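/- Let $d\in\mathbb N$, $\langle z\rangle=(1+|z|^2)^{1/2}$. For $k\in\mathbb R$ let $G^k$ be the set of $c\in C^\infty(\mathbb R^{2d})$ such that for every $\alpha\in\mathbb N^{2d}$ there is $C_\alpha$ with $|\partial^\alpha c(z)|\le C_\alpha\langle z\rangle^{k-|\alpha|}$ for all $z$. For $m\in\mathbb R$ let $G_h^m$ be the set of families $a=a(z;h)$, $0<h\le 1$, such that $a(\cdot\,;h)\in C^\infty(\mathbb R^{2d})$ for each $h$ and such that for every $\alpha\in\mathbb N^{2d}$ there is $C_\alpha$ with $$|\partial_z^\alpha a(z;h)|\le C_\alpha\,h^{|\alpha|}\langle hz\rangle^{m-|\alpha|},\qquad z\in\mathbb R^{2d},\ h\in(0,1].$$ For $a\in G^k$ the Weyl operator $a^w(x,D)$ on $\mathscr S(\mathbb R^d)$ is $$a^w(x,D)u(x)=\lim_{\varepsilon\to0+}(2\pi)^{-d}\iint\psi(\varepsilon\xi)\,e^{i(x-y)\cdot\xi}\,a\big(\tfrac{x+y}2,\xi\big)u(y)\,dy\,d\xi,$$ where $\psi\in C_c^\infty(\mathbb R^d)$ is any function that equals $1$ near the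 origin. The Weyl product $a\# b$ of $a,b\in\bigcup_kG^k$ is the symbol in $\bigcup_kG^k$ with $(a\# b)^w(x,D)=a^w(x,D)\,b^w(x,D)$ on $\mathscr S(\mathbb R^d)$; for families it is taken for each fixed $h$. **Theorem.** Let $m,n\in\mathbb R$, $a\in G_h^m$ and $b\in G_h^n$. Then for each $h\in(0,1]$ the Weyl product $a(\cdot\,;h)\# b(\cdot\,;h)$ exists and is unique, the family $a\# b$ belongs to $G_h^{m+n}$, and $$a\# b(z;h)\ \sim\ \sum_{j=0}^\infty h^{2j}\,c_j(z;h),\qquad c_j(z;h)=\frac{(i\sigma(D)/2)^j}{j!}\Big[a(\tfrac{X_1}h;h)\,b(\tfrac{X_2}h;h)\Big]_{X_1=X_2=hz},$$ where, for $X_1=(y,\eta)$, $X_2=(t,\theta)$ in $\mathbb R^{2d}$, $\sigma(D)=\sum_{k=1}^d\big(\partial_{y_k}\partial_{\theta_k}-\partial_{\eta_k}\partial_{t_k}\big)$. Here $\sim$ means that $c_j\in G_h^{m+n-2j}$ for every $j\ge0$ and that, for every $N\ge1$, $$h^{-2N}\Big(a\# b-\sum_{j=0}^{N-1}h^{2j}c_j\Big)\in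 G_h^{m+n-2N}.$$ -/

import Mathlib

open Set Filter Topology MeasureTheory
open scoped ContDiff SchwartzMap

noncomputable section

namespace ShubinCalculus

/-- Configuration space `ℝᵈ` with its Euclidean structure and Lebesgue measure. -/
abbrev Config (d : ℕ) : Type := EuclideanSpace ℝ (Fin d)

/-- Phase space `ℝ²ᵈ`, with points `z = (x, ξ)`. -/
abbrev Phase (d : ℕ) : Type := Config d × Config d

/-- The Japanese bracket `⟨z⟩ = (1 + |z|²)^{1/2}`, where `|z|² = |x|² + |ξ|²` is the Euclidean
norm (the norm that Mathlib puts on a product is the maximum norm). -/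
def japanese {d : ℕ} (z : Phase d) : ℝ := Real.sqrt (1 + ‖z.1‖ ^ 2 + ‖z.2‖ ^ 2)

/-- Shubin symbols of order `m`: smooth functions on `ℝ²ᵈ` with
`|∂^α a(z)| ≤ C_α ⟨z⟩^{m - |α|}` for all multi-indices `α`.
For each `k`, all partial derivatives of order `k` are bounded at once through the norm of the
`k`-th derivative. -/
def IsShubin {d : ℕ} (m : ℝ) (a : Phase d → ℂ) : Prop :=
  ContDiff ℝ ∞ a ∧
    ∀ k : ℕ, ∃ C : ℝ, ∀ z : Phase d,
      ‖iteratedFDeriv ℝ k a z‖ ≤ C * japanese z ^ (m - (k : ℝ))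

/-- `h`-Shubin symbols of order `m`: families `a h = a(·; h)`, `0 < h ≤ 1`, of smooth functions
on `ℝ²ᵈ` with `|∂_z^α a(z; h)| ≤ C_α h^{|α|} ⟨h z⟩^{m - |α|}`, where the constants do not depend
on `z` and `h`. Values at `h` outside `(0, 1]` play no role. -/
def IsHShubin {d : ℕ} (m : ℝ) (a : ℝ → Phase d → ℂ) : Prop :=
  (∀ h ∈ Ioc (0 : ℝ) 1, ContDiff ℝ ∞ (a h)) ∧
    ∀ k : ℕ, ∃ C : ℝ, ∀ h ∈ Ioc (0 : ℝ) 1, ∀ z : Phase d,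
      ‖iteratedFDeriv ℝ k (a h) z‖ ≤ C * h ^ k * japanese (h • z) ^ (m - (k : ℝ))

/-- Membership in `h^s G_h^m`: the family `h^{-s} a(·; h)` is an `h`-Shubin symbol of
order `m`. -/
def IsHPowShubin {d : ℕ} (s m : ℝ) (a : ℝ → Phase d → ℂ) : Prop :=
  IsHShubin m (fun h z => ((h ^ (-s) : ℝ) : ℂ) * a h z)

/-- The non-increasing envelope `max_{k ≥ j} μ_k` of a sequence of orders tending to `-∞`. -/
def orderEnvelope (μ : ℕ → ℝ) (j : ℕ) : ℝ := ⨆ k : ℕ, μ (j + k)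

/-- `a ∼ ∑_j h^{μ̃_0 - μ_j} a_j`, where `a_j` is an `h`-Shubin symbol of order `μ_j`, where
`μ_j → -∞`, and where `μ̃_j = max_{k ≥ j} μ_k`: for every `N ≥ 1` the remainder
`a - ∑_{j < N} h^{μ̃_0 - μ_j} a_j` belongs to `h^{μ̃_0 - μ̃_N} G_h^{μ̃_N}`. -/
structure HasAsymptoticExpansion {d : ℕ} (a : ℝ → Phase d → ℂ) (μ : ℕ → ℝ)
    (aj : ℕ → ℝ → Phase d → ℂ) : Prop where
  order_tendsto : Tendsto μ atTop atBot
  contDiff : ∀ h ∈ Ioc (0 : ℝ) 1, ContDiff ℝ ∞ (a h)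
  term_mem : ∀ j, IsHShubin (μ j) (aj j)
  remainder_mem : ∀ N : ℕ, 1 ≤ N →
    IsHPowShubin (orderEnvelope μ 0 - orderEnvelope μ N) (orderEnvelope μ N)
      (fun h z => a h z -
        ∑ j ∈ Finset.range N, ((h ^ (orderEnvelope μ 0 - μ j) : ℝ) : ℂ) * aj j h z)

/-- The regularized Weyl quantization
`(2π)^{-d} ∬ ψ(εξ) e^{i (x - y)·ξ} a((x + y)/2, ξ) u(y) dy dξ`; the integration variable is
`p = (y, ξ)`. -/
def regularizedWeyl {d : ℕ} (ψ : Config d → ℂ) (ε : ℝ) (a : Phase d → ℂ) (u : Config d → ℂ)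
    (x : Config d) : ℂ :=
  (((2 * Real.pi) ^ d : ℝ) : ℂ)⁻¹ *
    ∫ p : Config d × Config d,
      ψ (ε • p.2) * Complex.exp (Complex.I * ((inner ℝ (x - p.1) p.2 : ℝ) : ℂ)) *
        a ((1 / 2 : ℝ) • (x + p.1), p.2) * u p.1

/-- `a^w(x, D) u = v`, for Schwartz functions `u` and `v`: the regularized integrals converge
pointwise to `v` as `ε → 0+`, for every cutoff `ψ ∈ C_c^∞(ℝᵈ)` that equals one near the origin. -/
def WeylMapsTo {d : ℕ} (a : Phase d → ℂ) (u v : 𝓢(Config d, ℂ)) : Prop :=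
  ∀ ψ : Config d → ℂ, ContDiff ℝ ∞ ψ → HasCompactSupport ψ → (∀ᶠ ξ in 𝓝 0, ψ ξ = 1) →
    ∀ x : Config d,
      Tendsto (fun ε : ℝ => regularizedWeyl ψ ε a u x) (𝓝[>] 0) (𝓝 (v x))

/-- `c` is a Weyl product `a # b`: a Shubin symbol (of some order) such that
`c^w(x, D) = a^w(x, D) b^w(x, D)` on Schwartz functions. It is part of the assertion that the
three operators are defined on the Schwartz functions involved. -/
def IsWeylProduct {d : ℕ} (a b c : Phase d → ℂ) : Prop :=
  (∃ k : ℝ, IsShubin k c) ∧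
    ∀ u : 𝓢(Config d, ℂ), ∃ v w : 𝓢(Config d, ℂ),
      WeylMapsTo b u v ∧ WeylMapsTo a v w ∧ WeylMapsTo c u w

/-- The `k`-th coordinate vector of `ℝᵈ`. -/
def coordVec {d : ℕ} (k : Fin d) : Config d := EuclideanSpace.single k (1 : ℝ)

/-- The derivative of `F` in the direction `v`. -/
def dirDeriv {d : ℕ} (v : Phase d × Phase d) (F : Phase d × Phase d → ℂ)
    (X : Phase d × Phase d) : ℂ := fderiv ℝ F X v

/-- The operator `σ(D) = D_η·D_t - D_y·D_θ = ∑_k (∂_{y_k} ∂_{θ_k} - ∂_{η_k} ∂_{t_k})` on functions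
of `X = ((y, η), (t, θ)) ∈ ℝ⁴ᵈ`, where `D = -i ∂`. -/
def sigmaD {d : ℕ} (F : Phase d × Phase d → ℂ) (X : Phase d × Phase d) : ℂ :=
  ∑ k : Fin d,
    (dirDeriv ((coordVec k, 0), (0, 0)) (dirDeriv ((0, 0), (0, coordVec k)) F) X -
      dirDeriv ((0, coordVec k), (0, 0)) (dirDeriv ((0, 0), (coordVec k, 0)) F) X)

/-- The dilated tensor product `(a ⊗ b)_{h⁻¹}(z, w) = a(z/h; h) b(w/h; h)`. -/
def dilatedTensor {d : ℕ} (a b : ℝ → Phase d → ℂ) (h : ℝ) (X : Phase d × Phase d) : ℂ :=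
  a h (h⁻¹ • X.1) * b h (h⁻¹ • X.2)

/-- The terms `((i σ(D) / 2)^j / j!) (a ⊗ b)_{h⁻¹}`, evaluated at `h (z, z)`. -/
def weylTerm {d : ℕ} (a b : ℝ → Phase d → ℂ) (j : ℕ) (h : ℝ) (z : Phase d) : ℂ :=
  (Complex.I / 2) ^ j / (j.factorial : ℂ) * (sigmaD^[j] (dilatedTensor a b h)) (h • z, h • z)

end ShubinCalculus

end

open ShubinCalculus

/-!
The proof deforms the pointwise product into the Weyl product. Writing `a` as a superposition of
plane waves, put

  `T_τ(a, b)(z) = ∫ 𝓕a(ζ) e^{2πi⟨ζ, z⟩} b(z + τ Jζ) dζ`,   `Jζ = π (ζ₂, -ζ₁)`,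

for `0 ≤ τ ≤ 1` (`PW` for smooth compactly supported `a`, `T` in general). Then `T_0(a, b) = a b`
by Fourier inversion, and `T_1(a, b)` is the Weyl product.

*Meaning for general symbols.* Symbols are treated as amplitudes (`IsAmp`): functions of polynomial
growth whose derivatives grow no faster. The pairing `∫ 𝓕f · g` of two amplitudes is regularized by
trading powers of `1 - (4π²)⁻¹ Δ` for powers of `1 + |·|²` on both sides (`Pair`,
`integral_fourier_mul_eq_pair`). So it is bounded by finitely many seminorms and is continuous under
truncation (`exists_norm_pair_le`, `tendsto_pair`). With Peetre's inequality this gives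
`|T_τ(a, b)(z)| ≤ C A B ⟨hz⟩^{m + n}` as soon as finitely many derivatives of `a` and `b` are bounded
by `A ⟨hz⟩^m` and `B ⟨hz⟩^n`, uniformly in `τ` and `h` (`exists_norm_T_le`).

*The expansion.* The bilinear map `T_τ` obeys the Leibniz rule in `z` (`dd_T`), and
`d/dτ T_τ(a, b) = (i/2) ∑ (T_τ(∂_{x_k} a, ∂_{ξ_k} b) - T_τ(∂_{ξ_k} a, ∂_{x_k} b))`. Both follow from one
formula for increments in `(z, τ)` (`T_sub_eq_integral`). Integrating the second identity, the
remainder of order `N + 1` of the Taylor expansion in `τ` is an integral of remainders of order `N`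
of derivatives of `a` and `b` (`moyalRem_succ`). By induction on `N`, starting from the bound of
`T_τ`, the remainder gains `h^{2N}` and `2N` orders of decay, and the Leibniz rule extends this to
all derivatives (`exists_norm_iteratedFDeriv_moyalRem_le`). No stationary phase is needed. The Taylor
coefficients are the terms `h^{2j} c_j` (`weylTerm_eq_moyal`).

*`T_1` is the Weyl product.* The Weyl quantization of an amplitude is a convergent iterated integral
(`weylOp`, `weylMapsTo_of_eq`) and maps Schwartz functions to Schwartz functions (`weylS`). The
quantization of a plane wave is a translation times a character, so for compactly supported `a`
both `weylOp a` and `weylOp (T_1(a, b))` are superpositions of such operators, in the second case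
applied to `weylOp b u` (`weylOp_PW`, `weylOp_PW_eq_comp`). A limit of truncations gives the general
case (`weylOp_T`).

*Uniqueness.* If `weylOp c = 0`, evaluation at `x` of its action on `y ↦ g(x + y)` and Fourier
inversion in `x` show that `∫ e^{-i⟨q, ξ⟩} c(q/2, ξ) g(q) dq = 0` for all test functions `g`, whence
`c = 0` (`eq_zero_of_weylOp_eq_zero`).
-/

noncomputable section

namespace ShubinCalculus

/-! ### Directional derivatives and bounds for iterated derivatives -/

section Calculus

variable {E : Type*} [NormedAddCommGroup E] [NormedSpace ℝ E]

/-- The derivative of `f` in the direction `v`. -/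
def dd (v : E) (f : E → ℂ) (x : E) : ℂ := fderiv ℝ f x v

lemma contDiff_dd {f : E → ℂ} (hf : ContDiff ℝ ∞ f) (v : E) : ContDiff ℝ ∞ (dd v f) :=
  (hf.fderiv_right (m := ∞) (by simp)).clm_apply contDiff_const

lemma norm_iteratedFDeriv_dd_le {f : E → ℂ} (hf : ContDiff ℝ ∞ f) (v : E) (k : ℕ) (x : E) :
    ‖iteratedFDeriv ℝ k (dd v f) x‖ ≤ ‖v‖ * ‖iteratedFDeriv ℝ (k + 1) f x‖ := by
  have h := norm_iteratedFDeriv_clm_apply_const (𝕜 := ℝ) (f := fderiv ℝ f) (c := v) (x := x)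
    (N := ∞) (n := k) (hf.fderiv_right (m := ∞) (by simp)).contDiffAt (by exact_mod_cast le_top)
  rwa [norm_iteratedFDeriv_fderiv] at h

lemma dd_comm {f : E → ℂ} (hf : ContDiff ℝ ∞ f) (v w : E) : dd v (dd w f) = dd w (dd v f) := by
  funext x
  have h2 : ∀ a b : E, dd a (dd b f) x = fderiv ℝ (fderiv ℝ f) x a b := by
    intro a b
    have hd : DifferentiableAt ℝ (fderiv ℝ f) x :=
      ((hf.fderiv_right (m := ∞) (by simp)).differentiable (by simp)) x
    have := (hd.hasFDerivAt.clm_apply (hasFDerivAt_const b x)).fderiv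
    simp only [dd]
    change fderiv ℝ (fun y => fderiv ℝ f y b) x a = _
    rw [this]
    simp
  rw [h2, h2]
  exact (hf.contDiffAt.isSymmSndFDerivAt (n := ∞) (by
    rw [minSmoothness_of_isRCLikeNormedField]
    exact WithTop.coe_le_coe.2 (le_top : (2 : ℕ∞) ≤ ⊤))) v w

lemma dd_mul {f g : E → ℂ} (hf : ContDiff ℝ ∞ f) (hg : ContDiff ℝ ∞ g) (v : E) :
    dd v (fun x => f x * g x) = fun x => dd v f x * g x + f x * dd v g x := by
  funext x
  have h1 := ((hf.differentiable (by simp)) x).hasFDerivAt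
  have h2 := ((hg.differentiable (by simp)) x).hasFDerivAt
  simp only [dd]
  rw [(h1.fun_mul h2).fderiv]
  simp
  ring

lemma dd_sub {f g : E → ℂ} (hf : ContDiff ℝ ∞ f) (hg : ContDiff ℝ ∞ g) (v : E) :
    dd v (fun x => f x - g x) = fun x => dd v f x - dd v g x := by
  funext x
  simp only [dd]
  rw [fderiv_fun_sub ((hf.differentiable (by simp)) x) ((hg.differentiable (by simp)) x)]
  rfl

lemma dd_const_mul {f : E → ℂ} (hf : ContDiff ℝ ∞ f) (c : ℂ) (v : E) :
    dd v (fun x => c * f x) = fun x => c * dd v f x := by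
  funext x
  simp only [dd]
  rw [fderiv_const_mul ((hf.differentiable (by simp)) x)]
  rfl

lemma dd_sum {ι : Type*} (s : Finset ι) {f : ι → E → ℂ} (hf : ∀ i ∈ s, ContDiff ℝ ∞ (f i))
    (v : E) : dd v (fun x => ∑ i ∈ s, f i x) = fun x => ∑ i ∈ s, dd v (f i) x := by
  funext x
  simp only [dd]
  rw [fderiv_fun_sum (fun i hi => ((hf i hi).differentiable (by simp)) x)]
  simp

lemma dd_eq_sum [FiniteDimensional ℝ E] {ι : Type*} [Fintype ι] (B : Module.Basis ι ℝ E)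
    (f : E → ℂ) (v : E) : dd v f = fun x => ∑ i, (B.repr v i : ℂ) * dd (B i) f x := by
  funext x
  simp only [dd]
  conv_lhs => rw [← B.sum_repr v, map_sum]
  simp only [map_smul, Complex.real_smul]

/-- The norm of the `(k + 1)`-st derivative is controlled by the `k`-th derivatives of finitely many
directional derivatives: estimates of all derivatives reduce to estimates of functions. -/
lemma exists_norm_iteratedFDeriv_succ_le [FiniteDimensional ℝ E] {ι : Type*} [Fintype ι]
    (B : Module.Basis ι ℝ E) :
    ∃ C : ℝ, 0 ≤ C ∧ ∀ f : E → ℂ, ContDiff ℝ ∞ f → ∀ k x,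
      ‖iteratedFDeriv ℝ (k + 1) f x‖ ≤ C * ∑ i, ‖iteratedFDeriv ℝ k (dd (B i) f) x‖ := by
  let L : ι → (ℂ →L[ℝ] (E →L[ℝ] ℂ)) := fun i =>
    ContinuousLinearMap.smulRightL ℝ E ℂ (LinearMap.toContinuousLinearMap (B.coord i))
  refine ⟨∑ i, ‖L i‖, Finset.sum_nonneg fun i _ => norm_nonneg (L i), fun f hf k x => ?_⟩
  have hfd : fderiv ℝ f = fun x => ∑ i, (L i ∘ dd (B i) f) x := by
    funext y
    ext v
    have := congrFun (dd_eq_sum B f v) y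
    simp only [dd] at this
    simp [L, this, dd]
  have hL : ∀ i, ContDiff ℝ ∞ (L i ∘ dd (B i) f) := fun i =>
    (L i).contDiff.comp (contDiff_dd hf _)
  rw [← norm_iteratedFDeriv_fderiv, hfd, iteratedFDeriv_sum (fun i _ => (hL i).of_le
    (by exact_mod_cast le_top))]
  rw [Finset.sum_apply]
  refine (norm_sum_le _ _).trans ?_
  rw [Finset.mul_sum]
  refine Finset.sum_le_sum fun i _ => ?_
  refine ((L i).norm_iteratedFDeriv_comp_left (contDiff_dd hf (B i)).contDiffAt (n := k)
    (by exact_mod_cast le_top)).trans ?_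
  gcongr
  exact Finset.single_le_sum (f := fun i => ‖L i‖) (fun i _ => norm_nonneg (L i)) (Finset.mem_univ i)

lemma norm_iteratedFDeriv_mul_le_of_le {f g : E → ℂ} (hf : ContDiff ℝ ∞ f) (hg : ContDiff ℝ ∞ g)
    {x : E} {N : ℕ} {P Q : ℝ} (hP : ∀ j ≤ N, ‖iteratedFDeriv ℝ j f x‖ ≤ P)
    (hQ : ∀ j ≤ N, ‖iteratedFDeriv ℝ j g x‖ ≤ Q) :
    ∀ k ≤ N, ‖iteratedFDeriv ℝ k (fun y => f y * g y) x‖ ≤ 2 ^ N * (P * Q) := by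
  intro k hk
  have hP0 : 0 ≤ P := (norm_nonneg _).trans (hP 0 (Nat.zero_le _))
  have hQ0 : 0 ≤ Q := (norm_nonneg _).trans (hQ 0 (Nat.zero_le _))
  refine (norm_iteratedFDeriv_mul_le hf hg x (n := k) (by exact_mod_cast le_top)).trans ?_
  calc _ ≤ ∑ i ∈ Finset.range (k + 1), (k.choose i : ℝ) * (P * Q) := by
        refine Finset.sum_le_sum fun i hi => ?_
        rw [mul_assoc]
        have := Finset.mem_range.1 hi
        gcongr
        · exact hP i (by omega)
        · exact hQ (k - i) (by omega)
    _ = 2 ^ k * (P * Q) := by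
        rw [← Finset.sum_mul]
        congr 1
        exact_mod_cast Nat.sum_range_choose k
    _ ≤ _ := by
        gcongr
        norm_num

lemma contDiff_comp_affine {F : Type*} [NormedAddCommGroup F] [NormedSpace ℝ F] {f : E → ℂ}
    (hf : ContDiff ℝ ∞ f) (z : E) (L : F →L[ℝ] E) : ContDiff ℝ ∞ (fun y => f (z + L y)) :=
  hf.comp (contDiff_const.add L.contDiff)

lemma norm_iteratedFDeriv_comp_affine_le {F : Type*} [NormedAddCommGroup F] [NormedSpace ℝ F]
    {f : E → ℂ} (hf : ContDiff ℝ ∞ f) (z : E) (L : F →L[ℝ] E) (k : ℕ) (y : F) :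
    ‖iteratedFDeriv ℝ k (fun y => f (z + L y)) y‖ ≤
      ‖L‖ ^ k * ‖iteratedFDeriv ℝ k f (z + L y)‖ := by
  have hg : ContDiff ℝ ∞ (fun w => f (z + w)) := hf.comp (contDiff_const.add contDiff_id)
  have h := L.iteratedFDeriv_comp_right hg y (i := k) (by exact_mod_cast le_top)
  change ‖iteratedFDeriv ℝ k ((fun w => f (z + w)) ∘ L) y‖ ≤ _
  rw [h, iteratedFDeriv_comp_add_left]
  refine (ContinuousMultilinearMap.norm_compContinuousLinearMap_le _ _).trans ?_
  simp [mul_comm]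

lemma dd_comp_affine {F : Type*} [NormedAddCommGroup F] [NormedSpace ℝ F]
    {f : E → ℂ} (hf : ContDiff ℝ ∞ f) (z : E) (L : F →L[ℝ] E) (v : F) :
    dd v (fun y => f (z + L y)) = fun y => dd (L v) f (z + L y) := by
  funext y
  have h1 := ((hf.differentiable (by simp)) (z + L y)).hasFDerivAt
  have h2 : HasFDerivAt (fun y => z + L y) L y := by
    simpa using (L.hasFDerivAt (x := y)).const_add z
  simp only [dd]
  have := (h1.comp y h2).fderiv
  change fderiv ℝ (f ∘ fun y => z + L y) y v = _
  rw [this]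
  rfl

/-- The derivative along a straight line. -/
lemma hasDerivAt_comp_line {f : E → ℂ} (hf : ContDiff ℝ ∞ f) (z v : E) (s : ℝ) :
    HasDerivAt (fun s : ℝ => f (z + s • v)) (dd v f (z + s • v)) s := by
  have h1 := ((hf.differentiable (by simp)) (z + s • v)).hasFDerivAt
  have h2 : HasDerivAt (fun s : ℝ => z + s • v) v s := by
    simpa using ((hasDerivAt_id s).smul_const v).const_add z
  exact h1.comp_hasDerivAt s h2

/-! ### Amplitudes -/

/-- Amplitudes of order `2r`: smooth functions all of whose derivatives are
`O((1 + |x|²)^r)`, with no gain of decay under differentiation. -/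
def IsAmp (r : ℕ) (f : E → ℂ) : Prop :=
  ContDiff ℝ ∞ f ∧ ∀ k : ℕ, ∃ C : ℝ, ∀ x, ‖iteratedFDeriv ℝ k f x‖ ≤ C * (1 + ‖x‖ ^ 2) ^ r

/-- Constants for each order `k` give a common nonnegative constant for all orders `k ≤ N`. -/
lemma exists_uniform_of_forall {α : Type*} {F : ℕ → α → ℝ} {w : α → ℝ} (hw : ∀ x, 0 ≤ w x)
    (h : ∀ k, ∃ C : ℝ, ∀ x, F k x ≤ C * w x) (N : ℕ) :
    ∃ C : ℝ, 0 ≤ C ∧ ∀ k ≤ N, ∀ x, F k x ≤ C * w x := by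
  choose C hC using h
  refine ⟨∑ k ∈ Finset.range (N + 1), |C k|, Finset.sum_nonneg fun _ _ => abs_nonneg _,
    fun k hk x => (hC k x).trans ?_⟩
  refine mul_le_mul_of_nonneg_right ((le_abs_self _).trans ?_) (hw x)
  exact Finset.single_le_sum (f := fun k => |C k|) (fun _ _ => abs_nonneg _)
    (Finset.mem_range.2 (by omega))

lemma IsAmp.exists_bound {r : ℕ} {f : E → ℂ} (hf : IsAmp r f) (N : ℕ) :
    ∃ C : ℝ, 0 ≤ C ∧ ∀ k ≤ N, ∀ x, ‖iteratedFDeriv ℝ k f x‖ ≤ C * (1 + ‖x‖ ^ 2) ^ r :=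
  exists_uniform_of_forall (F := fun k x => ‖iteratedFDeriv ℝ k f x‖)
    (fun x => by positivity) hf.2 N

lemma IsAmp.exists_norm_le {r : ℕ} {f : E → ℂ} (hf : IsAmp r f) :
    ∃ C : ℝ, 0 ≤ C ∧ ∀ x, ‖f x‖ ≤ C * (1 + ‖x‖ ^ 2) ^ r := by
  obtain ⟨C, hC, h⟩ := hf.exists_bound 0
  exact ⟨C, hC, fun x => by simpa using h 0 le_rfl x⟩

lemma IsAmp.mono {r s : ℕ} (hrs : r ≤ s) {f : E → ℂ} (hf : IsAmp r f) : IsAmp s f := by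
  refine ⟨hf.1, fun k => ?_⟩
  obtain ⟨C, hC, h⟩ := hf.exists_bound k
  refine ⟨C, fun x => (h k le_rfl x).trans ?_⟩
  gcongr
  nlinarith [sq_nonneg ‖x‖]

lemma IsAmp.dd {r : ℕ} {f : E → ℂ} (hf : IsAmp r f) (v : E) : IsAmp r (dd v f) := by
  refine ⟨contDiff_dd hf.1 v, fun k => ?_⟩
  obtain ⟨C, h⟩ := hf.2 (k + 1)
  refine ⟨‖v‖ * C, fun x => (norm_iteratedFDeriv_dd_le hf.1 v k x).trans ?_⟩
  rw [mul_assoc]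
  exact mul_le_mul_of_nonneg_left (h x) (norm_nonneg v)

lemma isAmp_const (c : ℂ) : IsAmp 0 (fun _ : E => c) := by
  refine ⟨contDiff_const, fun k => ⟨‖c‖, fun x => ?_⟩⟩
  rcases Nat.eq_zero_or_pos k with rfl | hk
  · simp
  · rw [iteratedFDeriv_const_of_ne hk.ne']
    simp

lemma IsAmp.const_mul {r : ℕ} {f : E → ℂ} (hf : IsAmp r f) (c : ℂ) :
    IsAmp r (fun x => c * f x) := by
  refine ⟨contDiff_const.mul hf.1, fun k => ?_⟩
  obtain ⟨C, h⟩ := hf.2 k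
  refine ⟨‖c‖ * C, fun x => ?_⟩
  have : (fun x => c * f x) = c • f := rfl
  rw [this, iteratedFDeriv_const_smul_apply (hf.1.of_le (by exact_mod_cast le_top)).contDiffAt,
    norm_smul, mul_assoc]
  exact mul_le_mul_of_nonneg_left (h x) (norm_nonneg c)

lemma IsAmp.add {r : ℕ} {f g : E → ℂ} (hf : IsAmp r f) (hg : IsAmp r g) :
    IsAmp r (fun x => f x + g x) := by
  refine ⟨hf.1.add hg.1, fun k => ?_⟩
  obtain ⟨C, h⟩ := hf.2 k
  obtain ⟨C', h'⟩ := hg.2 k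
  refine ⟨C + C', fun x => ?_⟩
  have : (fun x => f x + g x) = f + g := rfl
  rw [this, iteratedFDeriv_add_apply (hf.1.of_le (by exact_mod_cast le_top)).contDiffAt
    (hg.1.of_le (by exact_mod_cast le_top)).contDiffAt, add_mul]
  exact (norm_add_le _ _).trans (add_le_add (h x) (h' x))

lemma IsAmp.sum {r : ℕ} {ι : Type*} (s : Finset ι) {f : ι → E → ℂ}
    (hf : ∀ i ∈ s, IsAmp r (f i)) : IsAmp r (fun x => ∑ i ∈ s, f i x) := by
  classical
  induction s using Finset.induction_on with
  | empty => simpa using (isAmp_const (E := E) 0).mono (Nat.zero_le r)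
  | insert a s ha ih =>
    simp only [Finset.sum_insert ha]
    exact (hf a (by simp)).add (ih fun i hi => hf i (by simp [hi]))

omit [NormedSpace ℝ E] in
lemma one_add_sq_add_le (x y : E) : 1 + ‖x + y‖ ^ 2 ≤ 2 * ((1 + ‖x‖ ^ 2) * (1 + ‖y‖ ^ 2)) := by
  have h1 := norm_add_le x y
  have h2 : ‖x + y‖ ^ 2 ≤ (‖x‖ + ‖y‖) ^ 2 := by gcongr
  nlinarith [sq_nonneg (‖x‖ - ‖y‖), mul_nonneg (sq_nonneg ‖x‖) (sq_nonneg ‖y‖)]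

lemma IsAmp.hasTemperateGrowth {r : ℕ} {f : E → ℂ} (hf : IsAmp r f) :
    f.HasTemperateGrowth := by
  refine ⟨hf.1, fun k => ?_⟩
  obtain ⟨C, hC, h⟩ := hf.exists_bound k
  refine ⟨2 * r, C, fun x => (h k le_rfl x).trans ?_⟩
  rw [pow_mul]
  gcongr
  nlinarith [norm_nonneg x]

end Calculus

/-! ### Powers of `1 + |x|²` -/

section Weights

variable {V : Type*} [NormedAddCommGroup V] [InnerProductSpace ℝ V]

/-- The function `(1 + |x|²)^{-K}`. -/
def rho (K : ℕ) (x : V) : ℂ := (((1 + ‖x‖ ^ 2 : ℝ) : ℂ)⁻¹) ^ K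

omit [InnerProductSpace ℝ V] in
lemma norm_rho (K : ℕ) (x : V) : ‖rho K x‖ = ((1 + ‖x‖ ^ 2) ^ K)⁻¹ := by
  simp only [rho, norm_pow, norm_inv, Complex.norm_real, Real.norm_eq_abs, inv_pow]
  rw [abs_of_pos (by positivity)]

lemma contDiff_inv_one_add_sq : ContDiff ℝ ∞ (fun x : V => (1 + ‖x‖ ^ 2)⁻¹) :=
  (contDiff_const.add (contDiff_norm_sq ℝ)).inv fun x => by positivity

lemma fderiv_inv_one_add_sq (x : V) :
    fderiv ℝ (fun x : V => (1 + ‖x‖ ^ 2)⁻¹) x =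
      (1 + ‖x‖ ^ 2)⁻¹ • ((1 + ‖x‖ ^ 2)⁻¹ • ((-2 : ℝ) • innerSL ℝ x)) := by
  have h1 : HasFDerivAt (fun x : V => 1 + ‖x‖ ^ 2) (2 • innerSL ℝ x) x :=
    ((hasStrictFDerivAt_norm_sq x).hasFDerivAt).const_add 1
  have h2 := (hasDerivAt_inv (x := 1 + ‖x‖ ^ 2) (by positivity)).comp_hasFDerivAt x h1
  rw [show (fun x : V => (1 + ‖x‖ ^ 2)⁻¹) = (fun t : ℝ => t⁻¹) ∘ (fun x : V => 1 + ‖x‖ ^ 2) from rfl,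
    h2.fderiv]
  ext v
  simp
  field_simp

/-- The derivatives of `(1 + |x|²)⁻¹` do not grow faster than the function itself. -/
lemma exists_iteratedFDeriv_inv_one_add_sq_le (N : ℕ) :
    ∃ C : ℝ, 0 ≤ C ∧ ∀ k ≤ N, ∀ x : V,
      ‖iteratedFDeriv ℝ k (fun x : V => (1 + ‖x‖ ^ 2)⁻¹) x‖ ≤ C * (1 + ‖x‖ ^ 2)⁻¹ := by
  set q : V → ℝ := fun x => (1 + ‖x‖ ^ 2)⁻¹ with hq
  have hqs : ContDiff ℝ ∞ q := contDiff_inv_one_add_sq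
  have hq0 : ∀ x, 0 ≤ q x := fun x => by simp only [hq]; positivity
  have hlin : ContDiff ℝ ∞ (fun x : V => (-2 : ℝ) • innerSL ℝ x) :=
    ((-2 : ℝ) • innerSL ℝ : V →L[ℝ] (V →L[ℝ] ℝ)).contDiff
  have hlinb : ∀ k, ∀ x : V, ‖iteratedFDeriv ℝ k (fun x : V => (-2 : ℝ) • innerSL ℝ x) x‖ ≤
      2 * (1 + ‖x‖) := by
    intro k x
    let L : V →L[ℝ] (V →L[ℝ] ℝ) := (-2 : ℝ) • innerSL ℝ
    have hL : ‖L‖ ≤ 2 := by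
      refine ContinuousLinearMap.opNorm_le_bound _ (by norm_num) fun v => ?_
      rw [show L v = (-2 : ℝ) • innerSL ℝ v from rfl, norm_smul]
      refine (mul_le_mul_of_nonneg_left (innerSL_apply_norm ℝ v).le (norm_nonneg _)).trans ?_
      norm_num
    change ‖iteratedFDeriv ℝ k L x‖ ≤ _
    match k with
    | 0 =>
      simp only [norm_iteratedFDeriv_zero]
      have := L.le_of_opNorm_le hL x
      linarith
    | 1 =>
      rw [← norm_iteratedFDeriv_fderiv, norm_iteratedFDeriv_zero, L.fderiv]
      linarith [norm_nonneg x]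
    | k + 2 =>
      rw [← norm_iteratedFDeriv_fderiv]
      have : fderiv ℝ L = fun _ => L := by funext y; exact L.fderiv
      rw [this, iteratedFDeriv_const_of_ne (by omega)]
      simp
      positivity
  induction N with
  | zero =>
    refine ⟨1, zero_le_one, fun k hk x => ?_⟩
    obtain rfl : k = 0 := by omega
    rw [norm_iteratedFDeriv_zero, one_mul, Real.norm_of_nonneg (hq0 x)]
  | succ N ih =>
    obtain ⟨C, hC, h⟩ := ih
    -- the product `q(x) x` has bounded derivatives of order at most `N`
    have h1 : ∀ k ≤ N, ∀ x : V,
        ‖iteratedFDeriv ℝ k (fun x : V => q x • ((-2 : ℝ) • innerSL ℝ x)) x‖ ≤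
          2 ^ N * (4 * C) := by
      intro k hk x
      refine (norm_iteratedFDeriv_smul_le hqs hlin x (n := k) (by exact_mod_cast le_top)).trans ?_
      calc _ ≤ ∑ i ∈ Finset.range (k + 1), (k.choose i : ℝ) * (4 * C) := by
            refine Finset.sum_le_sum fun i hi => ?_
            have := Finset.mem_range.1 hi
            rw [mul_assoc]
            refine mul_le_mul_of_nonneg_left ?_ (Nat.cast_nonneg _)
            calc _ ≤ (C * q x) * (2 * (1 + ‖x‖)) :=
                  mul_le_mul (h i (by omega) x) (hlinb _ x) (norm_nonneg _)
                    (mul_nonneg hC (hq0 x))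
              _ = C * (2 * (q x * (1 + ‖x‖))) := by ring
              _ ≤ C * (2 * 2) := by
                  gcongr
                  simp only [hq]
                  rw [inv_mul_le_iff₀ (by positivity)]
                  nlinarith [sq_nonneg (‖x‖ - 1)]
              _ = 4 * C := by ring
        _ = 2 ^ k * (4 * C) := by
            rw [← Finset.sum_mul]
            congr 1
            exact_mod_cast Nat.sum_range_choose k
        _ ≤ _ := by
            gcongr
            norm_num
    refine ⟨C + 2 ^ N * (C * (2 ^ N * (4 * C))), by positivity, fun k hk x => ?_⟩
    rcases Nat.lt_or_ge k (N + 1) with hk' | hk'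
    · refine (h k (by omega) x).trans ?_
      have := hq0 x
      gcongr
      have : 0 ≤ 2 ^ N * (C * (2 ^ N * (4 * C))) := by positivity
      linarith
    · obtain rfl : k = N + 1 := by omega
      have hfd : fderiv ℝ q = fun x => q x • (q x • ((-2 : ℝ) • innerSL ℝ x)) := by
        funext y
        exact fderiv_inv_one_add_sq y
      rw [← norm_iteratedFDeriv_fderiv, hfd]
      refine (norm_iteratedFDeriv_smul_le hqs (hqs.smul hlin) x (n := N)
        (by exact_mod_cast le_top)).trans ?_
      calc _ ≤ ∑ i ∈ Finset.range (N + 1), (N.choose i : ℝ) * ((C * q x) * (2 ^ N * (4 * C))) := by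
            refine Finset.sum_le_sum fun i hi => ?_
            have := Finset.mem_range.1 hi
            rw [mul_assoc]
            exact mul_le_mul_of_nonneg_left (mul_le_mul (h i (by omega) x) (h1 _ (by omega) x)
              (norm_nonneg _) (mul_nonneg hC (hq0 x))) (Nat.cast_nonneg _)
        _ = 2 ^ N * ((C * q x) * (2 ^ N * (4 * C))) := by
            rw [← Finset.sum_mul]
            congr 1
            exact_mod_cast Nat.sum_range_choose N
        _ = (2 ^ N * (C * (2 ^ N * (4 * C)))) * q x := by ring
        _ ≤ _ := by
            have := hq0 x
            gcongr
            linarith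

lemma contDiff_rho (K : ℕ) : ContDiff ℝ ∞ (rho K : V → ℂ) := by
  have h : ContDiff ℝ ∞ (fun x : V => ((1 + ‖x‖ ^ 2 : ℝ) : ℂ)⁻¹) := by
    have := Complex.ofRealCLM.contDiff.comp (n := ∞) (contDiff_inv_one_add_sq (V := V))
    convert! this using 1
    funext x
    simp
  exact h.pow K

lemma exists_iteratedFDeriv_rho_le (K N : ℕ) :
    ∃ C : ℝ, 0 ≤ C ∧ ∀ k ≤ N, ∀ x : V,
      ‖iteratedFDeriv ℝ k (rho K) x‖ ≤ C * ((1 + ‖x‖ ^ 2) ^ K)⁻¹ := by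
  induction K with
  | zero =>
    refine ⟨1, zero_le_one, fun k _ x => ?_⟩
    have : (rho 0 : V → ℂ) = fun _ => 1 := by funext; simp [rho]
    rw [this]
    rcases Nat.eq_zero_or_pos k with rfl | hk
    · simp
    · rw [iteratedFDeriv_const_of_ne hk.ne']
      simp
  | succ K ih =>
    obtain ⟨C, hC, h⟩ := ih
    obtain ⟨C', hC', h'⟩ := exists_iteratedFDeriv_inv_one_add_sq_le (V := V) N
    have h1 : (rho 1 : V → ℂ) = Complex.ofRealCLM ∘ (fun x : V => (1 + ‖x‖ ^ 2)⁻¹) := by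
      funext x
      simp [rho]
    have h1b : ∀ k ≤ N, ∀ x : V, ‖iteratedFDeriv ℝ k (rho 1) x‖ ≤ C' * (1 + ‖x‖ ^ 2)⁻¹ := by
      intro k hk x
      rw [h1]
      refine (Complex.ofRealCLM.norm_iteratedFDeriv_comp_left
        contDiff_inv_one_add_sq.contDiffAt (n := k) (by exact_mod_cast le_top)).trans ?_
      simpa using h' k hk x
    refine ⟨2 ^ N * (C * C'), by positivity, fun k hk x => ?_⟩
    have hmul : (rho (K + 1) : V → ℂ) = fun x => rho K x * rho 1 x := by
      funext y
      simp [rho, pow_succ]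
    rw [hmul]
    refine (norm_iteratedFDeriv_mul_le_of_le (contDiff_rho K) (contDiff_rho 1)
      (fun j hj => h j hj x) (fun j hj => h1b j hj x) k hk).trans (le_of_eq ?_)
    rw [pow_succ (1 + ‖x‖ ^ 2), mul_inv]
    ring

lemma integrable_inv_one_add_sq_pow [FiniteDimensional ℝ V] [MeasurableSpace V] [BorelSpace V]
    {K : ℕ} (hK : Module.finrank ℝ V < 2 * K) :
    Integrable (fun x : V => ((1 + ‖x‖ ^ 2) ^ K)⁻¹) := by
  have := integrable_rpow_neg_one_add_norm_sq (E := V) (μ := volume) (r := 2 * K)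
    (by exact_mod_cast hK)
  refine this.congr (Eventually.of_forall fun x => ?_)
  simp only
  rw [show -(2 * (K : ℝ)) / 2 = -(K : ℝ) by ring, Real.rpow_neg (by positivity), Real.rpow_natCast]

end Weights

/-! ### Regularized Fourier pairing -/

section Pairing

open scoped FourierTransform LineDeriv

variable {V : Type*} [NormedAddCommGroup V] [InnerProductSpace ℝ V] [FiniteDimensional ℝ V]

/-- The operator `1 - (4π²)⁻¹ Δ`, which the Fourier transform `𝓕` turns into multiplication by
`1 + |ζ|²`. -/
def Lam (f : V → ℂ) (x : V) : ℂ :=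
  f x - ((4 * Real.pi ^ 2 : ℝ) : ℂ)⁻¹ *
    ∑ i, dd (stdOrthonormalBasis ℝ V i) (dd (stdOrthonormalBasis ℝ V i) f) x

lemma contDiff_Lam {f : V → ℂ} (hf : ContDiff ℝ ∞ f) : ContDiff ℝ ∞ (Lam f) :=
  hf.sub (contDiff_const.mul (ContDiff.sum fun _ _ => contDiff_dd (contDiff_dd hf _) _))

lemma contDiff_iterate_Lam {f : V → ℂ} (hf : ContDiff ℝ ∞ f) (K : ℕ) :
    ContDiff ℝ ∞ (Lam^[K] f) := by
  induction K with
  | zero => exact hf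
  | succ K ih =>
    rw [Function.iterate_succ_apply']
    exact contDiff_Lam ih

omit [FiniteDimensional ℝ V] in
lemma dd_congr {f g : V → ℂ} {x : V} (h : f =ᶠ[𝓝 x] g) (v : V) : dd v f =ᶠ[𝓝 x] dd v g := by
  filter_upwards [h.fderiv (𝕜 := ℝ)] with y hy
  simp only [dd, hy]

lemma Lam_congr {f g : V → ℂ} {x : V} (h : f =ᶠ[𝓝 x] g) : Lam f =ᶠ[𝓝 x] Lam g := by
  have h2 : ∀ᶠ y in 𝓝 x, ∀ i, dd (stdOrthonormalBasis ℝ V i) (dd (stdOrthonormalBasis ℝ V i) f) y =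
      dd (stdOrthonormalBasis ℝ V i) (dd (stdOrthonormalBasis ℝ V i) g) y :=
    eventually_all.2 fun i => dd_congr (dd_congr h _) _
  filter_upwards [h, h2] with y hy hy2
  simp only [Lam, hy, hy2]

lemma iterate_Lam_congr {f g : V → ℂ} {x : V} (h : f =ᶠ[𝓝 x] g) (K : ℕ) :
    Lam^[K] f =ᶠ[𝓝 x] Lam^[K] g := by
  induction K with
  | zero => exact h
  | succ K ih =>
    rw [Function.iterate_succ_apply', Function.iterate_succ_apply']
    exact Lam_congr ih

variable (V) in
/-- A pointwise bound: `Lam^K` costs `2K` derivatives. -/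
lemma exists_iteratedFDeriv_iterate_Lam_le (K : ℕ) :
    ∃ C : ℝ, 0 ≤ C ∧ ∀ f : V → ℂ, ContDiff ℝ ∞ f → ∀ (N : ℕ) (x : V) (A : ℝ),
      (∀ k ≤ N + 2 * K, ‖iteratedFDeriv ℝ k f x‖ ≤ A) →
        ∀ k ≤ N, ‖iteratedFDeriv ℝ k (Lam^[K] f) x‖ ≤ C * A := by
  induction K with
  | zero => exact ⟨1, zero_le_one, fun f _ N x A h k hk => by simpa using h k (by omega)⟩
  | succ K ih =>
    obtain ⟨C, hC, h⟩ := ih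
    set b := stdOrthonormalBasis ℝ V
    set c : ℂ := ((4 * Real.pi ^ 2 : ℝ) : ℂ)⁻¹
    refine ⟨C + ‖c‖ * (Fintype.card (Fin (Module.finrank ℝ V)) * C), by positivity,
      fun f hf N x A hA k hk => ?_⟩
    have hg := contDiff_iterate_Lam hf K
    set g := Lam^[K] f
    have hgb : ∀ k ≤ N + 2, ‖iteratedFDeriv ℝ k g x‖ ≤ C * A :=
      h f hf (N + 2) x A fun k hk => hA k (by omega)
    rw [Function.iterate_succ_apply']
    have hs : ContDiff ℝ ∞ (fun y => ∑ i, dd (b i) (dd (b i) g) y) :=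
      ContDiff.sum fun _ _ => contDiff_dd (contDiff_dd hg _) _
    have e1 : Lam g = g - c • fun y => ∑ i, dd (b i) (dd (b i) g) y := rfl
    have hkl : ∀ {F : V → ℂ}, ContDiff ℝ ∞ F → ContDiffAt ℝ k F x := fun hF =>
      (hF.of_le (by exact_mod_cast le_top)).contDiffAt
    rw [e1, iteratedFDeriv_sub_apply (hkl hg) (show ContDiffAt ℝ k
        (c • fun y => ∑ i, dd (b i) (dd (b i) g) y) x from (hkl hs).const_smul c),
      iteratedFDeriv_const_smul_apply (hkl hs)]
    rw [iteratedFDeriv_sum (fun i _ => (contDiff_dd (contDiff_dd hg _) _).of_le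
      (by exact_mod_cast le_top)), Finset.sum_apply]
    refine (norm_sub_le _ _).trans ?_
    rw [norm_smul, add_mul, mul_assoc, mul_assoc]
    refine add_le_add (hgb k (by omega)) (mul_le_mul_of_nonneg_left ?_ (norm_nonneg _))
    refine (norm_sum_le _ _).trans ((Finset.sum_le_card_nsmul _ _ (C * A) fun i _ => ?_).trans
      (by simp))
    refine (norm_iteratedFDeriv_dd_le (contDiff_dd hg _) _ _ _).trans ?_
    rw [b.norm_eq_one, one_mul]
    refine (norm_iteratedFDeriv_dd_le hg _ _ _).trans ?_
    rw [b.norm_eq_one, one_mul]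
    exact hgb _ (by omega)

/-- `Lam` on Schwartz functions. -/
def LamS (f : 𝓢(V, ℂ)) : 𝓢(V, ℂ) :=
  f - ((4 * Real.pi ^ 2 : ℝ) : ℂ)⁻¹ •
    ∑ i, ∂_{(stdOrthonormalBasis ℝ V i : V)} (∂_{(stdOrthonormalBasis ℝ V i : V)} f)

lemma coe_LamS (f : 𝓢(V, ℂ)) : ⇑(LamS f) = Lam f := by
  have h : ∀ (v : V) (g : 𝓢(V, ℂ)), ⇑(∂_{v} g : 𝓢(V, ℂ)) = dd v g := fun v g => by
    funext x
    exact SchwartzMap.lineDerivOp_apply_eq_fderiv v g x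
  funext x
  simp [LamS, Lam, h, sum_apply]

lemma coe_iterate_LamS (f : 𝓢(V, ℂ)) (K : ℕ) : ⇑(LamS^[K] f) = Lam^[K] f := by
  induction K with
  | zero => rfl
  | succ K ih => rw [Function.iterate_succ_apply', Function.iterate_succ_apply', coe_LamS, ih]

omit [FiniteDimensional ℝ V] in
lemma hasTemperateGrowth_one_add_sq_pow (K : ℕ) :
    (fun x : V => (((1 + ‖x‖ ^ 2) ^ K : ℝ) : ℂ)).HasTemperateGrowth := by
  have h : (fun x : V => (1 + ‖x‖ ^ 2 : ℝ)).HasTemperateGrowth :=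
    (Function.HasTemperateGrowth.const 1).add (Function.hasTemperateGrowth_norm_sq (H := V))
  exact Function.Complex.hasTemperateGrowth_ofReal.comp (h.pow K)

variable [MeasurableSpace V] [BorelSpace V]

omit [FiniteDimensional ℝ V] [MeasurableSpace V] [BorelSpace V] in
lemma hasTemperateGrowth_dd {G : V → ℂ} (hG : G.HasTemperateGrowth) (v : V) :
    (dd v G).HasTemperateGrowth := by
  refine ⟨contDiff_dd hG.1 v, fun n => ?_⟩
  obtain ⟨k, C, h⟩ := hG.2 (n + 1)
  refine ⟨k, ‖v‖ * C, fun x => (norm_iteratedFDeriv_dd_le hG.1 v n x).trans ?_⟩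
  rw [mul_assoc]
  exact mul_le_mul_of_nonneg_left (h x) (norm_nonneg v)

lemma integrable_schwartz_mul (F : 𝓢(V, ℂ)) {G : V → ℂ} (hG : G.HasTemperateGrowth) :
    Integrable (fun x => F x * G x) := by
  refine (SchwartzMap.smulLeftCLM ℂ G F).integrable.congr (Eventually.of_forall fun x => ?_)
  simp [hG, mul_comm]

lemma integral_lineDeriv_mul (F : 𝓢(V, ℂ)) {G : V → ℂ} (hG : G.HasTemperateGrowth) (v : V) :
    ∫ x, (∂_{v} F : 𝓢(V, ℂ)) x * G x = - ∫ x, F x * dd v G x := by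
  have h := integral_mul_fderiv_eq_neg_fderiv_mul_of_integrable (μ := volume) (f := G) (g := F)
    (v := v)
    (by simpa only [mul_comm, dd] using integrable_schwartz_mul F (hasTemperateGrowth_dd hG v))
    (by
      have := integrable_schwartz_mul (∂_{v} F : 𝓢(V, ℂ)) hG
      simpa only [mul_comm, SchwartzMap.lineDerivOp_apply_eq_fderiv] using this)
    (by simpa only [mul_comm] using integrable_schwartz_mul F hG)
    (fun x _ => (hG.1.differentiable (by simp)) x) (fun x _ => F.differentiableAt)
  simp only [dd, SchwartzMap.lineDerivOp_apply_eq_fderiv]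
  simpa only [mul_comm] using h

lemma integral_LamS_mul (F : 𝓢(V, ℂ)) {G : V → ℂ} (hG : G.HasTemperateGrowth) :
    ∫ x, LamS F x * G x = ∫ x, F x * Lam G x := by
  set b := stdOrthonormalBasis ℝ V with hb
  set c : ℂ := ((4 * Real.pi ^ 2 : ℝ) : ℂ)⁻¹ with hc
  have e1 : ∀ x, LamS F x * G x =
      F x * G x - c * ∑ i, (∂_{(b i : V)} (∂_{(b i : V)} F) : 𝓢(V, ℂ)) x * G x := by
    intro x
    simp only [LamS, ← hb, ← hc, sub_apply, smul_apply, sum_apply,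
      smul_eq_mul, sub_mul, Finset.sum_mul, mul_assoc]
  have e2 : ∀ x, F x * Lam G x = F x * G x - c * ∑ i, F x * dd (b i) (dd (b i) G) x := by
    intro x
    simp only [Lam, ← hb, ← hc, Finset.mul_sum, mul_sub]
    congr 1
    exact Finset.sum_congr rfl fun i _ => by ring
  simp only [e1, e2]
  have i0 := integrable_schwartz_mul F hG
  have i1 : ∀ i ∈ Finset.univ, Integrable fun x => (∂_{(b i : V)} (∂_{(b i : V)} F) : 𝓢(V, ℂ)) x * G x :=
    fun i _ => integrable_schwartz_mul _ hG
  have i2 : ∀ i ∈ Finset.univ, Integrable fun x => F x * dd (b i) (dd (b i) G) x := fun i _ =>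
    integrable_schwartz_mul F (hasTemperateGrowth_dd (hasTemperateGrowth_dd hG _) _)
  rw [integral_sub i0 ((integrable_finsetSum _ i1).const_mul c),
    integral_sub i0 ((integrable_finsetSum _ i2).const_mul c), integral_const_mul,
    integral_const_mul, integral_finsetSum _ i1, integral_finsetSum _ i2]
  congr 2
  refine Finset.sum_congr rfl fun i _ => ?_
  rw [integral_lineDeriv_mul _ hG, integral_lineDeriv_mul _ (hasTemperateGrowth_dd hG _), neg_neg]

lemma fourier_LamS (f : 𝓢(V, ℂ)) (ζ : V) :
    𝓕 (LamS f) ζ = ((1 + ‖ζ‖ ^ 2 : ℝ) : ℂ) * 𝓕 f ζ := by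
  have hg : ∀ m : V, (inner ℝ · m).HasTemperateGrowth := fun m => by fun_prop
  set b := stdOrthonormalBasis ℝ V with hb
  set c : ℂ := ((4 * Real.pi ^ 2 : ℝ) : ℂ)⁻¹ with hc
  have hD : ∀ (m : V) (g : 𝓢(V, ℂ)),
      𝓕 (∂_{m} g : 𝓢(V, ℂ)) ζ = 2 * Real.pi * Complex.I * (inner ℝ ζ m : ℝ) * 𝓕 g ζ := by
    intro m g
    rw [SchwartzMap.fourier_lineDerivOp_eq]
    simp [hg]
    ring
  have h : 𝓕 (LamS f) = SchwartzMap.fourierTransformCLM ℂ (LamS f) := by simp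
  rw [h, LamS, map_sub, map_smul, map_sum]
  simp only [SchwartzMap.fourierTransformCLM_apply, sub_apply, smul_apply, sum_apply, hD,
    smul_eq_mul, ← hb, ← hc]
  have hs : (∑ i, ((inner ℝ ζ (b i) : ℝ) : ℂ) ^ 2) = ((‖ζ‖ ^ 2 : ℝ) : ℂ) := by
    rw [← b.sum_sq_norm_inner_left ζ]
    push_cast
    refine Finset.sum_congr rfl fun i _ => ?_
    rw [← Complex.ofReal_pow, ← Complex.ofReal_pow, Real.norm_eq_abs, sq_abs]
  have hpi : (Real.pi : ℂ) ≠ 0 := by exact_mod_cast Real.pi_ne_zero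
  calc _ = 𝓕 f ζ - c * ((2 * Real.pi * Complex.I) ^ 2 *
        (∑ i, ((inner ℝ ζ (b i) : ℝ) : ℂ) ^ 2) * 𝓕 f ζ) := by
        rw [Finset.mul_sum Finset.univ _ ((2 * (Real.pi : ℂ) * Complex.I) ^ 2), Finset.sum_mul]
        congr 2
        exact Finset.sum_congr rfl fun i _ => by ring
    _ = _ := by
        rw [hs, hc, mul_pow, Complex.I_sq]
        push_cast
        field_simp
        ring

/-- The dual of `fourier_LamS`: `1 - (4π²)⁻¹ Δ` acts on Fourier transforms as multiplication by
`1 + |x|²` on the original side. -/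
lemma LamS_fourier (f : 𝓢(V, ℂ)) :
    LamS (𝓕 f) = 𝓕 (SchwartzMap.smulLeftCLM ℂ (fun x : V => (((1 + ‖x‖ ^ 2) ^ 1 : ℝ) : ℂ)) f) := by
  have hg : ∀ m : V, (inner ℝ · m).HasTemperateGrowth := fun m => by fun_prop
  set b := stdOrthonormalBasis ℝ V with hb
  set c : ℂ := ((4 * Real.pi ^ 2 : ℝ) : ℂ)⁻¹ with hc
  have h : ∀ g : 𝓢(V, ℂ), 𝓕 g = SchwartzMap.fourierTransformCLM ℂ g := fun g => by simp
  simp only [LamS, ← hb, ← hc, SchwartzMap.lineDerivOp_fourier_eq]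
  simp only [h]
  rw [← map_sum, ← map_smul, ← map_sub]
  congr 1
  ext x
  have hs : (∑ i, ((inner ℝ x (b i) : ℝ) : ℂ) ^ 2) = ((‖x‖ ^ 2 : ℝ) : ℂ) := by
    rw [← b.sum_sq_norm_inner_left x]
    push_cast
    refine Finset.sum_congr rfl fun i _ => ?_
    rw [← Complex.ofReal_pow, ← Complex.ofReal_pow, Real.norm_eq_abs, sq_abs]
  have hpi : (Real.pi : ℂ) ≠ 0 := by exact_mod_cast Real.pi_ne_zero
  rw [SchwartzMap.smulLeftCLM_apply_apply (hasTemperateGrowth_one_add_sq_pow 1)]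
  simp only [sub_apply, smul_apply, sum_apply, SchwartzMap.smulLeftCLM_apply_apply (hg _),
    smul_eq_mul, Complex.real_smul]
  calc _ = f x - c * ((2 * Real.pi * Complex.I) ^ 2 *
        (∑ i, ((inner ℝ x (b i) : ℝ) : ℂ) ^ 2) * f x) := by
        rw [Finset.mul_sum Finset.univ _ ((2 * (Real.pi : ℂ) * Complex.I) ^ 2), Finset.sum_mul]
        congr 2
        exact Finset.sum_congr rfl fun i _ => by ring
    _ = _ := by
        rw [hs, hc, mul_pow, Complex.I_sq]
        push_cast
        field_simp
        ring

lemma fourier_iterate_LamS (f : 𝓢(V, ℂ)) (K : ℕ) (ζ : V) :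
    𝓕 (LamS^[K] f) ζ = ((1 + ‖ζ‖ ^ 2 : ℝ) : ℂ) ^ K * 𝓕 f ζ := by
  induction K with
  | zero => simp
  | succ K ih => rw [Function.iterate_succ_apply', fourier_LamS, ih, pow_succ]; ring

lemma iterate_LamS_fourier (f : 𝓢(V, ℂ)) (K : ℕ) :
    LamS^[K] (𝓕 f) =
      𝓕 (SchwartzMap.smulLeftCLM ℂ (fun x : V => (((1 + ‖x‖ ^ 2) ^ K : ℝ) : ℂ)) f) := by
  induction K with
  | zero => simp
  | succ K ih =>
    rw [Function.iterate_succ_apply', ih, LamS_fourier,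
      SchwartzMap.smulLeftCLM_smulLeftCLM_apply (hasTemperateGrowth_one_add_sq_pow 1)
        (hasTemperateGrowth_one_add_sq_pow K)]
    congr 3
    funext x
    simp [pow_succ, mul_comm]

lemma integral_iterate_LamS_mul (F : 𝓢(V, ℂ)) {r : ℕ} {G : V → ℂ} (hG : IsAmp r G) (K : ℕ) :
    ∫ x, LamS^[K] F x * G x = ∫ x, F x * Lam^[K] G x := by
  induction K generalizing F G with
  | zero => rfl
  | succ K ih =>
    have hLG : IsAmp r (Lam G) := by
      have h : IsAmp r (fun x => G x + -((4 * Real.pi ^ 2 : ℝ) : ℂ)⁻¹ *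
          ∑ i, dd (stdOrthonormalBasis ℝ V i) (dd (stdOrthonormalBasis ℝ V i) G) x) :=
        hG.add ((IsAmp.sum _ fun i _ => (hG.dd _).dd _).const_mul _)
      convert! h using 1
      funext x
      simp only [Lam]
      ring
    rw [Function.iterate_succ_apply', integral_LamS_mul _ hG.hasTemperateGrowth, ih _ hLG,
      Function.iterate_succ_apply]

/-- The oscillatory pairing `∫ 𝓕f · g` in a form that makes sense when neither `f` nor `g` decays:
powers of `1 - (4π²)⁻¹ Δ` and of `1 + |·|²` are traded for each other, on both sides. -/
def Pair (K : ℕ) (f g : V → ℂ) : ℂ :=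
  ∫ ζ, 𝓕 (fun w => rho K w * Lam^[K] f w) ζ * Lam^[K] (fun ζ => rho K ζ * g ζ) ζ

omit [FiniteDimensional ℝ V] [MeasurableSpace V] [BorelSpace V] in
lemma isAmp_rho (K : ℕ) : IsAmp 0 (rho K : V → ℂ) := by
  refine ⟨contDiff_rho K, fun k => ?_⟩
  obtain ⟨C, hC, h⟩ := exists_iteratedFDeriv_rho_le (V := V) K k
  refine ⟨C, fun x => (h k le_rfl x).trans ?_⟩
  gcongr
  rw [pow_zero]
  exact inv_le_one_of_one_le₀ (one_le_pow₀ (by nlinarith [sq_nonneg ‖x‖]))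

omit [FiniteDimensional ℝ V] [MeasurableSpace V] [BorelSpace V] in
lemma IsAmp.mul {r s : ℕ} {f g : V → ℂ} (hf : IsAmp r f) (hg : IsAmp s g) :
    IsAmp (r + s) (fun x => f x * g x) := by
  refine ⟨hf.1.mul hg.1, fun k => ?_⟩
  obtain ⟨C, hC, h⟩ := hf.exists_bound k
  obtain ⟨C', hC', h'⟩ := hg.exists_bound k
  refine ⟨2 ^ k * (C * C'), fun x => ?_⟩
  refine (norm_iteratedFDeriv_mul_le_of_le hf.1 hg.1 (fun j hj => h j hj x)
    (fun j hj => h' j hj x) k le_rfl).trans (le_of_eq ?_)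
  rw [pow_add]
  ring

/-- For Schwartz `f` the regularized pairing is the classical integral `∫ 𝓕f · g`, whatever `K`. The
factor `(1 + |ζ|²)^K` moves from `g` to `f` as `Lam^K`, and the factor `(1 + |w|²)^K` moves from `f`
back to `g` as `Lam^K`. -/
lemma integral_fourier_mul_eq_pair (f : 𝓢(V, ℂ)) {r : ℕ} {g : V → ℂ} (hg : IsAmp r g) (K : ℕ) :
    ∫ ζ, 𝓕 f ζ * g ζ = Pair K f g := by
  have hrho := isAmp_rho (V := V) K
  have hne : ∀ x : V, ((1 + ‖x‖ ^ 2 : ℝ) : ℂ) ≠ 0 := fun x => by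
    have : (0 : ℝ) < 1 + ‖x‖ ^ 2 := by positivity
    exact_mod_cast this.ne'
  set k := SchwartzMap.smulLeftCLM ℂ (rho K) (LamS^[K] f) with hk
  have hkc : ⇑k = fun w => rho K w * Lam^[K] f w := by
    funext w
    rw [hk, SchwartzMap.smulLeftCLM_apply_apply hrho.hasTemperateGrowth, coe_iterate_LamS,
      smul_eq_mul]
  have hk2 : SchwartzMap.smulLeftCLM ℂ (fun x : V => (((1 + ‖x‖ ^ 2) ^ K : ℝ) : ℂ)) k =
      LamS^[K] f := by
    ext x
    rw [SchwartzMap.smulLeftCLM_apply_apply (hasTemperateGrowth_one_add_sq_pow K), hkc,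
      coe_iterate_LamS]
    simp only [rho, smul_eq_mul, Complex.ofReal_pow, inv_pow]
    rw [← mul_assoc, mul_inv_cancel₀ (pow_ne_zero _ (hne x)), one_mul]
  calc ∫ ζ, 𝓕 f ζ * g ζ = ∫ ζ, (𝓕 (LamS^[K] f)) ζ * (rho K ζ * g ζ) := by
        refine integral_congr_ae (Eventually.of_forall fun ζ => ?_)
        simp only [fourier_iterate_LamS, rho, inv_pow]
        have := pow_ne_zero K (hne ζ)
        field_simp
    _ = ∫ ζ, (LamS^[K] (𝓕 k)) ζ * (rho K ζ * g ζ) := by rw [iterate_LamS_fourier, hk2]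
    _ = ∫ ζ, 𝓕 k ζ * Lam^[K] (fun ζ => rho K ζ * g ζ) ζ :=
        integral_iterate_LamS_mul _ (hrho.mul hg) K
    _ = _ := by
        rw [Pair, ← hkc, SchwartzMap.fourier_coe]

omit [MeasurableSpace V] [BorelSpace V] in
/-- With `K = r + dim V + 1` the weight `(1 + |x|²)^{-K}` absorbs the growth of an amplitude of order
`2r` and leaves an integrable function. -/
lemma exists_norm_rho_mul_iterate_Lam_le (r : ℕ) :
    ∃ C : ℝ, 0 ≤ C ∧ ∀ f : V → ℂ, ContDiff ℝ ∞ f → ∀ A : ℝ,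
      (∀ k ≤ 2 * (r + Module.finrank ℝ V + 1), ∀ x,
        ‖iteratedFDeriv ℝ k f x‖ ≤ A * (1 + ‖x‖ ^ 2) ^ r) →
      ∀ x, ‖rho (r + Module.finrank ℝ V + 1) x * Lam^[r + Module.finrank ℝ V + 1] f x‖ ≤
        C * A * ((1 + ‖x‖ ^ 2) ^ (Module.finrank ℝ V + 1))⁻¹ := by
  obtain ⟨C, hC, h⟩ := exists_iteratedFDeriv_iterate_Lam_le V (r + Module.finrank ℝ V + 1)
  refine ⟨C, hC, fun f hf A hA x => ?_⟩
  have h1 := h f hf 0 x (A * (1 + ‖x‖ ^ 2) ^ r) (fun k hk => hA k (by omega) x) 0 le_rfl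
  rw [norm_iteratedFDeriv_zero] at h1
  rw [norm_mul, norm_rho]
  refine (mul_le_mul_of_nonneg_left h1 (by positivity)).trans (le_of_eq ?_)
  rw [add_assoc, pow_add]
  field_simp

omit [MeasurableSpace V] [BorelSpace V] in
lemma exists_norm_iterate_Lam_rho_mul_le (r : ℕ) :
    ∃ C : ℝ, 0 ≤ C ∧ ∀ g : V → ℂ, ContDiff ℝ ∞ g → ∀ B : ℝ,
      (∀ k ≤ 2 * (r + Module.finrank ℝ V + 1), ∀ x,
        ‖iteratedFDeriv ℝ k g x‖ ≤ B * (1 + ‖x‖ ^ 2) ^ r) →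
      ∀ x, ‖Lam^[r + Module.finrank ℝ V + 1]
          (fun x => rho (r + Module.finrank ℝ V + 1) x * g x) x‖ ≤
        C * B * ((1 + ‖x‖ ^ 2) ^ (Module.finrank ℝ V + 1))⁻¹ := by
  set K := r + Module.finrank ℝ V + 1 with hK
  obtain ⟨C, hC, h⟩ := exists_iteratedFDeriv_iterate_Lam_le V K
  obtain ⟨C', hC', h'⟩ := exists_iteratedFDeriv_rho_le (V := V) K (2 * K)
  refine ⟨C * (2 ^ (2 * K) * C'), by positivity, fun g hg B hB x => ?_⟩
  have h1 := norm_iteratedFDeriv_mul_le_of_le (contDiff_rho K) hg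
    (fun j hj => h' j hj x) (fun j hj => hB j hj x)
  have h2 := h _ ((contDiff_rho K).mul hg) 0 x _ (fun k hk => h1 k (by omega)) 0 le_rfl
  rw [norm_iteratedFDeriv_zero] at h2
  refine h2.trans (le_of_eq ?_)
  rw [hK, add_assoc, pow_add (1 + ‖x‖ ^ 2)]
  field_simp

lemma integrable_of_norm_le_inv {f : V → ℂ} (hf : Continuous f) {C : ℝ}
    (h : ∀ x, ‖f x‖ ≤ C * ((1 + ‖x‖ ^ 2) ^ (Module.finrank ℝ V + 1))⁻¹) : Integrable f :=
  ((integrable_inv_one_add_sq_pow (V := V) (K := Module.finrank ℝ V + 1) (by omega)).const_mul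
    C).mono' hf.aestronglyMeasurable (Eventually.of_forall h)

lemma norm_fourier_le (f : V → ℂ) (ζ : V) : ‖𝓕 f ζ‖ ≤ ∫ x, ‖f x‖ :=
  VectorFourier.norm_fourierIntegral_le_integral_norm _ _ _ _ _

lemma continuous_fourier {f : V → ℂ} (hf : Integrable f) : Continuous (𝓕 f) :=
  VectorFourier.fourierIntegral_continuous Real.continuous_fourierChar
    (innerSL ℝ).continuous₂ hf

variable (V) in
/-- The regularized pairing of two amplitudes is bounded by finitely many of their seminorms. -/
lemma exists_norm_pair_le (r : ℕ) :
    ∃ C : ℝ, 0 ≤ C ∧ ∀ f g : V → ℂ, ContDiff ℝ ∞ f → ContDiff ℝ ∞ g → ∀ A B : ℝ,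
      (∀ k ≤ 2 * (r + Module.finrank ℝ V + 1), ∀ x,
        ‖iteratedFDeriv ℝ k f x‖ ≤ A * (1 + ‖x‖ ^ 2) ^ r) →
      (∀ k ≤ 2 * (r + Module.finrank ℝ V + 1), ∀ x,
        ‖iteratedFDeriv ℝ k g x‖ ≤ B * (1 + ‖x‖ ^ 2) ^ r) →
      ‖Pair (r + Module.finrank ℝ V + 1) f g‖ ≤ C * A * B := by
  obtain ⟨C, hC, h⟩ := exists_norm_rho_mul_iterate_Lam_le (V := V) r
  obtain ⟨C', hC', h'⟩ := exists_norm_iterate_Lam_rho_mul_le (V := V) r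
  set K := r + Module.finrank ℝ V + 1 with hK
  set I : ℝ := ∫ x : V, ((1 + ‖x‖ ^ 2) ^ (Module.finrank ℝ V + 1))⁻¹ with hI
  have hI0 : 0 ≤ I := integral_nonneg fun x => by positivity
  have hint := integrable_inv_one_add_sq_pow (V := V) (K := Module.finrank ℝ V + 1) (by omega)
  refine ⟨C * I * (C' * I), by positivity, fun f g hf hg A B hA hB => ?_⟩
  have h1 := h f hf A hA
  have h2 := h' g hg B hB
  have hA0 : 0 ≤ A := by
    simpa using (norm_nonneg _).trans (hA 0 (Nat.zero_le _) 0)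
  have h3 : ∀ ζ, ‖𝓕 (fun w => rho K w * Lam^[K] f w) ζ‖ ≤ C * A * I := by
    intro ζ
    refine (norm_fourier_le _ ζ).trans ?_
    rw [hI, ← integral_const_mul]
    exact integral_mono_of_nonneg (Eventually.of_forall fun x => norm_nonneg _)
      (hint.const_mul _) (Eventually.of_forall h1)
  calc ‖Pair K f g‖ ≤ ∫ ζ : V, (C * A * I) * (C' * B *
        ((1 + ‖ζ‖ ^ 2) ^ (Module.finrank ℝ V + 1))⁻¹) := by
        refine norm_integral_le_of_norm_le ((hint.const_mul _).const_mul _)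
          (Eventually.of_forall fun ζ => ?_)
        rw [norm_mul]
        exact mul_le_mul (h3 ζ) (h2 ζ) (norm_nonneg _) (by positivity)
    _ = _ := by
        rw [integral_const_mul, integral_const_mul]
        ring

/-- Continuity of the regularized pairing under locally stationary, uniformly bounded
approximation of the first amplitude. -/
lemma tendsto_pair (r : ℕ) {fn : ℕ → V → ℂ} {f g : V → ℂ} (hfn : ∀ n, ContDiff ℝ ∞ (fn n))
    (hev : ∀ x, ∀ᶠ n in atTop, fn n =ᶠ[𝓝 x] f) (hg : ContDiff ℝ ∞ g) {A B : ℝ}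
    (hA : ∀ n, ∀ k ≤ 2 * (r + Module.finrank ℝ V + 1), ∀ x,
        ‖iteratedFDeriv ℝ k (fn n) x‖ ≤ A * (1 + ‖x‖ ^ 2) ^ r)
    (hB : ∀ k ≤ 2 * (r + Module.finrank ℝ V + 1), ∀ x,
        ‖iteratedFDeriv ℝ k g x‖ ≤ B * (1 + ‖x‖ ^ 2) ^ r) :
    Tendsto (fun n => Pair (r + Module.finrank ℝ V + 1) (fn n) g) atTop
      (𝓝 (Pair (r + Module.finrank ℝ V + 1) f g)) := by
  obtain ⟨C, hC, h⟩ := exists_norm_rho_mul_iterate_Lam_le (V := V) r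
  obtain ⟨C', hC', h'⟩ := exists_norm_iterate_Lam_rho_mul_le (V := V) r
  set K := r + Module.finrank ℝ V + 1 with hK
  set I : ℝ := ∫ x : V, ((1 + ‖x‖ ^ 2) ^ (Module.finrank ℝ V + 1))⁻¹ with hI
  have hint := integrable_inv_one_add_sq_pow (V := V) (K := Module.finrank ℝ V + 1) (by omega)
  have hc : ∀ n, Continuous (fun w => rho K w * Lam^[K] (fn n) w) := fun n =>
    (contDiff_rho K).continuous.mul (contDiff_iterate_Lam (hfn n) K).continuous
  have h1 := fun n => h (fn n) (hfn n) A (hA n)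
  have h2 := h' g hg B hB
  have hI0 : 0 ≤ I := integral_nonneg fun x => by positivity
  have hA0 : 0 ≤ A := by
    simpa using (norm_nonneg _).trans (hA 0 0 (Nat.zero_le _) 0)
  have h3 : ∀ n ζ, ‖𝓕 (fun w => rho K w * Lam^[K] (fn n) w) ζ‖ ≤ C * A * I := by
    intro n ζ
    refine (norm_fourier_le _ ζ).trans ?_
    rw [hI, ← integral_const_mul]
    exact integral_mono_of_nonneg (Eventually.of_forall fun x => norm_nonneg _)
      (hint.const_mul _) (Eventually.of_forall (h1 n))
  have hlim : ∀ ζ, Tendsto (fun n => 𝓕 (fun w => rho K w * Lam^[K] (fn n) w) ζ) atTop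
      (𝓝 (𝓕 (fun w => rho K w * Lam^[K] f w) ζ)) := by
    intro ζ
    simp only [Real.fourier_eq]
    refine tendsto_integral_of_dominated_convergence
      (fun x => C * A * ((1 + ‖x‖ ^ 2) ^ (Module.finrank ℝ V + 1))⁻¹) (fun n => ?_)
      (hint.const_mul _) (fun n => Eventually.of_forall fun x => ?_)
      (Eventually.of_forall fun x => ?_)
    · refine Continuous.aestronglyMeasurable ?_
      exact (Real.continuous_fourierChar.comp
        (continuous_id.inner continuous_const).neg).smul (hc n)
    · rw [Circle.norm_smul]
      exact h1 n x
    · refine tendsto_const_nhds.congr' ?_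
      filter_upwards [hev x] with n hn
      rw [(iterate_Lam_congr hn K).eq_of_nhds]
  refine tendsto_integral_of_dominated_convergence
    (fun ζ => (C * A * I) * (C' * B * ((1 + ‖ζ‖ ^ 2) ^ (Module.finrank ℝ V + 1))⁻¹))
    (fun n => ?_) ((hint.const_mul _).const_mul _) (fun n => Eventually.of_forall fun ζ => ?_)
    (Eventually.of_forall fun ζ => (hlim ζ).mul_const _)
  · exact ((continuous_fourier (integrable_of_norm_le_inv (hc n) (h1 n))).mul
      (contDiff_iterate_Lam ((contDiff_rho K).mul hg) K).continuous).aestronglyMeasurable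
  · rw [norm_mul]
    exact mul_le_mul (h3 n ζ) (h2 ζ) (norm_nonneg _) (by positivity)

end Pairing

/-! ### Japanese bracket -/

section Bracket

variable {d : ℕ}

lemma japanese_pos (z : Phase d) : 0 < japanese z := Real.sqrt_pos.2 (by positivity)

lemma japanese_sq (z : Phase d) : japanese z ^ 2 = 1 + ‖z.1‖ ^ 2 + ‖z.2‖ ^ 2 :=
  Real.sq_sqrt (by positivity)

lemma one_le_japanese (z : Phase d) : 1 ≤ japanese z :=
  Real.one_le_sqrt.2 (by nlinarith [sq_nonneg ‖z.1‖, sq_nonneg ‖z.2‖])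

lemma one_add_sq_le_japanese_sq (z : Phase d) : 1 + ‖z‖ ^ 2 ≤ japanese z ^ 2 := by
  rw [japanese_sq, Prod.norm_def]
  rcases max_cases ‖z.1‖ ‖z.2‖ with ⟨h, _⟩ | ⟨h, _⟩ <;> rw [h] <;>
    nlinarith [sq_nonneg ‖z.1‖, sq_nonneg ‖z.2‖]

lemma japanese_sq_le (z : Phase d) : japanese z ^ 2 ≤ 2 * (1 + ‖z‖ ^ 2) := by
  rw [japanese_sq]
  have h1 : ‖z.1‖ ^ 2 ≤ ‖z‖ ^ 2 := by gcongr; exact norm_fst_le z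
  have h2 : ‖z.2‖ ^ 2 ≤ ‖z‖ ^ 2 := by gcongr; exact norm_snd_le z
  linarith

lemma japanese_sq_add_le (x y : Phase d) :
    japanese (x + y) ^ 2 ≤ 4 * (1 + ‖y‖ ^ 2) * japanese x ^ 2 := by
  have h1 := one_add_sq_add_le x.1 y.1
  have h2 := one_add_sq_add_le x.2 y.2
  have h3 : ‖y.1‖ ^ 2 ≤ ‖y‖ ^ 2 := by gcongr; exact norm_fst_le y
  have h4 : ‖y.2‖ ^ 2 ≤ ‖y‖ ^ 2 := by gcongr; exact norm_snd_le y
  have h5 : ‖(x + y).1‖ ^ 2 ≤ 2 * ‖x.1‖ ^ 2 + 2 * ‖y.1‖ ^ 2 := by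
    have : ‖(x + y).1‖ ^ 2 ≤ (‖x.1‖ + ‖y.1‖) ^ 2 := by gcongr; exact norm_add_le _ _
    nlinarith [sq_nonneg (‖x.1‖ - ‖y.1‖)]
  have h6 : ‖(x + y).2‖ ^ 2 ≤ 2 * ‖x.2‖ ^ 2 + 2 * ‖y.2‖ ^ 2 := by
    have : ‖(x + y).2‖ ^ 2 ≤ (‖x.2‖ + ‖y.2‖) ^ 2 := by gcongr; exact norm_add_le _ _
    nlinarith [sq_nonneg (‖x.2‖ - ‖y.2‖)]
  rw [japanese_sq, japanese_sq]
  nlinarith [mul_nonneg (sq_nonneg ‖y‖) (sq_nonneg ‖x.1‖),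
    mul_nonneg (sq_nonneg ‖y‖) (sq_nonneg ‖x.2‖), sq_nonneg ‖x.1‖, sq_nonneg ‖x.2‖]

lemma rpow_two_mul_half {t : ℝ} (ht : 0 < t) (m : ℝ) : t ^ m = (t ^ 2) ^ (m / 2) := by
  rw [← Real.rpow_natCast t 2, ← Real.rpow_mul ht.le]
  congr 1
  push_cast
  ring

/-- Peetre's inequality. -/
lemma japanese_add_rpow_le {r : ℕ} {m : ℝ} (hm : |m| ≤ 2 * r) (x y : Phase d) :
    japanese (x + y) ^ m ≤ 4 ^ r * japanese x ^ m * (1 + ‖y‖ ^ 2) ^ r := by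
  have hx := japanese_pos x
  have hxy := japanese_pos (x + y)
  have hP : 1 ≤ 4 * (1 + ‖y‖ ^ 2) := by nlinarith [sq_nonneg ‖y‖]
  have key : ∀ s : ℝ, s ≤ r → (4 * (1 + ‖y‖ ^ 2)) ^ s ≤ 4 ^ r * (1 + ‖y‖ ^ 2) ^ r := by
    intro s hs
    rw [← mul_pow, ← Real.rpow_natCast (4 * (1 + ‖y‖ ^ 2)) r]
    exact Real.rpow_le_rpow_of_exponent_le hP hs
  rw [rpow_two_mul_half hxy, rpow_two_mul_half hx]
  rcases le_total 0 m with h0 | h0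
  · rw [abs_of_nonneg h0] at hm
    calc (japanese (x + y) ^ 2) ^ (m / 2) ≤ (4 * (1 + ‖y‖ ^ 2) * japanese x ^ 2) ^ (m / 2) :=
          Real.rpow_le_rpow (by positivity) (japanese_sq_add_le x y) (by linarith)
      _ = (4 * (1 + ‖y‖ ^ 2)) ^ (m / 2) * (japanese x ^ 2) ^ (m / 2) :=
          Real.mul_rpow (by positivity) (by positivity)
      _ ≤ (4 ^ r * (1 + ‖y‖ ^ 2) ^ r) * (japanese x ^ 2) ^ (m / 2) := by
          gcongr
          exact key _ (by linarith)
      _ = _ := by ring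
  · rw [abs_of_nonpos h0] at hm
    have h1 : japanese x ^ 2 ≤ 4 * (1 + ‖y‖ ^ 2) * japanese (x + y) ^ 2 := by
      simpa using japanese_sq_add_le (x + y) (-y)
    have h2 : japanese x ^ 2 / (4 * (1 + ‖y‖ ^ 2)) ≤ japanese (x + y) ^ 2 := by
      rw [div_le_iff₀ (by positivity)]
      linarith
    calc (japanese (x + y) ^ 2) ^ (m / 2) ≤ (japanese x ^ 2 / (4 * (1 + ‖y‖ ^ 2))) ^ (m / 2) :=
          Real.rpow_le_rpow_of_nonpos (by positivity) h2 (by linarith)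
      _ = (4 * (1 + ‖y‖ ^ 2)) ^ (-(m / 2)) * (japanese x ^ 2) ^ (m / 2) := by
          rw [Real.div_rpow (by positivity) (by positivity), Real.rpow_neg (by positivity)]
          ring
      _ ≤ (4 ^ r * (1 + ‖y‖ ^ 2) ^ r) * (japanese x ^ 2) ^ (m / 2) := by
          gcongr
          exact key _ (by linarith)
      _ = _ := by ring

end Bracket

/-! ### Bounds of amplitudes along affine maps -/

section Affine

variable {E F : Type*} [NormedAddCommGroup E] [NormedSpace ℝ E] [NormedAddCommGroup F]
  [NormedSpace ℝ F]

omit [NormedSpace ℝ E] [NormedSpace ℝ F] in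
lemma one_add_mul_sq_le {M : ℝ} {x : E} {y : F} (h : ‖x‖ ≤ M * ‖y‖) :
    1 + ‖x‖ ^ 2 ≤ (1 + M ^ 2) * (1 + ‖y‖ ^ 2) := by
  have : ‖x‖ ^ 2 ≤ (M * ‖y‖) ^ 2 := by gcongr
  nlinarith [sq_nonneg M, sq_nonneg ‖y‖]

lemma norm_iteratedFDeriv_comp_affine_le_of_le {f : E → ℂ} (hf : ContDiff ℝ ∞ f) {r k : ℕ} {C : ℝ}
    (h : ∀ x, ‖iteratedFDeriv ℝ k f x‖ ≤ C * (1 + ‖x‖ ^ 2) ^ r) (z : E) (L : F →L[ℝ] E) (y : F) :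
    ‖iteratedFDeriv ℝ k (fun y => f (z + L y)) y‖ ≤
      ‖L‖ ^ k * (C * (2 * (1 + ‖z‖ ^ 2) * (1 + ‖L‖ ^ 2)) ^ r) * (1 + ‖y‖ ^ 2) ^ r := by
  have hC : 0 ≤ C := by simpa using (norm_nonneg _).trans (h 0)
  refine (norm_iteratedFDeriv_comp_affine_le hf z L k y).trans ?_
  rw [mul_assoc]
  refine mul_le_mul_of_nonneg_left ((h _).trans ?_) (by positivity)
  rw [mul_assoc, ← mul_pow]
  refine mul_le_mul_of_nonneg_left (pow_le_pow_left₀ (by positivity) ?_ _) hC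
  have h1 := one_add_sq_add_le z (L y)
  have h2 := one_add_mul_sq_le (L.le_opNorm y)
  calc _ ≤ 2 * ((1 + ‖z‖ ^ 2) * (1 + ‖L y‖ ^ 2)) := h1
    _ ≤ 2 * ((1 + ‖z‖ ^ 2) * ((1 + ‖L‖ ^ 2) * (1 + ‖y‖ ^ 2))) := by gcongr
    _ = _ := by ring

lemma IsAmp.comp_affine {f : E → ℂ} {r : ℕ} (hf : IsAmp r f) (z : E) (L : F →L[ℝ] E) :
    IsAmp r (fun y => f (z + L y)) := by
  refine ⟨contDiff_comp_affine hf.1 z L, fun k => ?_⟩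
  obtain ⟨C, h⟩ := hf.2 k
  exact ⟨_, norm_iteratedFDeriv_comp_affine_le_of_le hf.1 h z L⟩

end Affine

/-! ### Twisted products -/

section Twisted

open scoped FourierTransform

variable {d : ℕ}

/-- Phase space with its Euclidean norm, on which the Fourier transform is taken. -/
abbrev FPhase (d : ℕ) : Type := WithLp 2 (Config d × Config d)

variable (d) in
/-- The identification of the Euclidean phase space with `Phase d`. -/
def phaseEquiv : FPhase d ≃L[ℝ] Phase d := WithLp.prodContinuousLinearEquiv 2 ℝ _ _

@[simp] lemma phaseEquiv_fst (w : FPhase d) : (phaseEquiv d w).1 = w.fst := rfl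

@[simp] lemma phaseEquiv_snd (w : FPhase d) : (phaseEquiv d w).2 = w.snd := rfl

variable (d) in
/-- The map `ζ = (ζ₁, ζ₂) ↦ π (ζ₂, -ζ₁)`. The factor `π` is half of the factor `2π` of the Fourier
characters `e^{2πi⟨ζ, z⟩}`. -/
def symJ : FPhase d →L[ℝ] Phase d :=
  Real.pi • (((ContinuousLinearMap.snd ℝ _ _).comp (phaseEquiv d : FPhase d →L[ℝ] Phase d)).prod
    (-((ContinuousLinearMap.fst ℝ _ _).comp (phaseEquiv d : FPhase d →L[ℝ] Phase d))))

lemma symJ_apply (ζ : FPhase d) : symJ d ζ = (Real.pi • ζ.snd, -(Real.pi • ζ.fst)) := by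
  simp [symJ]

/-- The twisted product `∫ 𝓕a(ζ) e^{2πi⟨ζ, z⟩} b(z + τ Jζ) dζ`: with `a` written as a superposition
of plane waves, each plane wave acts on `b` as multiplication and translation. At `τ = 1` this is
the Weyl product, at `τ = 0` the pointwise product. -/
def PW (a b : Phase d → ℂ) (τ : ℝ) (z : Phase d) : ℂ :=
  ∫ ζ : FPhase d, 𝓕 (fun w => a (z + (phaseEquiv d : FPhase d →L[ℝ] Phase d) w)) ζ *
    b (z + (τ • symJ d) ζ)

/-- Smooth compactly supported functions that approximate `a`: each point has a neighbourhood on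
which they finally agree with `a`, and they are bounded as amplitudes. -/
structure IsApprox (r : ℕ) (an : ℕ → Phase d → ℂ) (a : Phase d → ℂ) : Prop where
  contDiff : ∀ n, ContDiff ℝ ∞ (an n)
  hasCompactSupport : ∀ n, HasCompactSupport (an n)
  eventuallyEq : ∀ z, ∀ᶠ n in atTop, an n =ᶠ[𝓝 z] a
  bound : ∀ k : ℕ, ∃ C : ℝ, ∀ n z, ‖iteratedFDeriv ℝ k (an n) z‖ ≤ C * (1 + ‖z‖ ^ 2) ^ r

lemma hasCompactSupport_dd {a : Phase d → ℂ} (ha : HasCompactSupport a) (v : Phase d) :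
    HasCompactSupport (dd v a) :=
  ha.fderiv_apply (𝕜 := ℝ) v

lemma IsApprox.dd {r : ℕ} {an : ℕ → Phase d → ℂ} {a : Phase d → ℂ} (h : IsApprox r an a)
    (v : Phase d) : IsApprox r (fun n => dd v (an n)) (dd v a) where
  contDiff n := contDiff_dd (h.contDiff n) v
  hasCompactSupport n := hasCompactSupport_dd (h.hasCompactSupport n) v
  eventuallyEq z := (h.eventuallyEq z).mono fun n hn => by
    filter_upwards [hn.fderiv (𝕜 := ℝ)] with y hy
    simp only [ShubinCalculus.dd, hy]
  bound k := by
    obtain ⟨C, hC⟩ := h.bound (k + 1)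
    refine ⟨‖v‖ * C, fun n z => (norm_iteratedFDeriv_dd_le (h.contDiff n) v k z).trans ?_⟩
    rw [mul_assoc]
    exact mul_le_mul_of_nonneg_left (hC n z) (norm_nonneg v)

lemma IsApprox.isAmp_apply {r : ℕ} {an : ℕ → Phase d → ℂ} {a : Phase d → ℂ} (h : IsApprox r an a)
    (n : ℕ) : IsAmp r (an n) :=
  ⟨h.contDiff n, fun k => (h.bound k).imp fun _ hC => hC n⟩

lemma IsApprox.isAmp {r : ℕ} {an : ℕ → Phase d → ℂ} {a : Phase d → ℂ} (h : IsApprox r an a) :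
    IsAmp r a := by
  refine ⟨contDiff_iff_contDiffAt.2 fun z => ?_, fun k => ?_⟩
  · obtain ⟨n, hn⟩ := (h.eventuallyEq z).exists
    exact (h.contDiff n).contDiffAt.congr_of_eventuallyEq hn.symm
  · obtain ⟨C, hC⟩ := h.bound k
    refine ⟨C, fun z => ?_⟩
    obtain ⟨n, hn⟩ := (h.eventuallyEq z).exists
    rw [← (hn.iteratedFDeriv ℝ k).eq_of_nhds]
    exact hC n z

lemma IsApprox.exists_bound {r : ℕ} {an : ℕ → Phase d → ℂ} {a : Phase d → ℂ}
    (h : IsApprox r an a) (N : ℕ) : ∃ C : ℝ, 0 ≤ C ∧ ∀ k ≤ N, ∀ n z,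
      ‖iteratedFDeriv ℝ k (an n) z‖ ≤ C * (1 + ‖z‖ ^ 2) ^ r := by
  obtain ⟨C, hC, hb⟩ := exists_uniform_of_forall (α := ℕ × Phase d)
    (F := fun k p => ‖iteratedFDeriv ℝ k (an p.1) p.2‖) (w := fun p => (1 + ‖p.2‖ ^ 2) ^ r)
    (fun p => by positivity) (fun k => (h.bound k).imp fun C hC p => hC p.1 p.2) N
  exact ⟨C, hC, fun k hk n z => hb k hk (n, z)⟩

lemma isApprox_const {r : ℕ} {a : Phase d → ℂ} (ha : IsAmp r a) (hc : HasCompactSupport a) :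
    IsApprox r (fun _ => a) a where
  contDiff _ := ha.1
  hasCompactSupport _ := hc
  eventuallyEq _ := Eventually.of_forall fun _ => EventuallyEq.rfl
  bound k := (ha.2 k).imp fun _ hC _ => hC

variable (d) in
/-- A smooth cutoff function on phase space that equals one near the origin. -/
def cutoff : ContDiffBump (0 : Phase d) := ⟨1, 2, one_pos, one_lt_two⟩

/-- The truncations `χ(z / (n + 1)) a(z)`. -/
def trunc (a : Phase d → ℂ) (n : ℕ) (z : Phase d) : ℂ :=
  ((cutoff d (((n : ℝ) + 1)⁻¹ • z) : ℝ) : ℂ) * a z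

lemma isApprox_trunc {r : ℕ} {a : Phase d → ℂ} (ha : IsAmp r a) : IsApprox r (trunc a) a := by
  set χ : Phase d → ℂ := fun z => ((cutoff d z : ℝ) : ℂ) with hχ
  have hχs : ContDiff ℝ ∞ χ := Complex.ofRealCLM.contDiff.comp (cutoff d).contDiff
  have hχc : HasCompactSupport χ := (cutoff d).hasCompactSupport.comp_left (g := Complex.ofReal) rfl
  let L : ℕ → (Phase d →L[ℝ] Phase d) := fun n => ((n : ℝ) + 1)⁻¹ • ContinuousLinearMap.id ℝ _
  have hL : ∀ n, ‖L n‖ ≤ 1 := fun n => by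
    refine ContinuousLinearMap.opNorm_le_bound _ zero_le_one fun z => ?_
    simp only [L, smul_apply, ContinuousLinearMap.id_apply, norm_smul]
    gcongr
    rw [Real.norm_of_nonneg (by positivity)]
    exact inv_le_one_of_one_le₀ (by linarith [Nat.cast_nonneg (α := ℝ) n])
  have hχn : ∀ n, ContDiff ℝ ∞ (fun z => χ (0 + L n z)) := fun n =>
    contDiff_comp_affine hχs 0 (L n)
  have ht : ∀ n, trunc a n = fun z => χ (0 + L n z) * a z := fun n => by
    funext z
    simp [trunc, hχ, L]
  refine ⟨fun n => ?_, fun n => ?_, fun z => ?_, fun k => ?_⟩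
  · rw [ht]
    exact (hχn n).mul ha.1
  · have h1 : HasCompactSupport (fun z : Phase d => χ (((n : ℝ) + 1)⁻¹ • z)) :=
      hχc.comp_smul (by positivity)
    exact h1.mul_right (f' := a)
  · obtain ⟨n0, hn0⟩ := exists_nat_gt (‖z‖ + 1)
    filter_upwards [eventually_ge_atTop n0] with n hn
    filter_upwards [Metric.ball_mem_nhds z one_pos] with y hy
    have hy' : ‖y‖ < n := by
      have h1 : ‖y‖ ≤ ‖z‖ + ‖y - z‖ := by
        simpa using norm_add_le z (y - z)
      rw [Metric.mem_ball, dist_eq_norm] at hy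
      have : (n0 : ℝ) ≤ n := by exact_mod_cast hn
      linarith
    have : cutoff d (((n : ℝ) + 1)⁻¹ • y) = 1 := by
      refine (cutoff d).one_of_mem_closedBall ?_
      rw [mem_closedBall_zero_iff, norm_smul, Real.norm_of_nonneg (by positivity)]
      change _ ≤ (1 : ℝ)
      rw [inv_mul_le_iff₀ (by positivity)]
      linarith
    simp [trunc, this]
  · obtain ⟨C, hC, h⟩ := ha.exists_bound k
    have hχb : ∀ k : ℕ, ∃ C : ℝ, ∀ z, ‖iteratedFDeriv ℝ k χ z‖ ≤ C * 1 := by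
      intro k
      obtain ⟨C, hC⟩ := ((hχs.continuous_iteratedFDeriv (m := k)
        (by exact_mod_cast le_top)).norm).bounded_above_of_compact_support
          ((hχc.iteratedFDeriv (𝕜 := ℝ) k).norm)
      exact ⟨C, fun z => by simpa using hC z⟩
    obtain ⟨C', hC', h'⟩ := exists_uniform_of_forall (fun _ => zero_le_one) hχb k
    refine ⟨2 ^ k * (C' * C), fun n z => ?_⟩
    rw [ht, mul_assoc, mul_assoc]
    refine norm_iteratedFDeriv_mul_le_of_le (hχn n) ha.1 (fun j hj => ?_)
      (fun j hj => h j hj z) k le_rfl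
    refine (norm_iteratedFDeriv_comp_affine_le hχs 0 (L n) j z).trans ?_
    calc _ ≤ 1 * C' := by
          gcongr
          · exact pow_le_one₀ (norm_nonneg _) (hL n)
          · simpa using h' j hj (0 + L n z)
      _ = C' := one_mul _

/-- The twisted product of general amplitudes, as the limit of the twisted products of the
truncations. It is meant for amplitudes `a` and `b`, for which the limit exists
(`IsApprox.tendsto_PW`). -/
def T (a b : Phase d → ℂ) (τ : ℝ) (z : Phase d) : ℂ :=
  limUnder atTop (fun n => PW (trunc a n) b τ z)

lemma hasCompactSupport_comp_phase {a : Phase d → ℂ} (ha : HasCompactSupport a) (z : Phase d) :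
    HasCompactSupport
      (fun w : FPhase d => a (z + (phaseEquiv d : FPhase d →L[ℝ] Phase d) w)) :=
  ha.comp_homeomorph ((phaseEquiv d).toHomeomorph.trans (Homeomorph.addLeft z))

lemma PW_eq_pair {a b : Phase d → ℂ} (ha : ContDiff ℝ ∞ a) (hc : HasCompactSupport a) {r : ℕ}
    (hb : IsAmp r b) (τ : ℝ) (z : Phase d) (K : ℕ) :
    PW a b τ z = Pair K (fun w => a (z + (phaseEquiv d : FPhase d →L[ℝ] Phase d) w))
      (fun ζ => b (z + (τ • symJ d) ζ)) := by
  have h := integral_fourier_mul_eq_pair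
    ((hasCompactSupport_comp_phase hc z).toSchwartzMap (contDiff_comp_affine ha z _))
    (hb.comp_affine z (τ • symJ d)) K
  exact h

lemma IsApprox.tendsto_PW_pair {r : ℕ} {an : ℕ → Phase d → ℂ} {a b : Phase d → ℂ}
    (h : IsApprox r an a) (hb : IsAmp r b) (τ : ℝ) (z : Phase d) :
    Tendsto (fun n => PW (an n) b τ z) atTop
      (𝓝 (Pair (r + Module.finrank ℝ (FPhase d) + 1)
        (fun w => a (z + (phaseEquiv d : FPhase d →L[ℝ] Phase d) w))
        (fun ζ => b (z + (τ • symJ d) ζ)))) := by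
  set e : FPhase d →L[ℝ] Phase d := (phaseEquiv d : FPhase d →L[ℝ] Phase d)
  have hb' := hb.comp_affine z (τ • symJ d)
  obtain ⟨B, hB, hBb⟩ := hb'.exists_bound (2 * (r + Module.finrank ℝ (FPhase d) + 1))
  obtain ⟨A, hA, hAb⟩ := exists_uniform_of_forall (α := ℕ × FPhase d)
    (F := fun k p => ‖iteratedFDeriv ℝ k (fun w => an p.1 (z + e w)) p.2‖)
    (w := fun p => (1 + ‖p.2‖ ^ 2) ^ r) (fun p => by positivity)
    (fun k => by
      obtain ⟨C, hC⟩ := h.bound k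
      exact ⟨_, fun p => norm_iteratedFDeriv_comp_affine_le_of_le (h.contDiff p.1)
        (fun x => hC p.1 x) z e p.2⟩) (2 * (r + Module.finrank ℝ (FPhase d) + 1))
  refine (tendsto_pair r (fun n => contDiff_comp_affine (h.contDiff n) z e) (fun w => ?_) hb'.1
    (fun n k hk x => hAb k hk (n, x)) hBb).congr fun n => ?_
  · filter_upwards [h.eventuallyEq (z + e w)] with n hn
    exact ((continuous_const.add e.continuous).tendsto w).eventually hn
  · rw [PW_eq_pair (h.contDiff n) (h.hasCompactSupport n) hb]

/-- The limit that defines `T` exists and is the regularized pairing. The latter does not involve the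
truncations, so any other approximation has the same limit. -/
lemma T_eq_pair {r : ℕ} {a b : Phase d → ℂ} (ha : IsAmp r a) (hb : IsAmp r b) (τ : ℝ)
    (z : Phase d) :
    T a b τ z = Pair (r + Module.finrank ℝ (FPhase d) + 1)
        (fun w => a (z + (phaseEquiv d : FPhase d →L[ℝ] Phase d) w))
        (fun ζ => b (z + (τ • symJ d) ζ)) :=
  ((isApprox_trunc ha).tendsto_PW_pair hb τ z).limUnder_eq

lemma IsApprox.tendsto_PW {r : ℕ} {an : ℕ → Phase d → ℂ} {a b : Phase d → ℂ}
    (h : IsApprox r an a) (hb : IsAmp r b) (τ : ℝ) (z : Phase d) :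
    Tendsto (fun n => PW (an n) b τ z) atTop (𝓝 (T a b τ z)) := by
  rw [T_eq_pair h.isAmp hb]
  exact h.tendsto_PW_pair hb τ z

lemma T_eq_PW {r : ℕ} {a b : Phase d → ℂ} (ha : IsAmp r a) (hc : HasCompactSupport a)
    (hb : IsAmp r b) (τ : ℝ) (z : Phase d) : T a b τ z = PW a b τ z :=
  tendsto_nhds_unique ((isApprox_const ha hc).tendsto_PW hb τ z) tendsto_const_nhds

/-- Bounds by powers of `⟨hz⟩` turn into bounds of the amplitude `w ↦ a(z + Lw)` with the same power
of `⟨hz⟩` at the base point, by Peetre's inequality. Here `h ≤ 1` makes the constant independent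
of `h`. -/
lemma norm_iteratedFDeriv_comp_affine_le_japanese {F : Type*} [NormedAddCommGroup F]
    [NormedSpace ℝ F] {a : Phase d → ℂ} (ha : ContDiff ℝ ∞ a) {h : ℝ} (hh : h ∈ Ioc (0 : ℝ) 1)
    {N r : ℕ} {m A M : ℝ} (hm : |m| ≤ 2 * r) (hM : 1 ≤ M)
    (hA : ∀ k ≤ N, ∀ z, ‖iteratedFDeriv ℝ k a z‖ ≤ A * japanese (h • z) ^ m)
    (L : F →L[ℝ] Phase d) (hL : ‖L‖ ≤ M) (z : Phase d) :
    ∀ k ≤ N, ∀ w, ‖iteratedFDeriv ℝ k (fun w => a (z + L w)) w‖ ≤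
      M ^ N * 4 ^ r * (1 + M ^ 2) ^ r * (A * japanese (h • z) ^ m) * (1 + ‖w‖ ^ 2) ^ r := by
  intro k hk w
  have hA0 : 0 ≤ A := by
    have := (norm_nonneg _).trans (hA 0 (Nat.zero_le _) 0)
    exact nonneg_of_mul_nonneg_left this (Real.rpow_pos_of_pos (japanese_pos _) _)
  have h1 : japanese (h • (z + L w)) ^ m ≤
      4 ^ r * japanese (h • z) ^ m * ((1 + M ^ 2) ^ r * (1 + ‖w‖ ^ 2) ^ r) := by
    rw [smul_add]
    refine (japanese_add_rpow_le hm _ _).trans ?_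
    have hJ := (Real.rpow_pos_of_pos (japanese_pos (h • z)) m).le
    rw [← mul_pow (1 + M ^ 2)]
    gcongr
    refine one_add_mul_sq_le ?_
    rw [norm_smul, Real.norm_of_nonneg hh.1.le]
    calc h * ‖L w‖ ≤ 1 * (M * ‖w‖) := by
          gcongr
          · exact hh.2
          · exact L.le_of_opNorm_le hL w
      _ = _ := one_mul _
  calc _ ≤ ‖L‖ ^ k * ‖iteratedFDeriv ℝ k a (z + L w)‖ :=
        norm_iteratedFDeriv_comp_affine_le ha z L k w
    _ ≤ M ^ N * (A * (4 ^ r * japanese (h • z) ^ m * ((1 + M ^ 2) ^ r * (1 + ‖w‖ ^ 2) ^ r))) := by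
        gcongr
        · exact (pow_le_pow_left₀ (norm_nonneg _) hL k).trans (pow_le_pow_right₀ hM hk)
        · refine (hA k hk _).trans ?_
          gcongr
    _ = _ := by ring

/-- Uniform bound of twisted products: only finitely many seminorms enter, and Peetre's inequality
lets the orders add up. -/
lemma exists_norm_T_le (r : ℕ) (m n : ℝ) :
    ∃ (N : ℕ) (C : ℝ), 0 ≤ C ∧ ∀ h ∈ Ioc (0 : ℝ) 1, ∀ τ ∈ Icc (0 : ℝ) 1, ∀ a b : Phase d → ℂ,
      IsAmp r a → IsAmp r b → ∀ A B : ℝ,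
      (∀ k ≤ N, ∀ z, ‖iteratedFDeriv ℝ k a z‖ ≤ A * japanese (h • z) ^ m) →
      (∀ k ≤ N, ∀ z, ‖iteratedFDeriv ℝ k b z‖ ≤ B * japanese (h • z) ^ n) →
      ∀ z, ‖T a b τ z‖ ≤ C * (A * B) * japanese (h • z) ^ (m + n) := by
  obtain ⟨s, hs⟩ := exists_nat_ge (|m| + |n|)
  set q := r + s with hq
  have hqs : (s : ℝ) ≤ 2 * q := by
    rw [hq]
    push_cast
    linarith [Nat.cast_nonneg (α := ℝ) r, Nat.cast_nonneg (α := ℝ) s]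
  have hm : |m| ≤ 2 * q := by linarith [abs_nonneg n]
  have hn : |n| ≤ 2 * q := by linarith [abs_nonneg m]
  obtain ⟨C, hC, hP⟩ := exists_norm_pair_le (FPhase d) q
  set e : FPhase d →L[ℝ] Phase d := (phaseEquiv d : FPhase d →L[ℝ] Phase d) with he
  set M : ℝ := 1 + ‖e‖ + ‖symJ d‖ with hM
  set N := 2 * (q + Module.finrank ℝ (FPhase d) + 1) with hN
  set c : ℝ := M ^ N * 4 ^ q * (1 + M ^ 2) ^ q with hc
  have hM1 : 1 ≤ M := by
    rw [hM]
    linarith [norm_nonneg e, norm_nonneg (symJ d)]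
  have hM0 : 0 ≤ M := by linarith
  refine ⟨N, C * c * c, by positivity, fun h hh τ hτ a b ha hb A B hA hB z => ?_⟩
  have ha' := ha.mono (show r ≤ q by omega)
  have hb' := hb.mono (show r ≤ q by omega)
  have hτJ : ‖τ • symJ d‖ ≤ M := by
    rw [norm_smul, Real.norm_of_nonneg hτ.1]
    have : τ * ‖symJ d‖ ≤ 1 * ‖symJ d‖ := by
      gcongr
      exact hτ.2
    rw [hM]
    linarith [norm_nonneg e]
  rw [T_eq_pair ha' hb']
  refine (hP _ _ (contDiff_comp_affine ha.1 z e) (contDiff_comp_affine hb.1 z _) _ _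
    (norm_iteratedFDeriv_comp_affine_le_japanese ha.1 hh hm hM1 hA e
      (by rw [hM]; linarith [norm_nonneg (symJ d)]) z)
    (norm_iteratedFDeriv_comp_affine_le_japanese hb.1 hh hn hM1 hB (τ • symJ d) hτJ z)).trans
    (le_of_eq ?_)
  rw [Real.rpow_add (japanese_pos _)]
  ring

end Twisted

/-! ### Derivatives of twisted products of compactly supported functions -/

section TwistedDeriv

open scoped FourierTransform LineDeriv

variable {d : ℕ}

/-- The Fourier transform of the translate `a(z + ·)`. -/
def phi (a : Phase d → ℂ) (z : Phase d) (ζ : FPhase d) : ℂ :=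
  𝓕 (fun w : FPhase d => a (z + (phaseEquiv d : FPhase d →L[ℝ] Phase d) w)) ζ

lemma PW_eq_integral_phi (a b : Phase d → ℂ) (τ : ℝ) (z : Phase d) :
    PW a b τ z = ∫ ζ, phi a z ζ * b (z + (τ • symJ d) ζ) := rfl

/-- The translate `a(z + ·)` as a Schwartz function on the Euclidean phase space. -/
def schwartzOf {a : Phase d → ℂ} (ha : ContDiff ℝ ∞ a) (hc : HasCompactSupport a) (z : Phase d) :
    𝓢(FPhase d, ℂ) :=
  (hasCompactSupport_comp_phase hc z).toSchwartzMap (contDiff_comp_affine ha z _)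

lemma phi_eq_fourier_schwartzOf {a : Phase d → ℂ} (ha : ContDiff ℝ ∞ a)
    (hc : HasCompactSupport a) (z : Phase d) :
    phi a z = ⇑(𝓕 (schwartzOf ha hc z) : 𝓢(FPhase d, ℂ)) := rfl

lemma phi_translate (a : Phase d → ℂ) (z z' : Phase d) (ζ : FPhase d) :
    phi a (z + z') ζ =
      Complex.exp (2 * Real.pi * Complex.I * (inner ℝ ζ ((phaseEquiv d).symm z') : ℝ)) *
        phi a z ζ := by
  have h := congrFun (VectorFourier.fourierIntegral_comp_add_right Real.fourierChar volume
    (innerₗ (FPhase d))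
    (fun w : FPhase d => a (z + (phaseEquiv d : FPhase d →L[ℝ] Phase d) w))
    ((phaseEquiv d).symm z')) ζ
  have e1 : (fun w : FPhase d => a (z + z' + (phaseEquiv d : FPhase d →L[ℝ] Phase d) w)) =
      (fun w : FPhase d => a (z + (phaseEquiv d : FPhase d →L[ℝ] Phase d) w)) ∘
        fun w => w + (phaseEquiv d).symm z' := by
    funext w
    simp only [Function.comp_apply, map_add, ContinuousLinearEquiv.coe_coe,
      ContinuousLinearEquiv.apply_symm_apply]
    congr 1
    abel
  rw [phi, e1]
  refine h.trans ?_
  rw [Circle.smul_def, Real.fourierChar_apply, smul_eq_mul]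
  congr 2
  rw [innerₗ_apply_apply, real_inner_comm]
  push_cast
  ring

lemma norm_phi (a : Phase d → ℂ) (z : Phase d) (ζ : FPhase d) : ‖phi a z ζ‖ = ‖phi a 0 ζ‖ := by
  have h := phi_translate a 0 z ζ
  rw [zero_add] at h
  rw [h, norm_mul, show 2 * (Real.pi : ℂ) * Complex.I * (inner ℝ ζ ((phaseEquiv d).symm z) : ℝ) =
    ((2 * Real.pi * inner ℝ ζ ((phaseEquiv d).symm z) : ℝ) : ℂ) * Complex.I by push_cast; ring,
    Complex.norm_exp_ofReal_mul_I, one_mul]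

/-- Differentiation of `a` multiplies its Fourier transform by a linear function. -/
lemma phi_dd {a : Phase d → ℂ} (ha : ContDiff ℝ ∞ a) (hc : HasCompactSupport a) (v z : Phase d)
    (ζ : FPhase d) :
    phi (dd v a) z ζ =
      2 * Real.pi * Complex.I * (inner ℝ ζ ((phaseEquiv d).symm v) : ℝ) * phi a z ζ := by
  set S := schwartzOf ha hc z with hS
  have hg : (inner ℝ · ((phaseEquiv d).symm v) : FPhase d → ℝ).HasTemperateGrowth := by fun_prop
  have h1 : (fun w : FPhase d => dd v a (z + (phaseEquiv d : FPhase d →L[ℝ] Phase d) w)) =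
      ⇑(∂_{((phaseEquiv d).symm v : FPhase d)} S : 𝓢(FPhase d, ℂ)) := by
    funext w
    rw [SchwartzMap.lineDerivOp_apply_eq_fderiv]
    have h2 := congrFun (dd_comp_affine ha z (phaseEquiv d : FPhase d →L[ℝ] Phase d)
      ((phaseEquiv d).symm v)) w
    simp only [ContinuousLinearEquiv.coe_coe, ContinuousLinearEquiv.apply_symm_apply] at h2
    exact h2.symm
  have h3 : phi (dd v a) z ζ = (𝓕 (∂_{((phaseEquiv d).symm v : FPhase d)} S : 𝓢(FPhase d, ℂ)) :
      𝓢(FPhase d, ℂ)) ζ := by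
    rw [SchwartzMap.fourier_coe, ← h1]
    rfl
  rw [h3, SchwartzMap.fourier_lineDerivOp_eq, phi_eq_fourier_schwartzOf ha hc]
  simp only [smul_apply, SchwartzMap.smulLeftCLM_apply_apply hg, smul_eq_mul, Complex.real_smul]
  ring

lemma hasDerivAt_phi {a : Phase d → ℂ} (ha : ContDiff ℝ ∞ a) (hc : HasCompactSupport a)
    (v z : Phase d) (ζ : FPhase d) (s : ℝ) :
    HasDerivAt (fun s : ℝ => phi a (z + s • v) ζ) (phi (dd v a) (z + s • v) ζ) s := by
  rw [phi_dd ha hc]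
  have h1 : ∀ s : ℝ, phi a (z + s • v) ζ =
      Complex.exp (2 * Real.pi * Complex.I * (inner ℝ ζ ((phaseEquiv d).symm v) : ℝ) * s) *
        phi a z ζ := by
    intro s
    rw [phi_translate, map_smul, inner_smul_right]
    push_cast
    congr 2
    ring
  simp only [h1]
  have h2 : HasDerivAt (fun s : ℝ =>
      2 * Real.pi * Complex.I * ((inner ℝ ζ ((phaseEquiv d).symm v) : ℝ) : ℂ) * (s : ℂ))
      (2 * Real.pi * Complex.I * (inner ℝ ζ ((phaseEquiv d).symm v) : ℝ)) s := by
    simpa using (Complex.ofRealCLM.hasDerivAt (x := s)).const_mul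
      (2 * Real.pi * Complex.I * ((inner ℝ ζ ((phaseEquiv d).symm v) : ℝ) : ℂ))
  refine (h2.cexp.mul_const (phi a z ζ)).congr_deriv ?_
  ring

lemma integrable_PW {a b : Phase d → ℂ} (ha : ContDiff ℝ ∞ a) (hc : HasCompactSupport a) {r : ℕ}
    (hb : IsAmp r b) (τ : ℝ) (z : Phase d) :
    Integrable (fun ζ => phi a z ζ * b (z + (τ • symJ d) ζ)) :=
  integrable_schwartz_mul (𝓕 (schwartzOf ha hc z)) (hb.comp_affine z _).hasTemperateGrowth

/-- The phase space directions `(e_k, 0)`. -/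
def dirX (k : Fin d) : Phase d := (coordVec k, 0)

/-- The phase space directions `(0, e_k)`. -/
def dirXi (k : Fin d) : Phase d := (0, coordVec k)

lemma norm_coordVec (k : Fin d) : ‖(coordVec k : Config d)‖ = 1 := by simp [coordVec]

lemma norm_dirX (k : Fin d) : ‖dirX k‖ = 1 := by simp [dirX, norm_coordVec, Prod.norm_def]

lemma norm_dirXi (k : Fin d) : ‖dirXi k‖ = 1 := by simp [dirXi, norm_coordVec, Prod.norm_def]

lemma inner_coordVec (x : Config d) (k : Fin d) : inner ℝ x (coordVec k) = x k := by
  simp [coordVec, EuclideanSpace.inner_single_right]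

lemma eq_sum_coordVec (x : Config d) : x = ∑ k, x k • coordVec k := by
  ext i
  simp [coordVec, Finset.sum_apply, Pi.single_apply]

lemma symJ_eq_sum (ζ : FPhase d) :
    symJ d ζ = ∑ k, ((Real.pi * ζ.snd k) • dirX k - (Real.pi * ζ.fst k) • dirXi k) := by
  rw [symJ_apply]
  conv_lhs => rw [eq_sum_coordVec ζ.snd, eq_sum_coordVec ζ.fst]
  ext1
  · simp [Prod.fst_sum, dirX, dirXi, Finset.smul_sum, smul_smul]
  · simp [Prod.snd_sum, dirX, dirXi, Finset.smul_sum, smul_smul]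

/-- A plane wave turns differentiation along `Jζ` into the Poisson bracket. -/
lemma phi_mul_dd_symJ {a b : Phase d → ℂ} (ha : ContDiff ℝ ∞ a) (hc : HasCompactSupport a)
    (z p : Phase d) (ζ : FPhase d) :
    phi a z ζ * dd (symJ d ζ) b p =
      Complex.I / 2 * ∑ k, (phi (dd (dirX k) a) z ζ * dd (dirXi k) b p -
        phi (dd (dirXi k) a) z ζ * dd (dirX k) b p) := by
  have h1 : dd (symJ d ζ) b p = ∑ k, (((Real.pi * ζ.snd k : ℝ) : ℂ) * dd (dirX k) b p -
      ((Real.pi * ζ.fst k : ℝ) : ℂ) * dd (dirXi k) b p) := by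
    simp only [dd]
    rw [symJ_eq_sum, map_sum]
    simp only [map_sub, map_smul, Complex.real_smul]
  have h2 : ∀ k, inner ℝ ζ ((phaseEquiv d).symm (dirX k)) = ζ.fst k := by
    intro k
    rw [WithLp.prod_inner_apply]
    simp [phaseEquiv, dirX, inner_coordVec]
  have h3 : ∀ k, inner ℝ ζ ((phaseEquiv d).symm (dirXi k)) = ζ.snd k := by
    intro k
    rw [WithLp.prod_inner_apply]
    simp [phaseEquiv, dirXi, inner_coordVec]
  simp only [h1, phi_dd ha hc, h2, h3]
  rw [Finset.mul_sum, Finset.mul_sum]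
  refine Finset.sum_congr rfl fun k _ => ?_
  push_cast
  linear_combination (-Real.pi * ζ.fst k * dd (dirXi k) b p + Real.pi * ζ.snd k * dd (dirX k) b p) *
    phi a z ζ * Complex.I_sq

variable (d) in
/-- A basis of phase space. -/
def phaseBasis : Module.Basis (Fin (Module.finrank ℝ (Phase d))) ℝ (Phase d) :=
  Module.finBasis ℝ (Phase d)

/-- The expression `(i/2) ∑ (Q(∂_{x_k} a, ∂_{ξ_k} b) - Q(∂_{ξ_k} a, ∂_{x_k} b))`. For the twisted
products `Q`, it is the derivative of `Q(a, b)` in the parameter `τ`. -/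
def bracketSum (Q : (Phase d → ℂ) → (Phase d → ℂ) → ℂ) (a b : Phase d → ℂ) : ℂ :=
  Complex.I / 2 * ∑ k, (Q (dd (dirX k) a) (dd (dirXi k) b) - Q (dd (dirXi k) a) (dd (dirX k) b))

/-- The derivative of `Q(a, b)` in the direction `(v, σ)` of the variables `(z, τ)`, for the twisted
products `Q`: the Leibniz rule in `z`, and `bracketSum` in `τ`. It is written with derivatives along
a basis, so that it involves finitely many values of `Q`. -/
def pathDeriv (Q : (Phase d → ℂ) → (Phase d → ℂ) → ℂ) (v : Phase d) (σ : ℝ) (a b : Phase d → ℂ) :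
    ℂ :=
  ∑ i, ((phaseBasis d).repr v i : ℂ) * (Q (dd (phaseBasis d i) a) b + Q a (dd (phaseBasis d i) b)) +
    σ * bracketSum Q a b

lemma pathDeriv_integrand {a b : Phase d → ℂ} (ha : ContDiff ℝ ∞ a) (hc : HasCompactSupport a)
    (v z p : Phase d) (σ : ℝ) (ζ : FPhase d) :
    phi (dd v a) z ζ * b p + phi a z ζ * dd (v + σ • symJ d ζ) b p =
      pathDeriv (fun a b => phi a z ζ * b p) v σ a b := by
  have h1 : dd (v + σ • symJ d ζ) b p = dd v b p + σ * dd (symJ d ζ) b p := by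
    simp [dd]
  have h2 : phi (dd v a) z ζ =
      ∑ i, ((phaseBasis d).repr v i : ℂ) * phi (dd (phaseBasis d i) a) z ζ := by
    simp only [phi_dd ha hc]
    conv_lhs => rw [← (phaseBasis d).sum_repr v]
    simp only [map_sum, map_smul, inner_sum, inner_smul_right]
    push_cast
    rw [Finset.mul_sum, Finset.sum_mul]
    exact Finset.sum_congr rfl fun i _ => by ring
  have h3 := congrFun (dd_eq_sum (phaseBasis d) b v) p
  rw [h1, mul_add, mul_left_comm (phi a z ζ) (σ : ℂ), phi_mul_dd_symJ ha hc, h2, h3, pathDeriv,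
    bracketSum, ← add_assoc]
  congr 1
  rw [Finset.sum_mul, Finset.mul_sum, ← Finset.sum_add_distrib]
  exact Finset.sum_congr rfl fun i _ => by ring

lemma integral_pathDeriv {a b : Phase d → ℂ} (ha : ContDiff ℝ ∞ a) (hc : HasCompactSupport a)
    {r : ℕ} (hb : IsAmp r b) (v z : Phase d) (τ σ : ℝ) :
    ∫ ζ, pathDeriv (fun a b => phi a z ζ * b (z + (τ • symJ d) ζ)) v σ a b =
      pathDeriv (fun a b => PW a b τ z) v σ a b := by
  have hi : ∀ v w, Integrable fun ζ => phi (dd v a) z ζ * dd w b (z + (τ • symJ d) ζ) :=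
    fun v w => integrable_PW (contDiff_dd ha v) (hasCompactSupport_dd hc v) (hb.dd w) τ z
  have hi1 : ∀ v, Integrable fun ζ => phi (dd v a) z ζ * b (z + (τ • symJ d) ζ) :=
    fun v => integrable_PW (contDiff_dd ha v) (hasCompactSupport_dd hc v) hb τ z
  have hi2 : ∀ v, Integrable fun ζ => phi a z ζ * dd v b (z + (τ • symJ d) ζ) :=
    fun v => integrable_PW ha hc (hb.dd v) τ z
  simp only [pathDeriv, bracketSum]
  rw [integral_add, integral_finsetSum, integral_const_mul, integral_const_mul,
    integral_finsetSum]
  · congr 1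
    · refine Finset.sum_congr rfl fun i _ => ?_
      rw [integral_const_mul, integral_add (hi1 _) (hi2 _)]
      rfl
    · congr 2
      refine Finset.sum_congr rfl fun k _ => ?_
      rw [integral_sub (hi _ _) (hi _ _)]
      rfl
  · exact fun k _ => (hi _ _).sub (hi _ _)
  · exact fun i _ => ((hi1 _).add (hi2 _)).const_mul _
  · exact integrable_finsetSum _ fun i _ => ((hi1 _).add (hi2 _)).const_mul _
  · exact ((integrable_finsetSum _ fun k _ => (hi _ _).sub (hi _ _)).const_mul _).const_mul _

lemma integrable_norm_phi_mul {a : Phase d → ℂ} (ha : ContDiff ℝ ∞ a) (hc : HasCompactSupport a)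
    (k : ℕ) : Integrable fun ζ : FPhase d => ‖phi a 0 ζ‖ * (1 + ‖ζ‖ ^ 2) ^ k := by
  have := (integrable_schwartz_mul (𝓕 (schwartzOf ha hc 0))
    (hasTemperateGrowth_one_add_sq_pow (V := FPhase d) k)).norm
  refine this.congr (Eventually.of_forall fun ζ => ?_)
  simp only [norm_mul, Complex.norm_real, phi_eq_fourier_schwartzOf ha hc]
  rw [Real.norm_of_nonneg (by positivity)]

/-- The derivative of the twisted product along a line in the variables `(z, τ)`, by differentiation
under the integral sign. -/
lemma hasDerivAt_PW {a b : Phase d → ℂ} (ha : ContDiff ℝ ∞ a) (hc : HasCompactSupport a)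
    {r : ℕ} (hb : IsAmp r b) (v z : Phase d) (τ σ s₀ : ℝ) :
    HasDerivAt (fun s : ℝ => PW a b (τ + s * σ) (z + s • v))
      (pathDeriv (fun a b => PW a b (τ + s₀ * σ) (z + s₀ • v)) v σ a b) s₀ := by
  rw [← integral_pathDeriv ha hc hb]
  have hpt : ∀ (ζ : FPhase d) (s : ℝ), z + s • v + ((τ + s * σ) • symJ d) ζ =
      (z + τ • symJ d ζ) + s • (v + σ • symJ d ζ) := by
    intro ζ s
    simp only [smul_apply, add_smul, smul_add, mul_smul]
    abel
  obtain ⟨B, hB, hBb⟩ := hb.exists_bound 1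
  have hB0 : ∀ p, ‖b p‖ ≤ B * (1 + ‖p‖ ^ 2) ^ r := fun p => by simpa using hBb 0 (by omega) p
  have hB1 : ∀ w p, ‖dd w b p‖ ≤ B * (1 + ‖p‖ ^ 2) ^ r * ‖w‖ := by
    intro w p
    refine ((fderiv ℝ b p).le_opNorm w).trans ?_
    gcongr
    have := hBb 1 le_rfl p
    rwa [← norm_iteratedFDeriv_fderiv, norm_iteratedFDeriv_zero] at this
  set t : ℝ := |s₀| + 1 with ht
  set R : ℝ := ‖z‖ + t * ‖v‖ with hR
  set Q : ℝ := (|τ| + t * |σ|) * ‖symJ d‖ with hQ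
  have hR0 : 0 ≤ R := by positivity
  have hQ0 : 0 ≤ Q := by positivity
  set c : ℝ := 2 * (1 + R ^ 2) * (1 + Q ^ 2) with hcdef
  have hp : ∀ ζ : FPhase d, ∀ s ∈ Metric.ball s₀ 1,
      1 + ‖z + s • v + ((τ + s * σ) • symJ d) ζ‖ ^ 2 ≤ c * (1 + ‖ζ‖ ^ 2) := by
    intro ζ s hs
    have hst : |s| ≤ t := by
      rw [Metric.mem_ball, Real.dist_eq] at hs
      have := abs_add_le s₀ (s - s₀)
      rw [add_sub_cancel] at this
      linarith
    have h1 : ‖z + s • v‖ ≤ R := by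
      refine (norm_add_le _ _).trans ?_
      rw [norm_smul, Real.norm_eq_abs, hR]
      gcongr
    have h2 : ‖((τ + s * σ) • symJ d) ζ‖ ≤ Q * ‖ζ‖ := by
      rw [smul_apply, norm_smul, Real.norm_eq_abs, hQ, mul_assoc]
      gcongr
      · refine (abs_add_le _ _).trans ?_
        rw [abs_mul]
        gcongr
      · exact (symJ d).le_opNorm ζ
    have h3 : 1 + ‖z + s • v‖ ^ 2 ≤ 1 + R ^ 2 := by gcongr
    calc _ ≤ 2 * ((1 + ‖z + s • v‖ ^ 2) * (1 + ‖((τ + s * σ) • symJ d) ζ‖ ^ 2)) :=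
          one_add_sq_add_le _ _
      _ ≤ 2 * ((1 + R ^ 2) * ((1 + Q ^ 2) * (1 + ‖ζ‖ ^ 2))) := by
          gcongr
          exact one_add_mul_sq_le h2
      _ = _ := by rw [hcdef]; ring
  have hcont : ∀ s, Continuous fun ζ =>
      phi a (z + s • v) ζ * b (z + s • v + ((τ + s * σ) • symJ d) ζ) := by
    intro s
    rw [phi_eq_fourier_schwartzOf ha hc]
    exact (SchwartzMap.continuous _).mul (hb.comp_affine _ _).1.continuous
  refine (hasDerivAt_integral_of_dominated_loc_of_deriv_le (s := Metric.ball s₀ 1)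
    (F := fun s ζ => phi a (z + s • v) ζ * b (z + s • v + ((τ + s * σ) • symJ d) ζ))
    (F' := fun s ζ => pathDeriv (fun a b => phi a (z + s • v) ζ *
      b (z + s • v + ((τ + s * σ) • symJ d) ζ)) v σ a b)
    (bound := fun ζ => B * c ^ r * (‖phi (dd v a) 0 ζ‖ * (1 + ‖ζ‖ ^ 2) ^ r) +
      B * c ^ r * (‖v‖ + |σ| * ‖symJ d‖) * (‖phi a 0 ζ‖ * (1 + ‖ζ‖ ^ 2) ^ (r + 1)))
    (Metric.ball_mem_nhds _ one_pos) (Eventually.of_forall fun s => (hcont s).aestronglyMeasurable)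
    (integrable_PW ha hc hb _ _) ?_ (Eventually.of_forall fun ζ s hs => ?_) ?_
    (Eventually.of_forall fun ζ s hs => ?_)).2
  · simp only [← pathDeriv_integrand ha hc]
    refine Continuous.aestronglyMeasurable ?_
    rw [phi_eq_fourier_schwartzOf ha hc,
      phi_eq_fourier_schwartzOf (contDiff_dd ha v) (hasCompactSupport_dd hc v)]
    have hq : Continuous fun ζ : FPhase d => z + s₀ • v + ((τ + s₀ * σ) • symJ d) ζ := by fun_prop
    refine ((SchwartzMap.continuous _).mul (hb.1.continuous.comp hq)).add
      ((SchwartzMap.continuous _).mul ?_)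
    have hfd : Continuous (fderiv ℝ b) := hb.1.continuous_fderiv (by simp)
    exact (hfd.comp hq).clm_apply (by fun_prop)
  · rw [← pathDeriv_integrand ha hc]
    have hpr : (1 + ‖z + s • v + ((τ + s * σ) • symJ d) ζ‖ ^ 2) ^ r ≤ c ^ r * (1 + ‖ζ‖ ^ 2) ^ r := by
      rw [← mul_pow]
      exact pow_le_pow_left₀ (by positivity) (hp ζ s hs) r
    have hw : ‖v + σ • symJ d ζ‖ ≤ (‖v‖ + |σ| * ‖symJ d‖) * (1 + ‖ζ‖ ^ 2) := by
      refine (norm_add_le _ _).trans ?_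
      rw [norm_smul, Real.norm_eq_abs]
      have h1 := (symJ d).le_opNorm ζ
      have h2 : ‖ζ‖ ≤ 1 + ‖ζ‖ ^ 2 := by nlinarith [sq_nonneg (‖ζ‖ - 1), sq_nonneg ‖ζ‖]
      have h3 : (1 : ℝ) ≤ 1 + ‖ζ‖ ^ 2 := by nlinarith [sq_nonneg ‖ζ‖]
      calc _ ≤ ‖v‖ * (1 + ‖ζ‖ ^ 2) + |σ| * (‖symJ d‖ * (1 + ‖ζ‖ ^ 2)) := by
            gcongr
            · exact le_mul_of_one_le_right (norm_nonneg _) h3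
            · exact h1.trans (mul_le_mul_of_nonneg_left h2 (norm_nonneg _))
        _ = _ := by ring
    refine (norm_add_le _ _).trans ?_
    rw [norm_mul, norm_mul, norm_phi, norm_phi a]
    refine add_le_add ?_ ?_
    · calc _ ≤ ‖phi (dd v a) 0 ζ‖ * (B * (c ^ r * (1 + ‖ζ‖ ^ 2) ^ r)) := by
            gcongr
            exact (hB0 _).trans (mul_le_mul_of_nonneg_left hpr hB)
        _ = _ := by ring
    · calc _ ≤ ‖phi a 0 ζ‖ * (B * (c ^ r * (1 + ‖ζ‖ ^ 2) ^ r) *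
            ((‖v‖ + |σ| * ‖symJ d‖) * (1 + ‖ζ‖ ^ 2))) := by
            gcongr
            exact (hB1 _ _).trans (mul_le_mul (mul_le_mul_of_nonneg_left hpr hB) hw
              (norm_nonneg _) (by positivity))
        _ = _ := by ring
  · exact ((integrable_norm_phi_mul (contDiff_dd ha v) (hasCompactSupport_dd hc v) r).const_mul _).add
      ((integrable_norm_phi_mul ha hc (r + 1)).const_mul _)
  · rw [← pathDeriv_integrand ha hc]
    have hb1 := hasDerivAt_comp_line hb.1 (z + τ • symJ d ζ) (v + σ • symJ d ζ) s
    have := (hasDerivAt_phi ha hc v z ζ s).mul hb1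
    simp only [← hpt] at this
    exact this

end TwistedDeriv

/-! ### Functions given by integrals along segments -/

section Segments

variable {E : Type*} [NormedAddCommGroup E] [NormedSpace ℝ E] [FiniteDimensional ℝ E]
  {ι : Type*} [Fintype ι]

/-- The linear form with coordinates `G i z`. -/
def gradForm (B : Module.Basis ι ℝ E) (G : ι → E → ℂ) (z : E) : E →L[ℝ] ℂ :=
  ∑ i, ContinuousLinearMap.smulRight (LinearMap.toContinuousLinearMap (B.coord i)) (G i z)

lemma gradForm_apply (B : Module.Basis ι ℝ E) (G : ι → E → ℂ) (z v : E) :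
    gradForm B G z v = ∑ i, (B.repr v i : ℂ) * G i z := by
  simp [gradForm, sum_apply]

lemma contDiff_gradForm (B : Module.Basis ι ℝ E) {G : ι → E → ℂ} {n : WithTop ℕ∞}
    (hG : ∀ i, ContDiff ℝ n (G i)) : ContDiff ℝ n (gradForm B G) := by
  have : gradForm B G = fun z => ∑ i, ContinuousLinearMap.smulRightL ℝ E ℂ
      (LinearMap.toContinuousLinearMap (B.coord i)) (G i z) := by
    funext z
    simp [gradForm]
  rw [this]
  exact ContDiff.sum fun i _ => (ContinuousLinearMap.contDiff _).comp (hG i)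

/-- A function whose increments are the integrals of a continuous one-form over segments is
differentiable. -/
lemma hasFDerivAt_of_segments (B : Module.Basis ι ℝ E) {f : E → ℂ} {G : ι → E → ℂ}
    (hG : ∀ i, Continuous (G i))
    (hf : ∀ z v, f (z + v) - f z = ∫ s in (0 : ℝ)..1, ∑ i, (B.repr v i : ℂ) * G i (z + s • v))
    (z : E) : HasFDerivAt f (gradForm B G z) z := by
  have hc : Continuous (gradForm B G) :=
    contDiff_zero.1 (contDiff_gradForm B fun i => contDiff_zero.2 (hG i))
  rw [hasFDerivAt_iff_isLittleO_nhds_zero, Asymptotics.isLittleO_iff]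
  intro ε hε
  obtain ⟨δ, hδ, h⟩ := Metric.continuousAt_iff.1 (hc.continuousAt (x := z)) ε hε
  filter_upwards [Metric.ball_mem_nhds (0 : E) hδ] with v hv
  rw [mem_ball_zero_iff] at hv
  have h1 : f (z + v) - f z - gradForm B G z v =
      ∫ s in (0 : ℝ)..1, (gradForm B G (z + s • v) - gradForm B G z) v := by
    simp only [sub_apply]
    rw [intervalIntegral.integral_sub, hf]
    · simp [gradForm_apply]
    · exact Continuous.intervalIntegrable (by fun_prop) _ _
    · exact Continuous.intervalIntegrable (by fun_prop) _ _
  rw [h1]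
  refine (intervalIntegral.norm_integral_le_of_norm_le_const (C := ε * ‖v‖) fun s hs => ?_).trans
    (by simp)
  rw [uIoc_of_le zero_le_one] at hs
  refine ((gradForm B G (z + s • v) - gradForm B G z).le_opNorm v).trans ?_
  gcongr
  rw [← dist_eq_norm]
  refine (h ?_).le
  rw [dist_eq_norm, add_sub_cancel_left, norm_smul, Real.norm_of_nonneg hs.1.le]
  calc s * ‖v‖ ≤ 1 * ‖v‖ := by gcongr; exact hs.2
    _ < δ := by simpa using hv

lemma dd_of_segments (B : Module.Basis ι ℝ E) {f : E → ℂ} {G : ι → E → ℂ}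
    (hG : ∀ i, Continuous (G i))
    (hf : ∀ z v, f (z + v) - f z = ∫ s in (0 : ℝ)..1, ∑ i, (B.repr v i : ℂ) * G i (z + s • v))
    (i : ι) : dd (B i) f = G i := by
  classical
  funext z
  rw [dd, (hasFDerivAt_of_segments B hG hf z).fderiv, gradForm_apply]
  rw [Finset.sum_eq_single i]
  · simp
  · intro j _ hj
    simp [hj.symm]
  · simp

lemma contDiff_succ_of_segments (B : Module.Basis ι ℝ E) {f : E → ℂ} {G : ι → E → ℂ} {n : ℕ}
    (hG : ∀ i, ContDiff ℝ n (G i))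
    (hf : ∀ z v, f (z + v) - f z = ∫ s in (0 : ℝ)..1, ∑ i, (B.repr v i : ℂ) * G i (z + s • v)) :
    ContDiff ℝ ((n + 1 : ℕ) : WithTop ℕ∞) f := by
  have h := hasFDerivAt_of_segments B (fun i => (hG i).continuous) hf
  have h2 : fderiv ℝ f = gradForm B G := funext fun z => (h z).fderiv
  rw [show ((n + 1 : ℕ) : WithTop ℕ∞) = (n : WithTop ℕ∞) + 1 by push_cast; rfl]
  rw [contDiff_succ_iff_fderiv]
  refine ⟨fun z => (h z).differentiableAt, by simp, ?_⟩
  rw [h2]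
  exact contDiff_gradForm B hG

end Segments

/-! ### Regularity of twisted products -/

section TwistedRegularity

variable {d : ℕ}

lemma one_add_sq_pow_le_japanese (r : ℕ) (z : Phase d) :
    (1 + ‖z‖ ^ 2) ^ r ≤ japanese z ^ (2 * r : ℝ) := by
  rw [show (2 * r : ℝ) = ((2 * r : ℕ) : ℝ) by push_cast; ring, Real.rpow_natCast, pow_mul]
  exact pow_le_pow_left₀ (by positivity) (one_add_sq_le_japanese_sq z) r

/-- Twisted products of approximations are bounded, uniformly on bounded sets. -/
lemma IsApprox.exists_norm_PW_le {r : ℕ} {an : ℕ → Phase d → ℂ} {a b : Phase d → ℂ}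
    (h : IsApprox r an a) (hb : IsAmp r b) (R : ℝ) :
    ∃ C : ℝ, ∀ n, ∀ τ ∈ Icc (0 : ℝ) 1, ∀ z, ‖z‖ ≤ R → ‖PW (an n) b τ z‖ ≤ C := by
  obtain ⟨N, C, hC, hT⟩ := exists_norm_T_le (d := d) r (2 * r) (2 * r)
  obtain ⟨A, hA, hAb⟩ := h.exists_bound N
  obtain ⟨B, hB, hBb⟩ := hb.exists_bound N
  refine ⟨C * (A * B) * (2 * (1 + R ^ 2)) ^ (2 * r), fun n τ hτ z hz => ?_⟩
  rw [← T_eq_PW (h.isAmp_apply n) (h.hasCompactSupport n) hb]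
  refine (hT 1 ⟨one_pos, le_rfl⟩ τ hτ _ _ (h.isAmp_apply n) hb A B (fun k hk z => ?_)
    (fun k hk z => ?_) z).trans ?_
  · rw [one_smul]
    exact (hAb k hk n z).trans (mul_le_mul_of_nonneg_left (one_add_sq_pow_le_japanese r z) hA)
  · rw [one_smul]
    exact (hBb k hk z).trans (mul_le_mul_of_nonneg_left (one_add_sq_pow_le_japanese r z) hB)
  · rw [one_smul, show (2 * r + 2 * r : ℝ) = ((2 * (2 * r) : ℕ) : ℝ) by push_cast; ring,
      Real.rpow_natCast, pow_mul]
    have : ‖z‖ ^ 2 ≤ R ^ 2 := by gcongr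
    gcongr
    exact (japanese_sq_le z).trans (by linarith)

lemma exists_norm_T_le_of_norm_le {r : ℕ} {a b : Phase d → ℂ} (ha : IsAmp r a) (hb : IsAmp r b)
    (R : ℝ) : ∃ C : ℝ, ∀ τ ∈ Icc (0 : ℝ) 1, ∀ z, ‖z‖ ≤ R → ‖T a b τ z‖ ≤ C := by
  obtain ⟨C, hC⟩ := (isApprox_trunc ha).exists_norm_PW_le hb R
  exact ⟨C, fun τ hτ z hz => le_of_tendsto ((isApprox_trunc ha).tendsto_PW hb τ z).norm
    (Eventually.of_forall fun n => hC n τ hτ z hz)⟩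

lemma tendsto_pathDeriv {α : Type*} {l : Filter α}
    {Q : α → (Phase d → ℂ) → (Phase d → ℂ) → ℂ} {Q₀ : (Phase d → ℂ) → (Phase d → ℂ) → ℂ}
    {a : α → Phase d → ℂ} {a₀ b : Phase d → ℂ} (v : Phase d) (σ : ℝ)
    (h1 : ∀ v, Tendsto (fun i => Q i (dd v (a i)) b) l (𝓝 (Q₀ (dd v a₀) b)))
    (h2 : ∀ w, Tendsto (fun i => Q i (a i) (dd w b)) l (𝓝 (Q₀ a₀ (dd w b))))
    (h3 : ∀ v w, Tendsto (fun i => Q i (dd v (a i)) (dd w b)) l (𝓝 (Q₀ (dd v a₀) (dd w b)))) :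
    Tendsto (fun i => pathDeriv (Q i) v σ (a i) b) l (𝓝 (pathDeriv Q₀ v σ a₀ b)) :=
  (tendsto_finsetSum _ fun _ _ => ((h1 _).add (h2 _)).const_mul _).add
    (((tendsto_finsetSum _ fun _ _ => (h3 _ _).sub (h3 _ _)).const_mul _).const_mul _)

lemma exists_norm_bracketSum_le {α : Type*}
    {Q : α → (Phase d → ℂ) → (Phase d → ℂ) → ℂ} {a : α → Phase d → ℂ} {b : Phase d → ℂ}
    (h : ∀ v w, ∃ C : ℝ, ∀ i, ‖Q i (dd v (a i)) (dd w b)‖ ≤ C) :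
    ∃ C : ℝ, ∀ i, ‖bracketSum (Q i) (a i) b‖ ≤ C := by
  choose C hC using h
  refine ⟨1 / 2 * ∑ k, (C (dirX k) (dirXi k) + C (dirXi k) (dirX k)), fun i => ?_⟩
  rw [bracketSum, norm_mul]
  refine mul_le_mul (by simp) ((norm_sum_le _ _).trans (Finset.sum_le_sum fun k _ =>
    (norm_sub_le _ _).trans (add_le_add (hC _ _ _) (hC _ _ _)))) (norm_nonneg _) (by norm_num)

lemma exists_norm_pathDeriv_le {α : Type*}
    {Q : α → (Phase d → ℂ) → (Phase d → ℂ) → ℂ} {a : α → Phase d → ℂ} {b : Phase d → ℂ}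
    (h1 : ∀ v, ∃ C : ℝ, ∀ i, ‖Q i (dd v (a i)) b‖ ≤ C)
    (h2 : ∀ w, ∃ C : ℝ, ∀ i, ‖Q i (a i) (dd w b)‖ ≤ C)
    (h3 : ∀ v w, ∃ C : ℝ, ∀ i, ‖Q i (dd v (a i)) (dd w b)‖ ≤ C) :
    ∃ C : ℝ, ∀ i v σ, ‖pathDeriv (Q i) v σ (a i) b‖ ≤ C * (‖v‖ + |σ|) := by
  obtain ⟨C', hC'⟩ := exists_norm_bracketSum_le h3
  choose C₁ hC₁ using h1
  choose C₂ hC₂ using h2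
  set L : _ → (Phase d →L[ℝ] ℝ) := fun i =>
    LinearMap.toContinuousLinearMap ((phaseBasis d).coord i) with hL
  set S : ℝ := ∑ i, ‖L i‖ * (|C₁ (phaseBasis d i)| + |C₂ (phaseBasis d i)|) with hS
  have hS0 : 0 ≤ S := Finset.sum_nonneg fun i _ => by positivity
  refine ⟨S + |C'|, fun i v σ => ?_⟩
  have e1 : ‖∑ j, ((phaseBasis d).repr v j : ℂ) *
      (Q i (dd (phaseBasis d j) (a i)) b + Q i (a i) (dd (phaseBasis d j) b))‖ ≤ S * ‖v‖ := by
    refine (norm_sum_le _ _).trans ?_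
    rw [hS, Finset.sum_mul]
    refine Finset.sum_le_sum fun j _ => ?_
    rw [norm_mul, Complex.norm_real]
    have : ‖(phaseBasis d).repr v j‖ ≤ ‖L j‖ * ‖v‖ := (L j).le_opNorm v
    calc _ ≤ (‖L j‖ * ‖v‖) * (|C₁ (phaseBasis d j)| + |C₂ (phaseBasis d j)|) := by
          gcongr
          exact (norm_add_le _ _).trans (add_le_add ((hC₁ _ i).trans (le_abs_self _))
            ((hC₂ _ i).trans (le_abs_self _)))
      _ = _ := by ring
  have e2 : ‖(σ : ℂ) * bracketSum (Q i) (a i) b‖ ≤ |C'| * |σ| := by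
    rw [norm_mul, Complex.norm_real, Real.norm_eq_abs, mul_comm]
    gcongr
    exact (hC' i).trans (le_abs_self _)
  refine (norm_add_le _ _).trans ((add_le_add e1 e2).trans ?_)
  nlinarith [norm_nonneg v, abs_nonneg σ, abs_nonneg C', mul_nonneg hS0 (abs_nonneg σ),
    mul_nonneg (abs_nonneg C') (norm_nonneg v)]

lemma add_mul_mem_Icc {τ σ s : ℝ} (hτ : τ ∈ Icc (0 : ℝ) 1) (hσ : τ + σ ∈ Icc (0 : ℝ) 1)
    (hs : s ∈ Icc (0 : ℝ) 1) : τ + s * σ ∈ Icc (0 : ℝ) 1 := by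
  constructor <;> nlinarith [hτ.1, hτ.2, hσ.1, hσ.2, hs.1, hs.2]

lemma norm_add_smul_le {E : Type*} [NormedAddCommGroup E] [NormedSpace ℝ E] (z v : E) {s : ℝ}
    (hs : s ∈ Icc (0 : ℝ) 1) : ‖z + s • v‖ ≤ ‖z‖ + ‖v‖ := by
  refine (norm_add_le _ _).trans ?_
  rw [norm_smul, Real.norm_of_nonneg hs.1]
  nlinarith [norm_nonneg v, hs.2]

/-- The increments of the twisted product of amplitudes in the variables `(z, τ)`. -/
lemma T_sub_eq_integral {r : ℕ} {a b : Phase d → ℂ} (ha : IsAmp r a) (hb : IsAmp r b)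
    {τ σ : ℝ} (hτ : τ ∈ Icc (0 : ℝ) 1) (hσ : τ + σ ∈ Icc (0 : ℝ) 1) (z v : Phase d) :
    T a b (τ + σ) (z + v) - T a b τ z =
      ∫ s in (0 : ℝ)..1, pathDeriv (fun a b => T a b (τ + s * σ) (z + s • v)) v σ a b := by
  have h := isApprox_trunc ha
  set an := trunc a
  have hcont : ∀ n, Continuous fun s : ℝ =>
      pathDeriv (fun a b => PW a b (τ + s * σ) (z + s • v)) v σ (an n) b := by
    intro n
    have hc : ∀ {a b : Phase d → ℂ}, ContDiff ℝ ∞ a → HasCompactSupport a → IsAmp r b →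
        Continuous fun s : ℝ => PW a b (τ + s * σ) (z + s • v) := fun ha hc hb =>
      continuous_iff_continuousAt.2 fun s => (hasDerivAt_PW ha hc hb v z τ σ s).continuousAt
    refine continuous_iff_continuousAt.2 fun s => tendsto_pathDeriv v σ (fun v' => ?_) (fun w => ?_)
      (fun v' w => ?_)
    · exact (hc ((h.dd v').contDiff n) ((h.dd v').hasCompactSupport n) hb).continuousAt
    · exact (hc (h.contDiff n) (h.hasCompactSupport n) (hb.dd w)).continuousAt
    · exact (hc ((h.dd v').contDiff n) ((h.dd v').hasCompactSupport n) (hb.dd w)).continuousAt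
  have hn : ∀ n, PW (an n) b (τ + σ) (z + v) - PW (an n) b τ z =
      ∫ s in (0 : ℝ)..1, pathDeriv (fun a b => PW a b (τ + s * σ) (z + s • v)) v σ (an n) b := by
    intro n
    rw [intervalIntegral.integral_eq_sub_of_hasDerivAt
      (fun s _ => hasDerivAt_PW (h.contDiff n) (h.hasCompactSupport n) hb v z τ σ s)
      ((hcont n).intervalIntegrable _ _)]
    simp
  refine tendsto_nhds_unique ((h.tendsto_PW hb _ _).sub (h.tendsto_PW hb τ z)) ?_
  simp only [hn]
  have hbd : ∀ {an : ℕ → Phase d → ℂ} {a b : Phase d → ℂ}, IsApprox r an a → IsAmp r b →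
      ∃ C : ℝ, ∀ i : ℕ × Icc (0 : ℝ) 1,
        ‖PW (an i.1) b (τ + i.2 * σ) (z + (i.2 : ℝ) • v)‖ ≤ C := by
    intro an a b h hb
    obtain ⟨C, hC⟩ := h.exists_norm_PW_le hb (‖z‖ + ‖v‖)
    exact ⟨C, fun i => hC _ _ (add_mul_mem_Icc hτ hσ i.2.2) _ (norm_add_smul_le z v i.2.2)⟩
  have h1 := fun v' => hbd (h.dd v') hb
  have h2 := fun w => hbd h (hb.dd w)
  have h3 := fun v' w => hbd (h.dd v') (hb.dd w)
  obtain ⟨C, hC⟩ := exists_norm_pathDeriv_le (α := ℕ × Icc (0 : ℝ) 1)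
    (Q := fun i a b => PW a b (τ + i.2 * σ) (z + (i.2 : ℝ) • v)) (a := fun i => an i.1) (b := b)
    h1 h2 h3
  refine intervalIntegral.tendsto_integral_filter_of_dominated_convergence
    (fun _ => C * (‖v‖ + |σ|)) (Eventually.of_forall fun n => (hcont n).aestronglyMeasurable)
    (Eventually.of_forall fun n => Eventually.of_forall fun s hs => ?_) (by simp)
    (Eventually.of_forall fun s hs => ?_)
  · rw [uIoc_of_le zero_le_one] at hs
    exact hC (n, ⟨s, hs.1.le, hs.2⟩) v σ
  · exact tendsto_pathDeriv v σ (fun v' => (h.dd v').tendsto_PW hb _ _)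
      (fun w => h.tendsto_PW (hb.dd w) _ _) (fun v' w => (h.dd v').tendsto_PW (hb.dd w) _ _)

lemma exists_norm_pathDeriv_T_le {r : ℕ} {a b : Phase d → ℂ} (ha : IsAmp r a) (hb : IsAmp r b)
    (R : ℝ) : ∃ C : ℝ, ∀ τ ∈ Icc (0 : ℝ) 1, ∀ z, ‖z‖ ≤ R → ∀ v σ,
      ‖pathDeriv (fun a b => T a b τ z) v σ a b‖ ≤ C * (‖v‖ + |σ|) := by
  let α := {p : ℝ × Phase d // p.1 ∈ Icc (0 : ℝ) 1 ∧ ‖p.2‖ ≤ R}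
  have hbd : ∀ {a b : Phase d → ℂ}, IsAmp r a → IsAmp r b →
      ∃ C : ℝ, ∀ i : α, ‖T a b i.1.1 i.1.2‖ ≤ C := by
    intro a b ha hb
    obtain ⟨C, hC⟩ := exists_norm_T_le_of_norm_le ha hb R
    exact ⟨C, fun i => hC _ i.2.1 _ i.2.2⟩
  have h1 := fun v' => hbd (ha.dd v') hb
  have h2 := fun w => hbd ha (hb.dd w)
  have h3 := fun v' w => hbd (ha.dd v') (hb.dd w)
  obtain ⟨C, hC⟩ := exists_norm_pathDeriv_le
    (Q := fun (i : α) a b => T a b i.1.1 i.1.2) (a := fun _ => a) (b := b) h1 h2 h3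
  exact ⟨C, fun τ hτ z hz v σ => hC ⟨(τ, z), hτ, hz⟩ v σ⟩

lemma exists_norm_T_sub_le {r : ℕ} {a b : Phase d → ℂ} (ha : IsAmp r a) (hb : IsAmp r b) (R : ℝ) :
    ∃ C : ℝ, ∀ τ ∈ Icc (0 : ℝ) 1, ∀ τ' ∈ Icc (0 : ℝ) 1, ∀ z v, ‖z‖ + ‖v‖ ≤ R →
      ‖T a b τ' (z + v) - T a b τ z‖ ≤ C * (‖v‖ + |τ' - τ|) := by
  obtain ⟨C, hC⟩ := exists_norm_pathDeriv_T_le ha hb R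
  refine ⟨C, fun τ hτ τ' hτ' z v hzv => ?_⟩
  have hσ : τ + (τ' - τ) ∈ Icc (0 : ℝ) 1 := by simpa using hτ'
  have := T_sub_eq_integral ha hb hτ hσ z v
  rw [add_sub_cancel] at this
  rw [this]
  refine (intervalIntegral.norm_integral_le_of_norm_le_const (C := C * (‖v‖ + |τ' - τ|))
    fun s hs => ?_).trans (by simp)
  rw [uIoc_of_le zero_le_one] at hs
  have hs' : s ∈ Icc (0 : ℝ) 1 := ⟨hs.1.le, hs.2⟩
  exact hC _ (add_mul_mem_Icc hτ hσ hs') _ ((norm_add_smul_le z v hs').trans hzv) v (τ' - τ)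

lemma continuous_T {r : ℕ} {a b : Phase d → ℂ} (ha : IsAmp r a) (hb : IsAmp r b) {τ : ℝ}
    (hτ : τ ∈ Icc (0 : ℝ) 1) : Continuous (T a b τ) := by
  refine continuous_iff_continuousAt.2 fun z => ?_
  obtain ⟨C, hC⟩ := exists_norm_T_sub_le ha hb (‖z‖ + 1)
  rw [ContinuousAt, tendsto_iff_norm_sub_tendsto_zero]
  have h0 : Tendsto (fun y => C * ‖y - z‖) (𝓝 z) (𝓝 0) := by
    have : Continuous fun y : Phase d => C * ‖y - z‖ := by fun_prop
    simpa using this.tendsto z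
  refine tendsto_of_tendsto_of_tendsto_of_le_of_le' tendsto_const_nhds h0
    (Eventually.of_forall fun _ => norm_nonneg _) ?_
  filter_upwards [Metric.ball_mem_nhds z one_pos] with y hy
  rw [Metric.mem_ball, dist_eq_norm] at hy
  simpa using hC τ hτ τ hτ z (y - z) (by linarith)

lemma continuousOn_T_left {r : ℕ} {a b : Phase d → ℂ} (ha : IsAmp r a) (hb : IsAmp r b)
    (z : Phase d) : ContinuousOn (fun τ => T a b τ z) (Icc 0 1) := by
  intro τ hτ
  obtain ⟨C, hC⟩ := exists_norm_T_sub_le ha hb ‖z‖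
  rw [ContinuousWithinAt, tendsto_iff_norm_sub_tendsto_zero]
  have h0 : Tendsto (fun t => C * |t - τ|) (𝓝[Icc 0 1] τ) (𝓝 0) := by
    have : Continuous fun t : ℝ => C * |t - τ| := by fun_prop
    simpa using (this.tendsto τ).mono_left nhdsWithin_le_nhds
  refine tendsto_of_tendsto_of_tendsto_of_le_of_le' tendsto_const_nhds h0
    (Eventually.of_forall fun _ => norm_nonneg _) ?_
  filter_upwards [self_mem_nhdsWithin] with t ht
  simpa using hC τ hτ t ht z 0 (by simp)

lemma T_segments {r : ℕ} {a b : Phase d → ℂ} (ha : IsAmp r a) (hb : IsAmp r b) {τ : ℝ}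
    (hτ : τ ∈ Icc (0 : ℝ) 1) (z v : Phase d) :
    T a b τ (z + v) - T a b τ z = ∫ s in (0 : ℝ)..1, ∑ i, ((phaseBasis d).repr v i : ℂ) *
      (T (dd (phaseBasis d i) a) b τ (z + s • v) + T a (dd (phaseBasis d i) b) τ (z + s • v)) := by
  have := T_sub_eq_integral ha hb hτ (σ := 0) (by simpa using hτ) z v
  simpa [pathDeriv] using this

/-- The Leibniz rule for twisted products. -/
lemma dd_T {r : ℕ} {a b : Phase d → ℂ} (ha : IsAmp r a) (hb : IsAmp r b) {τ : ℝ}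
    (hτ : τ ∈ Icc (0 : ℝ) 1) (i) : dd (phaseBasis d i) (T a b τ) =
      fun z => T (dd (phaseBasis d i) a) b τ z + T a (dd (phaseBasis d i) b) τ z :=
  dd_of_segments (phaseBasis d) (G := fun i z => T (dd (phaseBasis d i) a) b τ z +
    T a (dd (phaseBasis d i) b) τ z)
    (fun _ => (continuous_T (ha.dd _) hb hτ).add (continuous_T ha (hb.dd _) hτ))
    (T_segments ha hb hτ) i

lemma contDiff_T {r : ℕ} {a b : Phase d → ℂ} (ha : IsAmp r a) (hb : IsAmp r b) {τ : ℝ}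
    (hτ : τ ∈ Icc (0 : ℝ) 1) : ContDiff ℝ ∞ (T a b τ) := by
  refine contDiff_infty.2 fun n => ?_
  induction n generalizing a b with
  | zero => exact contDiff_zero.2 (continuous_T ha hb hτ)
  | succ n ih =>
    exact contDiff_succ_of_segments (phaseBasis d) (G := fun i z =>
      T (dd (phaseBasis d i) a) b τ z + T a (dd (phaseBasis d i) b) τ z)
      (fun i => (ih (ha.dd _) hb).add (ih ha (hb.dd _))) (T_segments ha hb hτ)

end TwistedRegularity

/-! ### The Moyal expansion -/

section Moyal

open scoped FourierTransform

variable {d : ℕ}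

/-- The terms of the expansion of the twisted product in powers of `τ`: the coefficient of `τ^j` is
`(i/2)^j/j!` times the `j`-th power of the Poisson bidifferential operator. -/
def moyal : ℕ → (Phase d → ℂ) → (Phase d → ℂ) → Phase d → ℂ
  | 0, a, b => fun z => a z * b z
  | j + 1, a, b => fun z => ((j : ℂ) + 1)⁻¹ * bracketSum (fun a b => moyal j a b z) a b

lemma bracketSum_sub (Q Q' : (Phase d → ℂ) → (Phase d → ℂ) → ℂ) (a b : Phase d → ℂ) :
    bracketSum (fun a b => Q a b - Q' a b) a b = bracketSum Q a b - bracketSum Q' a b := by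
  simp only [bracketSum, ← mul_sub, ← Finset.sum_sub_distrib]
  congr 1
  exact Finset.sum_congr rfl fun k _ => by ring

lemma bracketSum_sum (s : Finset ℕ) (c : ℕ → ℂ) (Q : ℕ → (Phase d → ℂ) → (Phase d → ℂ) → ℂ)
    (a b : Phase d → ℂ) :
    bracketSum (fun a b => ∑ j ∈ s, c j * Q j a b) a b = ∑ j ∈ s, c j * bracketSum (Q j) a b := by
  simp only [bracketSum, Finset.mul_sum, mul_sub]
  rw [Finset.sum_comm]
  simp only [← Finset.sum_sub_distrib]
  exact Finset.sum_congr rfl fun k _ => Finset.sum_congr rfl fun k _ => by ring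

lemma contDiff_bracketSum {Q : (Phase d → ℂ) → (Phase d → ℂ) → Phase d → ℂ} {a b : Phase d → ℂ}
    (h : ∀ v w, ContDiff ℝ ∞ (Q (dd v a) (dd w b))) :
    ContDiff ℝ ∞ (fun z => bracketSum (fun a b => Q a b z) a b) :=
  contDiff_const.mul (ContDiff.sum fun _ _ => (h _ _).sub (h _ _))

lemma contDiff_moyal (j : ℕ) {a b : Phase d → ℂ} (ha : ContDiff ℝ ∞ a) (hb : ContDiff ℝ ∞ b) :
    ContDiff ℝ ∞ (moyal j a b) := by
  induction j generalizing a b with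
  | zero => exact ha.mul hb
  | succ j ih =>
    exact contDiff_const.mul (contDiff_bracketSum fun v w =>
      ih (contDiff_dd ha v) (contDiff_dd hb w))

/-- The Leibniz rule for the terms of the Moyal expansion. -/
lemma dd_moyal (j : ℕ) {a b : Phase d → ℂ} (ha : ContDiff ℝ ∞ a) (hb : ContDiff ℝ ∞ b)
    (v : Phase d) :
    dd v (moyal j a b) = fun z => moyal j (dd v a) b z + moyal j a (dd v b) z := by
  induction j generalizing a b with
  | zero => exact dd_mul ha hb v
  | succ j ih =>
    have hc : ∀ w w', ContDiff ℝ ∞ (moyal j (dd w a) (dd w' b)) := fun w w' =>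
      contDiff_moyal j (contDiff_dd ha w) (contDiff_dd hb w')
    simp only [moyal]
    rw [dd_const_mul (contDiff_bracketSum hc)]
    simp only [bracketSum]
    rw [dd_const_mul (f := fun z => ∑ k, (moyal j (dd (dirX k) a) (dd (dirXi k) b) z -
        moyal j (dd (dirXi k) a) (dd (dirX k) b) z))
        (ContDiff.sum fun _ _ => (hc _ _).sub (hc _ _)),
      dd_sum _ (f := fun k z => moyal j (dd (dirX k) a) (dd (dirXi k) b) z -
        moyal j (dd (dirXi k) a) (dd (dirX k) b) z) fun _ _ => (hc _ _).sub (hc _ _)]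
    funext z
    rw [← mul_add, ← mul_add, ← Finset.sum_add_distrib]
    refine congrArg (fun t => ((j : ℂ) + 1)⁻¹ * (Complex.I / 2 * t))
      (Finset.sum_congr rfl fun k _ => ?_)
    rw [dd_sub (hc _ _) (hc _ _), ih (contDiff_dd ha _) (contDiff_dd hb _),
      ih (contDiff_dd ha _) (contDiff_dd hb _)]
    simp only [dd_comm ha v, dd_comm hb v]
    ring

/-- At `τ = 0` the twisted product is the pointwise product, by Fourier inversion. -/
lemma T_zero {r : ℕ} {a b : Phase d → ℂ} (ha : IsAmp r a) (hb : IsAmp r b) (z : Phase d) :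
    T a b 0 z = a z * b z := by
  have h := isApprox_trunc ha
  have h1 : ∀ n, PW (trunc a n) b 0 z = trunc a n z * b z := by
    intro n
    rw [PW_eq_integral_phi]
    have h0 : ∀ ζ, z + ((0 : ℝ) • symJ d) ζ = z := fun ζ => by simp
    simp only [h0]
    rw [integral_mul_const]
    congr 1
    set S := schwartzOf (h.contDiff n) (h.hasCompactSupport n) z with hS
    rw [phi_eq_fourier_schwartzOf (h.contDiff n) (h.hasCompactSupport n), ← hS]
    have h2 : 𝓕⁻ (⇑(𝓕 S : 𝓢(FPhase d, ℂ))) 0 = S 0 := by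
      rw [← SchwartzMap.fourierInv_coe]
      simp
    rw [Real.fourierInv_eq] at h2
    simpa [hS, schwartzOf] using h2
  have h2 := h.tendsto_PW hb 0 z
  simp only [h1] at h2
  refine tendsto_nhds_unique h2 (tendsto_const_nhds.congr' ?_)
  filter_upwards [h.eventuallyEq z] with n hn
  rw [hn.eq_of_nhds]

/-- The remainder of the expansion of the twisted product in powers of `τ`. -/
def moyalRem (N : ℕ) (a b : Phase d → ℂ) (τ : ℝ) (z : Phase d) : ℂ :=
  T a b τ z - ∑ j ∈ Finset.range N, ((τ : ℂ) ^ j) * moyal j a b z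

lemma contDiff_moyalRem (N : ℕ) {r : ℕ} {a b : Phase d → ℂ} (ha : IsAmp r a) (hb : IsAmp r b)
    {τ : ℝ} (hτ : τ ∈ Icc (0 : ℝ) 1) : ContDiff ℝ ∞ (moyalRem N a b τ) :=
  (contDiff_T ha hb hτ).sub (ContDiff.sum fun j _ =>
    contDiff_const.mul (contDiff_moyal j ha.1 hb.1))

lemma dd_moyalRem (N : ℕ) {r : ℕ} {a b : Phase d → ℂ} (ha : IsAmp r a) (hb : IsAmp r b)
    {τ : ℝ} (hτ : τ ∈ Icc (0 : ℝ) 1) (i) : dd (phaseBasis d i) (moyalRem N a b τ) =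
      fun z => moyalRem N (dd (phaseBasis d i) a) b τ z +
        moyalRem N a (dd (phaseBasis d i) b) τ z := by
  have hm : ∀ j, ContDiff ℝ ∞ (fun z => (τ : ℂ) ^ j * moyal j a b z) := fun j =>
    contDiff_const.mul (contDiff_moyal j ha.1 hb.1)
  have h1 : moyalRem N a b τ = fun z => T a b τ z -
      ∑ j ∈ Finset.range N, ((τ : ℂ) ^ j) * moyal j a b z := rfl
  rw [h1, dd_sub (contDiff_T ha hb hτ) (ContDiff.sum fun j _ => hm j), dd_sum _ fun j _ => hm j,
    dd_T ha hb hτ]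
  funext z
  simp only [dd_const_mul (contDiff_moyal _ ha.1 hb.1), dd_moyal _ ha.1 hb.1, moyalRem, mul_add,
    Finset.sum_add_distrib]
  ring

/-- The recursion for the remainders, from the differential equation of the twisted product
in `τ`. -/
lemma moyalRem_succ (N : ℕ) {r : ℕ} {a b : Phase d → ℂ} (ha : IsAmp r a) (hb : IsAmp r b)
    {τ : ℝ} (hτ : τ ∈ Icc (0 : ℝ) 1) (z : Phase d) :
    moyalRem (N + 1) a b τ z =
      ∫ s in (0 : ℝ)..1, τ * bracketSum (fun a b => moyalRem N a b (s * τ) z) a b := by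
  have h0 := T_sub_eq_integral ha hb (τ := 0) (σ := τ) (by simp) (by simpa using hτ) z 0
  simp only [zero_add, add_zero, T_zero ha hb, pathDeriv, map_zero, Finsupp.coe_zero,
    Pi.zero_apply, Complex.ofReal_zero, zero_mul, Finset.sum_const_zero, smul_zero] at h0
  have hc : ContinuousOn (fun s : ℝ => (τ : ℂ) * bracketSum (fun a b => T a b (s * τ) z) a b)
      (uIcc 0 1) := by
    rw [uIcc_of_le zero_le_one]
    have h1 : ∀ {a b : Phase d → ℂ}, IsAmp r a → IsAmp r b →
        ContinuousOn (fun s : ℝ => T a b (s * τ) z) (Icc 0 1) := fun ha hb =>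
      (continuousOn_T_left ha hb z).comp (by fun_prop) fun s hs =>
        ⟨mul_nonneg hs.1 hτ.1, mul_le_one₀ hs.2 hτ.1 hτ.2⟩
    exact continuousOn_const.mul (continuousOn_const.mul (continuousOn_finsetSum _ fun k _ =>
      (h1 (ha.dd _) (hb.dd _)).sub (h1 (ha.dd _) (hb.dd _))))
  have hi : ∀ j, IntervalIntegrable (fun s : ℝ => (τ : ℂ) * (((s * τ : ℝ) : ℂ) ^ j *
      bracketSum (fun a b => moyal j a b z) a b)) volume 0 1 := fun j =>
    Continuous.intervalIntegrable (by fun_prop) _ _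
  have hpow : ∀ j : ℕ, ∫ s in (0 : ℝ)..1, ((s : ℝ) : ℂ) ^ j = ((j : ℂ) + 1)⁻¹ := by
    intro j
    have := integral_pow (a := 0) (b := 1) j
    have h2 : ∫ s in (0 : ℝ)..1, ((s : ℝ) : ℂ) ^ j = ((∫ s in (0 : ℝ)..1, s ^ j : ℝ) : ℂ) := by
      rw [← intervalIntegral.integral_ofReal]
      simp
    rw [h2, this]
    simp
  calc moyalRem (N + 1) a b τ z = (T a b τ z - a z * b z) -
        ∑ j ∈ Finset.range N, ∫ s in (0 : ℝ)..1, (τ : ℂ) * (((s * τ : ℝ) : ℂ) ^ j *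
          bracketSum (fun a b => moyal j a b z) a b) := by
        rw [moyalRem, Finset.sum_range_succ', pow_zero, one_mul, moyal]
        have : ∀ j, ∫ s in (0 : ℝ)..1, (τ : ℂ) * (((s * τ : ℝ) : ℂ) ^ j *
            bracketSum (fun a b => moyal j a b z) a b) = (τ : ℂ) ^ (j + 1) * moyal (j + 1) a b z := by
          intro j
          simp only [moyal]
          rw [← hpow j, ← intervalIntegral.integral_mul_const,
            ← intervalIntegral.integral_const_mul]
          congr 1
          funext s
          push_cast
          ring
        simp only [this]
        ring
    _ = ∫ s in (0 : ℝ)..1, ((τ : ℂ) * bracketSum (fun a b => T a b (s * τ) z) a b -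
          ∑ j ∈ Finset.range N, (τ : ℂ) * (((s * τ : ℝ) : ℂ) ^ j *
          bracketSum (fun a b => moyal j a b z) a b)) := by
        rw [intervalIntegral.integral_sub hc.intervalIntegrable
          (Continuous.intervalIntegrable (by fun_prop) _ _), h0,
          intervalIntegral.integral_finsetSum fun j _ => hi j]
    _ = _ := by
        congr 1
        funext s
        simp only [moyalRem]
        rw [bracketSum_sub, bracketSum_sum, mul_sub, Finset.mul_sum]

/-- The bounds `|∂^k a(z)| ≤ A h^k ⟨hz⟩^{m - δ k}` of the derivatives of order at most `M`. The case
`δ = 1` is that of `h`-Shubin symbols, the case `δ = 0`, `h = 1` that of amplitudes. -/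
def WeightBound (M : ℕ) (δ h m A : ℝ) (a : Phase d → ℂ) : Prop :=
  ∀ k ≤ M, ∀ z, ‖iteratedFDeriv ℝ k a z‖ ≤ A * h ^ k * japanese (h • z) ^ (m - δ * k)

lemma WeightBound.dd {M : ℕ} {δ h m A : ℝ} {a : Phase d → ℂ} (ha : ContDiff ℝ ∞ a)
    (hA : WeightBound (M + 1) δ h m A a) (v : Phase d) :
    WeightBound M δ h (m - δ) (‖v‖ * (A * h)) (dd v a) := by
  intro k hk z
  refine (norm_iteratedFDeriv_dd_le ha v k z).trans ?_
  refine (mul_le_mul_of_nonneg_left (hA (k + 1) (by omega) z) (norm_nonneg v)).trans (le_of_eq ?_)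
  push_cast
  rw [show m - δ * ((k : ℝ) + 1) = m - δ - δ * k by ring, pow_succ]
  ring

lemma WeightBound.mono {M M' : ℕ} (hM : M ≤ M') {δ h m A : ℝ} {a : Phase d → ℂ}
    (hA : WeightBound M' δ h m A a) : WeightBound M δ h m A a := fun k hk => hA k (hk.trans hM)

lemma WeightBound.nonneg {M : ℕ} {δ h m A : ℝ} {a : Phase d → ℂ} (hA : WeightBound M δ h m A a) :
    0 ≤ A := by
  have := (norm_nonneg _).trans (hA 0 (Nat.zero_le _) 0)
  rw [pow_zero, mul_one] at this
  exact nonneg_of_mul_nonneg_left this (Real.rpow_pos_of_pos (japanese_pos _) _)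

lemma WeightBound.uniform {M : ℕ} {δ h m A : ℝ} (hδ : 0 ≤ δ) (hh : h ∈ Ioc (0 : ℝ) 1)
    {a : Phase d → ℂ} (hA : WeightBound M δ h m A a) :
    ∀ k ≤ M, ∀ z, ‖iteratedFDeriv ℝ k a z‖ ≤ A * japanese (h • z) ^ m := by
  intro k hk z
  have hA0 := hA.nonneg
  refine (hA k hk z).trans ?_
  have := japanese_pos (h • z)
  calc A * h ^ k * japanese (h • z) ^ (m - δ * k) ≤ A * 1 * japanese (h • z) ^ m := by
        gcongr
        · exact pow_le_one₀ hh.1.le hh.2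
        · exact one_le_japanese _
        · nlinarith [mul_nonneg hδ (Nat.cast_nonneg (α := ℝ) k)]
    _ = _ := by ring

/-- The recursion `moyalRem_succ` trades one step of the expansion for one derivative of each symbol,
hence for the factor `h²` and the loss of `δ` from each of the two orders. -/
lemma exists_norm_moyalRem_le {δ : ℝ} (hδ : 0 ≤ δ) (N r : ℕ) (m n : ℝ) :
    ∃ (M : ℕ) (C : ℝ), 0 ≤ C ∧ ∀ h ∈ Ioc (0 : ℝ) 1, ∀ τ ∈ Icc (0 : ℝ) 1, ∀ a b : Phase d → ℂ,
      IsAmp r a → IsAmp r b → ∀ A B : ℝ, WeightBound M δ h m A a → WeightBound M δ h n B b →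
      ∀ z, ‖moyalRem N a b τ z‖ ≤
        C * (A * B) * h ^ (2 * N) * japanese (h • z) ^ (m + n - δ * (2 * N)) := by
  induction N generalizing m n with
  | zero =>
    obtain ⟨M, C, hC, hT⟩ := exists_norm_T_le (d := d) r m n
    refine ⟨M, C, hC, fun h hh τ hτ a b ha hb A B hA hB z => ?_⟩
    simpa [moyalRem] using hT h hh τ hτ a b ha hb A B (hA.uniform hδ hh) (hB.uniform hδ hh) z
  | succ N ih =>
    obtain ⟨M, C, hC, hR⟩ := ih (m - δ) (n - δ)
    -- the bracket is half of a sum of `2d` terms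
    refine ⟨M + 1, d * C, by positivity, fun h hh τ hτ a b ha hb A B hA hB z => ?_⟩
    set K := C * ((A * h) * (B * h)) * h ^ (2 * N) *
      japanese (h • z) ^ (m - δ + (n - δ) - δ * (2 * N)) with hK
    have hterm : ∀ s ∈ Icc (0 : ℝ) 1, ∀ v w : Phase d, ‖v‖ = 1 → ‖w‖ = 1 →
        ‖moyalRem N (dd v a) (dd w b) (s * τ) z‖ ≤ K := by
      intro s hs v w hv hw
      refine hR h hh (s * τ) ⟨mul_nonneg hs.1 hτ.1, mul_le_one₀ hs.2 hτ.1 hτ.2⟩ _ _ (ha.dd v)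
        (hb.dd w) _ _ ?_ ?_ z
      · simpa [hv] using hA.dd ha.1 v
      · simpa [hw] using hB.dd hb.1 w
    rw [moyalRem_succ N ha hb hτ]
    have hbound : ∀ s ∈ uIoc (0 : ℝ) 1,
        ‖τ * bracketSum (fun a b => moyalRem N a b (s * τ) z) a b‖ ≤ d * K := by
      intro s hs
      rw [uIoc_of_le zero_le_one] at hs
      have hs' : s ∈ Icc (0 : ℝ) 1 := ⟨hs.1.le, hs.2⟩
      have h1 : ‖bracketSum (fun a b => moyalRem N a b (s * τ) z) a b‖ ≤ 1 / 2 * (d * (K + K)) := by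
        rw [bracketSum, norm_mul]
        refine mul_le_mul (by simp) ?_ (norm_nonneg _) (by norm_num)
        refine (norm_sum_le_of_le (Finset.univ) fun k _ => (norm_sub_le _ _).trans (add_le_add
          (hterm s hs' _ _ (norm_dirX k) (norm_dirXi k))
          (hterm s hs' _ _ (norm_dirXi k) (norm_dirX k)))).trans (le_of_eq ?_)
        simp
        ring
      rw [norm_mul, Complex.norm_real, Real.norm_of_nonneg hτ.1]
      calc _ ≤ 1 * (1 / 2 * (d * (K + K))) := by
            gcongr
            exact hτ.2
        _ = _ := by ring
    refine (intervalIntegral.norm_integral_le_of_norm_le_const hbound).trans (le_of_eq ?_)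
    rw [hK, show m - δ + (n - δ) - δ * (2 * N) = m + n - δ * (2 * ((N + 1 : ℕ) : ℝ)) by
      push_cast; ring]
    simp
    ring

/-- The remainders of the Moyal expansion gain `h²` and, for `δ = 1`, two orders of decay at each
step; derivatives gain as those of the symbols do. -/
lemma exists_norm_iteratedFDeriv_moyalRem_le {δ : ℝ} (hδ : 0 ≤ δ) (k N r : ℕ) (m n : ℝ) :
    ∃ (M : ℕ) (C : ℝ), 0 ≤ C ∧ ∀ h ∈ Ioc (0 : ℝ) 1, ∀ τ ∈ Icc (0 : ℝ) 1, ∀ a b : Phase d → ℂ,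
      IsAmp r a → IsAmp r b → ∀ A B : ℝ, WeightBound M δ h m A a → WeightBound M δ h n B b →
      ∀ z, ‖iteratedFDeriv ℝ k (moyalRem N a b τ) z‖ ≤
        C * (A * B) * h ^ (k + 2 * N) * japanese (h • z) ^ (m + n - δ * (k + 2 * N)) := by
  induction k generalizing m n with
  | zero =>
    obtain ⟨M, C, hC, hR⟩ := exists_norm_moyalRem_le (d := d) hδ N r m n
    refine ⟨M, C, hC, fun h hh τ hτ a b ha hb A B hA hB z => ?_⟩
    simpa using hR h hh τ hτ a b ha hb A B hA hB z
  | succ k ih =>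
    obtain ⟨M₁, C₁, hC₁, h₁⟩ := ih (m - δ) n
    obtain ⟨M₂, C₂, hC₂, h₂⟩ := ih m (n - δ)
    obtain ⟨C₃, hC₃, h₃⟩ := exists_norm_iteratedFDeriv_succ_le (phaseBasis d)
    refine ⟨max M₁ M₂ + 1, C₃ * ∑ i, ‖phaseBasis d i‖ * (C₁ + C₂), by positivity,
      fun h hh τ hτ a b ha hb A B hA hB z => ?_⟩
    refine (h₃ _ (contDiff_moyalRem N ha hb hτ) k z).trans ?_
    have hA0 := hA.nonneg
    have hB0 := hB.nonneg
    set J := japanese (h • z) ^ (m + n - δ * (((k + 1 : ℕ) : ℝ) + 2 * N)) with hJ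
    have e1 : m - δ + n - δ * (k + 2 * N) = m + n - δ * (((k + 1 : ℕ) : ℝ) + 2 * N) := by
      push_cast; ring
    have e2 : m + (n - δ) - δ * (k + 2 * N) = m + n - δ * (((k + 1 : ℕ) : ℝ) + 2 * N) := by
      push_cast; ring
    have hterm : ∀ i, ‖iteratedFDeriv ℝ k (dd (phaseBasis d i) (moyalRem N a b τ)) z‖ ≤
        (‖phaseBasis d i‖ * (C₁ + C₂)) * ((A * B) * h ^ (k + 1 + 2 * N) * J) := by
      intro i
      rw [dd_moyalRem N ha hb hτ]
      have hs : ∀ {a b : Phase d → ℂ}, IsAmp r a → IsAmp r b →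
          ContDiffAt ℝ k (moyalRem N a b τ) z := fun ha hb =>
        ((contDiff_moyalRem N ha hb hτ).of_le (by exact_mod_cast le_top)).contDiffAt
      have hadd := iteratedFDeriv_add_apply (hs (ha.dd (phaseBasis d i)) hb)
        (hs ha (hb.dd (phaseBasis d i)))
      change iteratedFDeriv ℝ k (fun z => moyalRem N (dd (phaseBasis d i) a) b τ z +
        moyalRem N a (dd (phaseBasis d i) b) τ z) z = _ at hadd
      rw [hadd]
      refine (norm_add_le _ _).trans ?_
      have t1 := h₁ h hh τ hτ _ _ (ha.dd (phaseBasis d i)) hb _ _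
        ((hA.mono (by omega : M₁ + 1 ≤ max M₁ M₂ + 1)).dd ha.1 (phaseBasis d i))
        (hB.mono (by omega)) z
      have t2 := h₂ h hh τ hτ _ _ ha (hb.dd (phaseBasis d i)) _ _ (hA.mono (by omega))
        ((hB.mono (by omega : M₂ + 1 ≤ max M₁ M₂ + 1)).dd hb.1 (phaseBasis d i)) z
      rw [e1, ← hJ] at t1
      rw [e2, ← hJ] at t2
      refine (add_le_add t1 t2).trans (le_of_eq ?_)
      rw [show k + 1 + 2 * N = (k + 2 * N) + 1 by ring, pow_succ]
      ring
    calc _ ≤ C₃ * ∑ i, (‖phaseBasis d i‖ * (C₁ + C₂)) * ((A * B) * h ^ (k + 1 + 2 * N) * J) := by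
          gcongr with i
          exact hterm i
      _ = _ := by
          rw [← Finset.sum_mul]
          ring

lemma moyal_eq_sub (j : ℕ) (a b : Phase d → ℂ) :
    moyal j a b = fun z => moyalRem j a b 1 z - moyalRem (j + 1) a b 1 z := by
  funext z
  simp [moyalRem, Finset.sum_range_succ]

lemma exists_norm_iteratedFDeriv_moyal_le {δ : ℝ} (hδ : 0 ≤ δ) (k j r : ℕ) (m n : ℝ) :
    ∃ (M : ℕ) (C : ℝ), 0 ≤ C ∧ ∀ h ∈ Ioc (0 : ℝ) 1, ∀ a b : Phase d → ℂ,
      IsAmp r a → IsAmp r b → ∀ A B : ℝ, WeightBound M δ h m A a → WeightBound M δ h n B b →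
      ∀ z, ‖iteratedFDeriv ℝ k (moyal j a b) z‖ ≤
        C * (A * B) * h ^ (k + 2 * j) * japanese (h • z) ^ (m + n - δ * (k + 2 * j)) := by
  obtain ⟨M₁, C₁, hC₁, h₁⟩ := exists_norm_iteratedFDeriv_moyalRem_le (d := d) hδ k j r m n
  obtain ⟨M₂, C₂, hC₂, h₂⟩ := exists_norm_iteratedFDeriv_moyalRem_le (d := d) hδ k (j + 1) r m n
  refine ⟨max M₁ M₂, C₁ + C₂, by positivity, fun h hh a b ha hb A B hA hB z => ?_⟩
  have h01 : (1 : ℝ) ∈ Icc (0 : ℝ) 1 := ⟨zero_le_one, le_rfl⟩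
  have hA0 := hA.nonneg
  have hB0 := hB.nonneg
  have hh0 := hh.1
  have hs : ∀ N, ContDiffAt ℝ k (moyalRem N a b 1) z := fun N =>
    ((contDiff_moyalRem N ha hb h01).of_le (by exact_mod_cast le_top)).contDiffAt
  have hsub := iteratedFDeriv_sub_apply (hs j) (hs (j + 1))
  change iteratedFDeriv ℝ k (fun z => moyalRem j a b 1 z - moyalRem (j + 1) a b 1 z) z = _ at hsub
  rw [moyal_eq_sub, hsub]
  refine (norm_sub_le _ _).trans ((add_le_add
    (h₁ h hh 1 h01 a b ha hb A B (hA.mono (by omega)) (hB.mono (by omega)) z)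
    (h₂ h hh 1 h01 a b ha hb A B (hA.mono (by omega)) (hB.mono (by omega)) z)).trans ?_)
  rw [add_mul C₁, add_mul, add_mul]
  have hJ := japanese_pos (h • z)
  have hp : h ^ (k + 2 * (j + 1)) ≤ h ^ (k + 2 * j) :=
    pow_le_pow_of_le_one hh.1.le hh.2 (by omega)
  have hj : japanese (h • z) ^ (m + n - δ * (k + 2 * ((j + 1 : ℕ) : ℝ))) ≤
      japanese (h • z) ^ (m + n - δ * (k + 2 * j)) := by
    refine Real.rpow_le_rpow_of_exponent_le (one_le_japanese _) ?_
    push_cast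
    nlinarith
  gcongr

end Moyal

/-! ### The terms of the expansion as powers of the bidifferential operator -/

section WeylTerm

variable {d : ℕ}

lemma contDiff_sigmaD {F : Phase d × Phase d → ℂ} (hF : ContDiff ℝ ∞ F) :
    ContDiff ℝ ∞ (sigmaD F) :=
  ContDiff.sum fun _ _ => (contDiff_dd (contDiff_dd hF _) _).sub
    (contDiff_dd (contDiff_dd hF _) _)

lemma sigmaD_linear (c : ℂ) {G H : Fin d → Phase d × Phase d → ℂ}
    (hG : ∀ k, ContDiff ℝ ∞ (G k)) (hH : ∀ k, ContDiff ℝ ∞ (H k)) :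
    sigmaD (fun X => c * ∑ k, (G k X - H k X)) =
      fun X => c * ∑ k, (sigmaD (G k) X - sigmaD (H k) X) := by
  have h1 : ∀ (v : Phase d × Phase d) {G H : Fin d → Phase d × Phase d → ℂ},
      (∀ k, ContDiff ℝ ∞ (G k)) → (∀ k, ContDiff ℝ ∞ (H k)) →
      dd v (fun X => c * ∑ k, (G k X - H k X)) =
        fun X => c * ∑ k, (dd v (G k) X - dd v (H k) X) := by
    intro v G H hG hH
    rw [dd_const_mul (ContDiff.sum fun k _ => (hG k).sub (hH k)),
      dd_sum _ fun k _ => (hG k).sub (hH k)]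
    funext X
    simp only [dd_sub (hG _) (hH _)]
  have h2 : ∀ (v w : Phase d × Phase d),
      dd v (dd w (fun X => c * ∑ k, (G k X - H k X))) =
        fun X => c * ∑ k, (dd v (dd w (G k)) X - dd v (dd w (H k)) X) := by
    intro v w
    rw [h1 w hG hH, h1 v (fun k => contDiff_dd (hG k) w) fun k => contDiff_dd (hH k) w]
  funext X
  change ∑ i : Fin d, (dd _ (dd _ _) X - dd _ (dd _ _) X) = c * ∑ k,
    (∑ i : Fin d, (dd _ (dd _ _) X - dd _ (dd _ _) X) -
      ∑ i : Fin d, (dd _ (dd _ _) X - dd _ (dd _ _) X))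
  simp only [h2]
  simp only [← mul_sub, ← Finset.sum_sub_distrib]
  rw [← Finset.mul_sum, Finset.sum_comm]
  congr 1
  exact Finset.sum_congr rfl fun i _ => Finset.sum_congr rfl fun k _ => by ring

lemma iterate_sigmaD_linear (j : ℕ) (c : ℂ) {G H : Fin d → Phase d × Phase d → ℂ}
    (hG : ∀ k, ContDiff ℝ ∞ (G k)) (hH : ∀ k, ContDiff ℝ ∞ (H k)) :
    sigmaD^[j] (fun X => c * ∑ k, (G k X - H k X)) =
      fun X => c * ∑ k, (sigmaD^[j] (G k) X - sigmaD^[j] (H k) X) := by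
  induction j generalizing G H with
  | zero => rfl
  | succ j ih =>
    simp only [Function.iterate_succ_apply]
    rw [sigmaD_linear c hG hH, ih (fun k => contDiff_sigmaD (hG k)) fun k => contDiff_sigmaD (hH k)]

/-- The tensor product of two functions, dilated by `t`. -/
def dilTensor (t : ℝ) (f g : Phase d → ℂ) (X : Phase d × Phase d) : ℂ := f (t • X.1) * g (t • X.2)

lemma contDiff_dilTensor (t : ℝ) {f g : Phase d → ℂ} (hf : ContDiff ℝ ∞ f)
    (hg : ContDiff ℝ ∞ g) : ContDiff ℝ ∞ (dilTensor t f g) :=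
  (hf.comp (contDiff_fst.const_smul t)).mul (hg.comp (contDiff_snd.const_smul t))

lemma dd_dilTensor (t : ℝ) {f g : Phase d → ℂ} (hf : ContDiff ℝ ∞ f) (hg : ContDiff ℝ ∞ g)
    (v w : Phase d) :
    dd (v, w) (dilTensor t f g) =
      fun X => t * (dilTensor t (dd v f) g X + dilTensor t f (dd w g) X) := by
  let L₁ : Phase d × Phase d →L[ℝ] Phase d := t • ContinuousLinearMap.fst ℝ _ _
  let L₂ : Phase d × Phase d →L[ℝ] Phase d := t • ContinuousLinearMap.snd ℝ _ _
  have h0 : dilTensor t f g = fun X => f (0 + L₁ X) * g (0 + L₂ X) := by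
    funext X
    simp [dilTensor, L₁, L₂]
  rw [h0, dd_mul (contDiff_comp_affine hf 0 L₁) (contDiff_comp_affine hg 0 L₂),
    dd_comp_affine hf, dd_comp_affine hg]
  funext X
  simp [dilTensor, L₁, L₂, dd]
  ring

lemma sigmaD_dilTensor (t : ℝ) {f g : Phase d → ℂ} (hf : ContDiff ℝ ∞ f) (hg : ContDiff ℝ ∞ g) :
    sigmaD (dilTensor t f g) = fun X => ((t : ℂ) ^ 2) * ∑ k,
      (dilTensor t (dd (dirX k) f) (dd (dirXi k) g) X -
        dilTensor t (dd (dirXi k) f) (dd (dirX k) g) X) := by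
  have h0 : ∀ f : Phase d → ℂ, dd (0 : Phase d) f = fun _ => 0 := fun f => by
    funext x
    simp [dd]
  have h1 : ∀ v w : Phase d, dd (v, (0 : Phase d)) (dd ((0 : Phase d), w) (dilTensor t f g)) =
      fun X => ((t : ℂ) ^ 2) * dilTensor t (dd v f) (dd w g) X := by
    intro v w
    have e1 : dd ((0 : Phase d), w) (dilTensor t f g) =
        fun X => (t : ℂ) * dilTensor t f (dd w g) X := by
      rw [dd_dilTensor t hf hg, h0]
      funext X
      simp [dilTensor]
    rw [e1, dd_const_mul (contDiff_dilTensor t hf (contDiff_dd hg w)),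
      dd_dilTensor t hf (contDiff_dd hg w), h0]
    funext X
    simp [dilTensor]
    ring
  funext X
  rw [Finset.mul_sum]
  refine Finset.sum_congr rfl fun k _ => ?_
  rw [mul_sub, ← congrFun (h1 (dirX k) (dirXi k)) X, ← congrFun (h1 (dirXi k) (dirX k)) X]
  rfl

/-- On the diagonal, the powers of `σ(D)` applied to a tensor product are the terms of the Moyal
expansion; each `σ(D)` contributes the square of the dilation factor. -/
lemma iterate_sigmaD_dilTensor (j : ℕ) (t : ℝ) {f g : Phase d → ℂ} (hf : ContDiff ℝ ∞ f)
    (hg : ContDiff ℝ ∞ g) (w : Phase d) :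
    (Complex.I / 2) ^ j / (j.factorial : ℂ) * (sigmaD^[j] (dilTensor t f g)) (w, w) =
      (t : ℂ) ^ (2 * j) * moyal j f g (t • w) := by
  induction j generalizing f g with
  | zero => simp [dilTensor, moyal]
  | succ j ih =>
    have hs : ∀ v v', ContDiff ℝ ∞ (dilTensor t (dd v f) (dd v' g)) := fun v v' =>
      contDiff_dilTensor t (contDiff_dd hf v) (contDiff_dd hg v')
    rw [Function.iterate_succ_apply, sigmaD_dilTensor t hf hg,
      iterate_sigmaD_linear j _ (fun k => hs _ _) fun k => hs _ _]
    simp only [moyal, bracketSum]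
    have e : ∀ S : ℂ, (Complex.I / 2) ^ (j + 1) / ((j + 1).factorial : ℂ) * ((t : ℂ) ^ 2 * S) =
        (t : ℂ) ^ 2 * ((j : ℂ) + 1)⁻¹ * (Complex.I / 2) *
          ((Complex.I / 2) ^ j / (j.factorial : ℂ) * S) := by
      intro S
      have h1 : (j.factorial : ℂ) ≠ 0 := by exact_mod_cast j.factorial_ne_zero
      have h2 : (j : ℂ) + 1 ≠ 0 := by exact_mod_cast j.succ_ne_zero
      rw [Nat.factorial_succ, pow_succ]
      push_cast
      field_simp
    rw [e, Finset.mul_sum]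
    simp only [mul_sub, ih (contDiff_dd hf _) (contDiff_dd hg _)]
    simp only [← mul_sub, ← Finset.mul_sum]
    ring

/-- The powers `h^{2j}` of the expansion cancel against the dilation by `h⁻¹` in `weylTerm`. -/
lemma weylTerm_eq_moyal (j : ℕ) {a b : ℝ → Phase d → ℂ} {h : ℝ} (hh : h ≠ 0)
    (ha : ContDiff ℝ ∞ (a h)) (hb : ContDiff ℝ ∞ (b h)) (z : Phase d) :
    ((h ^ (2 * j) : ℝ) : ℂ) * weylTerm a b j h z = moyal j (a h) (b h) z := by
  have h1 : weylTerm a b j h z = (((h⁻¹ : ℝ) : ℂ)) ^ (2 * j) * moyal j (a h) (b h) (h⁻¹ • h • z) :=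
    iterate_sigmaD_dilTensor j h⁻¹ ha hb (h • z)
  rw [h1, smul_smul, inv_mul_cancel₀ hh, one_smul, ← mul_assoc]
  push_cast
  rw [← mul_pow, mul_inv_cancel₀ (by exact_mod_cast hh), one_pow, one_mul]

end WeylTerm

/-! ### The Weyl quantization of amplitudes -/

section Weyl

open scoped FourierTransform

variable {d : ℕ}

lemma exists_norm_iteratedFDeriv_schwartz_le {V : Type*} [NormedAddCommGroup V] [NormedSpace ℝ V]
    (u : 𝓢(V, ℂ)) (N K : ℕ) :
    ∃ C : ℝ, 0 ≤ C ∧ ∀ k ≤ N, ∀ x, ‖iteratedFDeriv ℝ k u x‖ ≤ C * ((1 + ‖x‖ ^ 2) ^ K)⁻¹ := by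
  set C : ℝ := 2 ^ (2 * K) *
    (Finset.Iic (2 * K, N)).sup (fun m => SchwartzMap.seminorm ℝ m.1 m.2) u with hC
  have h : ∀ k ≤ N, ∀ x, ‖iteratedFDeriv ℝ k u x‖ ≤ C * ((1 + ‖x‖ ^ 2) ^ K)⁻¹ := by
    intro k hk x
    rw [← div_eq_mul_inv, le_div_iff₀ (by positivity), mul_comm]
    refine le_trans ?_ (SchwartzMap.one_add_le_sup_seminorm_apply (𝕜 := ℝ) (m := (2 * K, N))
      le_rfl hk u x)
    rw [pow_mul]
    gcongr
    nlinarith [norm_nonneg x]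
  exact ⟨C, by positivity, h⟩

variable (d) in
/-- The map `q ↦ (q/2, 0)`. -/
def halfX : Config d →L[ℝ] Phase d := ((1 / 2 : ℝ) • ContinuousLinearMap.id ℝ (Config d)).prod 0

lemma halfX_apply (q : Config d) : halfX d q = ((1 / 2 : ℝ) • q, 0) := by simp [halfX]

lemma norm_halfX_apply_le (q : Config d) : ‖halfX d q‖ ≤ ‖q‖ := by
  rw [halfX_apply, Prod.norm_def, norm_smul]
  simp
  linarith [norm_nonneg q]

lemma norm_halfX_le : ‖halfX d‖ ≤ 1 :=
  ContinuousLinearMap.opNorm_le_bound _ zero_le_one fun q => by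
    simpa using norm_halfX_apply_le q

/-- The inner integral `∫ e^{-i⟨q, ξ⟩} c(x + q/2, ξ) u(x + q) dq` of the Weyl quantization, in the
variable `q = y - x`. -/
def innerWeyl (c : Phase d → ℂ) (u : Config d → ℂ) (x ξ : Config d) : ℂ :=
  ∫ q, Complex.exp (-(Complex.I * (inner ℝ q ξ : ℝ))) * (c ((x, ξ) + halfX d q) * u (x + q))

lemma norm_exp_neg_I_mul (t : ℝ) : ‖Complex.exp (-(Complex.I * t))‖ = 1 := by
  rw [show -(Complex.I * t) = ((-t : ℝ) : ℂ) * Complex.I by push_cast; ring,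
    Complex.norm_exp_ofReal_mul_I]

/-- The integrand of `innerWeyl` decays in `q`, uniformly for bounded `(x, ξ)`. -/
lemma exists_norm_mul_schwartz_le (u : 𝓢(Config d, ℂ)) (r : ℕ) (R : ℝ) :
    ∃ C : ℝ, 0 ≤ C ∧ ∀ (c : Phase d → ℂ) (A : ℝ), (∀ z, ‖c z‖ ≤ A * (1 + ‖z‖ ^ 2) ^ r) →
      ∀ x ξ : Config d, ‖x‖ ≤ R → ‖ξ‖ ≤ R → ∀ q, ‖c ((x, ξ) + halfX d q) * u (x + q)‖ ≤
        C * A * ((1 + ‖q‖ ^ 2) ^ (Module.finrank ℝ (Config d) + 1))⁻¹ := by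
  set n := Module.finrank ℝ (Config d) + 1
  obtain ⟨C, hC, hu⟩ := exists_norm_iteratedFDeriv_schwartz_le u 0 (r + n)
  set P : ℝ := 2 * (1 + R ^ 2) with hP
  have hP0 : 0 ≤ P := by positivity
  refine ⟨P ^ r * C * P ^ (r + n), by positivity, fun c A hA x ξ hx hξ q => ?_⟩
  have hA0 : 0 ≤ A := by simpa using (norm_nonneg _).trans (hA 0)
  have h1 : 1 + ‖(x, ξ) + halfX d q‖ ^ 2 ≤ P * (1 + ‖q‖ ^ 2) := by
    refine (one_add_sq_add_le _ _).trans ?_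
    have : ‖(x, ξ)‖ ^ 2 ≤ R ^ 2 := by
      gcongr
      exact max_le hx hξ
    have h2 : ‖halfX d q‖ ^ 2 ≤ ‖q‖ ^ 2 := by
      gcongr
      exact norm_halfX_apply_le q
    rw [hP, mul_assoc]
    gcongr
  have h2 : ((1 + ‖x + q‖ ^ 2) ^ (r + n))⁻¹ ≤ P ^ (r + n) * ((1 + ‖q‖ ^ 2) ^ (r + n))⁻¹ := by
    rw [← div_eq_mul_inv, le_div_iff₀ (by positivity), inv_mul_le_iff₀ (by positivity), ← mul_pow]
    refine pow_le_pow_left₀ (by positivity) ?_ _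
    have h3 := one_add_sq_add_le (x + q) (-x)
    rw [show x + q + -x = q by abel, norm_neg] at h3
    have h4 : ‖x‖ ^ 2 ≤ R ^ 2 := by gcongr
    refine h3.trans ?_
    rw [hP]
    nlinarith [sq_nonneg ‖x + q‖, mul_nonneg (sq_nonneg ‖x + q‖) (sub_nonneg.2 h4)]
  have h0 : ‖u (x + q)‖ ≤ C * ((1 + ‖x + q‖ ^ 2) ^ (r + n))⁻¹ := by
    simpa using hu 0 le_rfl (x + q)
  rw [norm_mul]
  calc _ ≤ A * (P * (1 + ‖q‖ ^ 2)) ^ r * (C * (P ^ (r + n) * ((1 + ‖q‖ ^ 2) ^ (r + n))⁻¹)) := by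
        gcongr
        · refine (hA _).trans ?_
          gcongr
        · refine h0.trans ?_
          gcongr
    _ = _ := by
        rw [mul_pow, pow_add (1 + ‖q‖ ^ 2)]
        field_simp

lemma continuous_innerWeyl_integrand {c : Phase d → ℂ} (hc : Continuous c) (u : 𝓢(Config d, ℂ)) :
    Continuous fun p : (Config d × Config d) × Config d =>
      Complex.exp (-(Complex.I * (inner ℝ p.2 p.1.2 : ℝ))) *
        (c (p.1 + halfX d p.2) * u (p.1.1 + p.2)) := by
  fun_prop

lemma integrable_innerWeyl {r : ℕ} {c : Phase d → ℂ} (hc : IsAmp r c) (u : 𝓢(Config d, ℂ))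
    (x ξ : Config d) : Integrable fun q =>
      Complex.exp (-(Complex.I * (inner ℝ q ξ : ℝ))) * (c ((x, ξ) + halfX d q) * u (x + q)) := by
  obtain ⟨A, -, hA⟩ := hc.exists_norm_le
  obtain ⟨C, -, h⟩ := exists_norm_mul_schwartz_le u r (max ‖x‖ ‖ξ‖)
  have hcont : Continuous fun q : Config d =>
      Complex.exp (-(Complex.I * (inner ℝ q ξ : ℝ))) * (c ((x, ξ) + halfX d q) * u (x + q)) := by
    have := hc.1.continuous
    fun_prop
  refine integrable_of_norm_le_inv hcont (C := C * A) fun q => ?_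
  rw [norm_mul, norm_exp_neg_I_mul, one_mul]
  exact h c A hA x ξ (le_max_left _ _) (le_max_right _ _) q

lemma continuous_innerWeyl {r : ℕ} {c : Phase d → ℂ} (hc : IsAmp r c) (u : 𝓢(Config d, ℂ)) :
    Continuous fun p : Config d × Config d => innerWeyl c u p.1 p.2 := by
  refine continuous_iff_continuousAt.2 fun p => ?_
  obtain ⟨A, -, hA⟩ := hc.exists_norm_le
  obtain ⟨C, -, h⟩ := exists_norm_mul_schwartz_le u r (‖p‖ + 1)
  have hcont := continuous_innerWeyl_integrand hc.1.continuous u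
  refine continuousAt_of_dominated (F := fun (p : Config d × Config d) q =>
    Complex.exp (-(Complex.I * (inner ℝ q p.2 : ℝ))) * (c (p + halfX d q) * u (p.1 + q)))
    (bound := fun q => C * A * ((1 + ‖q‖ ^ 2) ^ (Module.finrank ℝ (Config d) + 1))⁻¹)
    (Eventually.of_forall fun p => (integrable_innerWeyl hc u p.1 p.2).1) ?_
    ((integrable_inv_one_add_sq_pow (by omega)).const_mul _)
    (Eventually.of_forall fun q => ?_)
  · filter_upwards [Metric.ball_mem_nhds p one_pos] with p' hp'
    refine Eventually.of_forall fun q => ?_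
    rw [Metric.mem_ball, dist_eq_norm] at hp'
    have h1 : ‖p'‖ ≤ ‖p‖ + 1 := by
      have := norm_add_le p (p' - p)
      rw [add_sub_cancel] at this
      linarith
    rw [norm_mul, norm_exp_neg_I_mul, one_mul]
    exact h c A hA p'.1 p'.2 ((norm_fst_le p').trans h1) ((norm_snd_le p').trans h1) q
  · exact (hcont.comp (by fun_prop : Continuous fun p : Config d × Config d => (p, q))).continuousAt

lemma innerWeyl_eq_fourier (c : Phase d → ℂ) (u : Config d → ℂ) (x ξ : Config d) :
    innerWeyl c u x ξ = Complex.exp (Complex.I * (inner ℝ x ξ : ℝ)) *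
      𝓕 (fun y => c (((1 / 2 : ℝ) • x, ξ) + halfX d y) * u y) ((2 * Real.pi)⁻¹ • ξ) := by
  rw [Real.fourier_eq', ← integral_const_mul, innerWeyl, ← integral_add_left_eq_self
    (fun y => Complex.exp (Complex.I * (inner ℝ x ξ : ℝ)) * (Complex.exp
      ((-2 * Real.pi * inner ℝ y ((2 * Real.pi)⁻¹ • ξ) : ℝ) * Complex.I) •
        (c (((1 / 2 : ℝ) • x, ξ) + halfX d y) * u y))) x]
  congr 1
  funext q
  have e : ((1 / 2 : ℝ) • x, ξ) + halfX d (x + q) = (x, ξ) + halfX d q := by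
    simp only [halfX_apply, Prod.mk_add_mk, smul_add, ← add_assoc, ← add_smul]
    norm_num
  rw [e, smul_eq_mul, ← mul_assoc (Complex.exp (Complex.I * _)), ← Complex.exp_add]
  congr 2
  rw [inner_smul_right, inner_add_left]
  push_cast
  field_simp
  ring

/-- The inner integral of the Weyl quantization decays rapidly in `ξ`: it is a Fourier transform, so
that `Lam^{K + r}` yields the factor `(1 + |ξ|²)^{-(K + r)}`, of which the growth of `c` in `ξ` takes
up `(1 + |ξ|²)^r`. -/
lemma exists_norm_innerWeyl_le (u : 𝓢(Config d, ℂ)) (r K : ℕ) :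
    ∃ (M : ℕ) (C : ℝ), 0 ≤ C ∧ ∀ c : Phase d → ℂ, IsAmp r c → ∀ A : ℝ,
      (∀ k ≤ M, ∀ z, ‖iteratedFDeriv ℝ k c z‖ ≤ A * (1 + ‖z‖ ^ 2) ^ r) → ∀ x ξ,
        ‖innerWeyl c u x ξ‖ ≤ C * A * (1 + ‖x‖ ^ 2) ^ r * ((1 + ‖ξ‖ ^ 2) ^ K)⁻¹ := by
  set n := Module.finrank ℝ (Config d) + 1 with hn
  set M := 2 * (K + r) with hM
  obtain ⟨U, hU, hu⟩ := exists_norm_iteratedFDeriv_schwartz_le u M (r + n)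
  obtain ⟨L, hL, hLam⟩ := exists_iteratedFDeriv_iterate_Lam_le (Config d) (K + r)
  set I₀ := ∫ y : Config d, ((1 + ‖y‖ ^ 2) ^ n)⁻¹ with hI
  have hI0 : 0 ≤ I₀ := integral_nonneg fun y => by positivity
  have hint : Integrable fun y : Config d => ((1 + ‖y‖ ^ 2) ^ n)⁻¹ :=
    integrable_inv_one_add_sq_pow (by omega)
  set P : ℝ := 1 + (2 * Real.pi) ^ 2 with hP
  refine ⟨M, L * (2 ^ M * (4 ^ r * U)) * I₀ * P ^ (K + r), by positivity,
    fun c hc A hA x ξ => ?_⟩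
  have hA0 : 0 ≤ A := by simpa using (norm_nonneg _).trans (hA 0 (Nat.zero_le _) 0)
  set p : Phase d := ((1 / 2 : ℝ) • x, ξ) with hp
  set g : Config d → ℂ := fun y => c (p + halfX d y) with hg
  have hgA : IsAmp r g := hc.comp_affine p (halfX d)
  set f : 𝓢(Config d, ℂ) := SchwartzMap.smulLeftCLM ℂ g u with hf
  have hfc : (f : Config d → ℂ) = fun y => g y * u y := by
    funext y
    simp [hf, hgA.hasTemperateGrowth]
  set w := (2 * Real.pi)⁻¹ • ξ with hw
  set X : ℝ := (1 + ‖x‖ ^ 2) * (1 + ‖ξ‖ ^ 2) with hX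
  have hpX : 1 + ‖p‖ ^ 2 ≤ X := by
    have h1 : ‖(1 / 2 : ℝ) • x‖ ≤ ‖x‖ := by
      rw [norm_smul]
      simp
      linarith [norm_nonneg x]
    have h2 : ‖p‖ ≤ max ‖x‖ ‖ξ‖ := max_le_max h1 le_rfl
    have h3 : ‖p‖ ^ 2 ≤ max ‖x‖ ‖ξ‖ ^ 2 := by gcongr
    rw [hX]
    rcases max_cases ‖x‖ ‖ξ‖ with ⟨h, _⟩ | ⟨h, _⟩ <;> rw [h] at h3 <;>
      nlinarith [sq_nonneg ‖x‖, sq_nonneg ‖ξ‖, mul_nonneg (sq_nonneg ‖x‖) (sq_nonneg ‖ξ‖)]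
  have hgb : ∀ y, ∀ k ≤ M, ‖iteratedFDeriv ℝ k g y‖ ≤ A * (4 * X * (1 + ‖y‖ ^ 2)) ^ r := by
    intro y k hk
    refine (norm_iteratedFDeriv_comp_affine_le_of_le hc.1 (hA k hk) p (halfX d) y).trans ?_
    have h1 : ‖halfX d‖ ^ k ≤ 1 := pow_le_one₀ (norm_nonneg _) norm_halfX_le
    have h2 : 1 + ‖halfX d‖ ^ 2 ≤ 2 := by
      have := pow_le_one₀ (n := 2) (norm_nonneg _) (norm_halfX_le (d := d))
      linarith
    calc _ ≤ 1 * (A * (2 * X * 2) ^ r) * (1 + ‖y‖ ^ 2) ^ r := by gcongr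
      _ = _ := by rw [mul_pow _ (1 + ‖y‖ ^ 2)]; ring
  have hfb : ∀ y, ∀ k ≤ M, ‖iteratedFDeriv ℝ k f y‖ ≤
      2 ^ M * (4 ^ r * U) * (A * X ^ r) * ((1 + ‖y‖ ^ 2) ^ n)⁻¹ := by
    intro y k hk
    rw [hfc]
    refine (norm_iteratedFDeriv_mul_le_of_le hgA.1 (u.smooth ⊤) (hgb y)
      (fun j hj => hu j hj y) k hk).trans (le_of_eq ?_)
    rw [pow_add (1 + ‖y‖ ^ 2), mul_pow, mul_pow]
    field_simp
  have hLb : ∀ y, ‖Lam^[K + r] f y‖ ≤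
      L * (2 ^ M * (4 ^ r * U)) * (A * X ^ r) * ((1 + ‖y‖ ^ 2) ^ n)⁻¹ := by
    intro y
    have := hLam f (f.smooth ⊤) 0 y _ (fun k hk => hfb y k (by omega)) 0 le_rfl
    rw [norm_iteratedFDeriv_zero] at this
    exact this.trans (le_of_eq (by ring))
  have hFou : (1 + ‖w‖ ^ 2) ^ (K + r) * ‖(𝓕 f : 𝓢(Config d, ℂ)) w‖ ≤
      L * (2 ^ M * (4 ^ r * U)) * (A * X ^ r) * I₀ := by
    have h1 := congrArg norm (fourier_iterate_LamS f (K + r) w)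
    rw [norm_mul, norm_pow, Complex.norm_real, Real.norm_of_nonneg (by positivity)] at h1
    rw [← h1, SchwartzMap.fourier_coe]
    refine (norm_fourier_le _ _).trans ?_
    rw [coe_iterate_LamS, hI, ← integral_const_mul]
    refine integral_mono_of_nonneg (Eventually.of_forall fun y => norm_nonneg _)
      (hint.const_mul _) (Eventually.of_forall hLb)
  rw [innerWeyl_eq_fourier, norm_mul, show Complex.I * ((inner ℝ x ξ : ℝ) : ℂ) =
    ((inner ℝ x ξ : ℝ) : ℂ) * Complex.I by ring, Complex.norm_exp_ofReal_mul_I, one_mul]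
  have hFe : 𝓕 (fun y => c (p + halfX d y) * u y) w = (𝓕 f : 𝓢(Config d, ℂ)) w := by
    rw [SchwartzMap.fourier_coe, hfc]
  rw [hFe]
  have hξw : 1 + ‖ξ‖ ^ 2 ≤ P * (1 + ‖w‖ ^ 2) := by
    refine one_add_mul_sq_le ?_
    rw [hw, norm_smul, Real.norm_of_nonneg (by positivity)]
    field_simp
    exact le_rfl
  rw [← div_eq_mul_inv, le_div_iff₀ (by positivity)]
  have hkey : (1 + ‖ξ‖ ^ 2) ^ (K + r) * ‖(𝓕 f : 𝓢(Config d, ℂ)) w‖ ≤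
      P ^ (K + r) * (L * (2 ^ M * (4 ^ r * U)) * (A * X ^ r) * I₀) := by
    calc _ ≤ (P * (1 + ‖w‖ ^ 2)) ^ (K + r) * ‖(𝓕 f : 𝓢(Config d, ℂ)) w‖ := by gcongr
      _ = P ^ (K + r) * ((1 + ‖w‖ ^ 2) ^ (K + r) * ‖(𝓕 f : 𝓢(Config d, ℂ)) w‖) := by
          rw [mul_pow]; ring
      _ ≤ _ := by gcongr
  rw [hX, mul_pow, pow_add (1 + ‖ξ‖ ^ 2)] at hkey
  have hpos : (0 : ℝ) < (1 + ‖ξ‖ ^ 2) ^ r := by positivity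
  refine le_of_mul_le_mul_right ?_ hpos
  linarith

/-- The Weyl quantization of an amplitude, as an iterated integral. -/
def weylOp (c : Phase d → ℂ) (u : Config d → ℂ) (x : Config d) : ℂ :=
  (((2 * Real.pi) ^ d : ℝ) : ℂ)⁻¹ * ∫ ξ, innerWeyl c u x ξ

lemma integrable_innerWeyl_right {r : ℕ} {c : Phase d → ℂ} (hc : IsAmp r c) (u : 𝓢(Config d, ℂ))
    (x : Config d) : Integrable fun ξ => innerWeyl c u x ξ := by
  obtain ⟨M, C, -, h⟩ := exists_norm_innerWeyl_le u r (Module.finrank ℝ (Config d) + 1)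
  obtain ⟨A, -, hA⟩ := hc.exists_bound M
  have hcont : Continuous fun ξ => innerWeyl c u x ξ := by
    have := continuous_innerWeyl hc u
    fun_prop
  exact integrable_of_norm_le_inv hcont fun ξ => h c hc A hA x ξ

/-- Convergence of amplitudes: pointwise, with uniform bounds. -/
structure AmpTendsto (r : ℕ) (cn : ℕ → Phase d → ℂ) (c : Phase d → ℂ) : Prop where
  isAmp : ∀ n, IsAmp r (cn n)
  bound : ∀ k : ℕ, ∃ C : ℝ, ∀ n z, ‖iteratedFDeriv ℝ k (cn n) z‖ ≤ C * (1 + ‖z‖ ^ 2) ^ r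
  tendsto : ∀ z, Tendsto (fun n => cn n z) atTop (𝓝 (c z))

lemma AmpTendsto.exists_bound {r : ℕ} {cn : ℕ → Phase d → ℂ} {c : Phase d → ℂ}
    (h : AmpTendsto r cn c) (N : ℕ) : ∃ C : ℝ, 0 ≤ C ∧ ∀ k ≤ N, ∀ n z,
      ‖iteratedFDeriv ℝ k (cn n) z‖ ≤ C * (1 + ‖z‖ ^ 2) ^ r := by
  obtain ⟨C, hC, hb⟩ := exists_uniform_of_forall (α := ℕ × Phase d)
    (F := fun k p => ‖iteratedFDeriv ℝ k (cn p.1) p.2‖) (w := fun p => (1 + ‖p.2‖ ^ 2) ^ r)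
    (fun p => by positivity) (fun k => (h.bound k).imp fun C hC p => hC p.1 p.2) N
  exact ⟨C, hC, fun k hk n z => hb k hk (n, z)⟩

lemma IsApprox.ampTendsto {r : ℕ} {an : ℕ → Phase d → ℂ} {a : Phase d → ℂ}
    (h : IsApprox r an a) : AmpTendsto r an a where
  isAmp := h.isAmp_apply
  bound := h.bound
  tendsto z := tendsto_const_nhds.congr' <| by
    filter_upwards [h.eventuallyEq z] with n hn using hn.eq_of_nhds.symm

lemma AmpTendsto.weylOp {r : ℕ} {cn : ℕ → Phase d → ℂ} {c : Phase d → ℂ}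
    (h : AmpTendsto r cn c) (u : 𝓢(Config d, ℂ)) (x : Config d) :
    Tendsto (fun n => weylOp (cn n) u x) atTop (𝓝 (weylOp c u x)) := by
  refine Tendsto.const_mul _ ?_
  obtain ⟨M, C, -, hJ⟩ := exists_norm_innerWeyl_le u r (Module.finrank ℝ (Config d) + 1)
  obtain ⟨A, -, hA⟩ := h.exists_bound M
  refine tendsto_integral_of_dominated_convergence
    (fun ξ => C * A * (1 + ‖x‖ ^ 2) ^ r *
      ((1 + ‖ξ‖ ^ 2) ^ (Module.finrank ℝ (Config d) + 1))⁻¹)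
    (fun n => (integrable_innerWeyl_right (h.isAmp n) u x).1)
    ((integrable_inv_one_add_sq_pow (by omega)).const_mul _)
    (fun n => Eventually.of_forall fun ξ => hJ _ (h.isAmp n) A (fun k hk z => hA k hk n z) x ξ)
    (Eventually.of_forall fun ξ => ?_)
  obtain ⟨C', -, h'⟩ := exists_norm_mul_schwartz_le u r (max ‖x‖ ‖ξ‖)
  refine tendsto_integral_of_dominated_convergence
    (fun q => C' * A * ((1 + ‖q‖ ^ 2) ^ (Module.finrank ℝ (Config d) + 1))⁻¹)
    (fun n => (integrable_innerWeyl (h.isAmp n) u x ξ).1)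
    ((integrable_inv_one_add_sq_pow (by omega)).const_mul _)
    (fun n => Eventually.of_forall fun q => ?_)
    (Eventually.of_forall fun q => ((h.tendsto _).mul_const _).const_mul _)
  rw [norm_mul, norm_exp_neg_I_mul, one_mul]
  exact h' _ A (fun z => by simpa using hA 0 (Nat.zero_le _) n z) x ξ (le_max_left _ _)
    (le_max_right _ _) q

lemma regularizedWeyl_eq {r : ℕ} {c : Phase d → ℂ} (hc : IsAmp r c) (u : 𝓢(Config d, ℂ))
    {ψ : Config d → ℂ} (hψ : Continuous ψ) (hψc : HasCompactSupport ψ) {ε : ℝ} (hε : 0 < ε)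
    (x : Config d) :
    regularizedWeyl ψ ε c u x =
      (((2 * Real.pi) ^ d : ℝ) : ℂ)⁻¹ * ∫ ξ, ψ (ε • ξ) * innerWeyl c u x ξ := by
  have hψε : HasCompactSupport fun ξ : Config d => ψ (ε • ξ) := hψc.comp_smul hε.ne'
  have hint : Integrable fun p : Config d × Config d =>
      ψ (ε • p.2) * Complex.exp (Complex.I * ((inner ℝ (x - p.1) p.2 : ℝ) : ℂ)) *
        c ((1 / 2 : ℝ) • (x + p.1), p.2) * u p.1 := by
    obtain ⟨A, hA0, hA⟩ := hc.exists_norm_le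
    have h1 : Integrable fun y : Config d =>
        ‖SchwartzMap.smulLeftCLM ℂ (fun y : Config d => (((1 + ‖y‖ ^ 2) ^ r : ℝ) : ℂ)) u y‖ :=
      (SchwartzMap.integrable _).norm
    have h2 : Integrable fun ξ : Config d => A * (2 * (1 + ‖x‖ ^ 2)) ^ r *
        (‖ψ (ε • ξ)‖ * (1 + ‖ξ‖ ^ 2) ^ r) := by
      refine Integrable.const_mul (Continuous.integrable_of_hasCompactSupport (by fun_prop) ?_) _
      exact hψε.norm.mul_right
    refine (h1.mul_prod h2).mono' ?_ (Eventually.of_forall fun p => ?_)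
    · have := hc.1.continuous
      exact Continuous.aestronglyMeasurable (by fun_prop)
    · rw [SchwartzMap.smulLeftCLM_apply_apply (hasTemperateGrowth_one_add_sq_pow r), smul_eq_mul,
        norm_mul, norm_mul, norm_mul, norm_mul, Complex.norm_real,
        show Complex.I * ((inner ℝ (x - p.1) p.2 : ℝ) : ℂ) =
          ((inner ℝ (x - p.1) p.2 : ℝ) : ℂ) * Complex.I by ring, Complex.norm_exp_ofReal_mul_I,
        mul_one, Real.norm_of_nonneg (by positivity)]
      have h3 : ‖c ((1 / 2 : ℝ) • (x + p.1), p.2)‖ ≤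
          A * (2 * (1 + ‖x‖ ^ 2)) ^ r * ((1 + ‖p.1‖ ^ 2) ^ r * (1 + ‖p.2‖ ^ 2) ^ r) := by
        refine (hA _).trans ?_
        rw [mul_assoc, ← mul_pow, ← mul_pow]
        gcongr
        have h4 := one_add_sq_add_le x p.1
        have h5 : ‖(1 / 2 : ℝ) • (x + p.1)‖ ≤ ‖x + p.1‖ := by
          rw [norm_smul]
          simp
          linarith [norm_nonneg (x + p.1)]
        have h6 : ‖((1 / 2 : ℝ) • (x + p.1), p.2)‖ ^ 2 ≤ ‖x + p.1‖ ^ 2 + ‖p.2‖ ^ 2 := by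
          have : ‖((1 / 2 : ℝ) • (x + p.1), p.2)‖ ≤ max ‖x + p.1‖ ‖p.2‖ := max_le_max h5 le_rfl
          have h7 : ‖((1 / 2 : ℝ) • (x + p.1), p.2)‖ ^ 2 ≤ max ‖x + p.1‖ ‖p.2‖ ^ 2 := by gcongr
          rcases max_cases ‖x + p.1‖ ‖p.2‖ with ⟨h, _⟩ | ⟨h, _⟩ <;> rw [h] at h7 <;>
            nlinarith [sq_nonneg ‖x + p.1‖, sq_nonneg ‖p.2‖]
        calc _ ≤ (1 + ‖x + p.1‖ ^ 2) * (1 + ‖p.2‖ ^ 2) := by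
              nlinarith [mul_nonneg (sq_nonneg ‖x + p.1‖) (sq_nonneg ‖p.2‖)]
          _ ≤ 2 * ((1 + ‖x‖ ^ 2) * (1 + ‖p.1‖ ^ 2)) * (1 + ‖p.2‖ ^ 2) := by gcongr
          _ = _ := by ring
      calc _ ≤ ‖ψ (ε • p.2)‖ * (A * (2 * (1 + ‖x‖ ^ 2)) ^ r *
            ((1 + ‖p.1‖ ^ 2) ^ r * (1 + ‖p.2‖ ^ 2) ^ r)) * ‖u p.1‖ := by gcongr
        _ = _ := by ring
  rw [regularizedWeyl]
  congr 1
  rw [Measure.volume_eq_prod] at hint ⊢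
  rw [integral_prod_symm _ hint]
  congr 1
  funext ξ
  rw [innerWeyl, ← integral_const_mul, ← integral_add_left_eq_self _ x]
  congr 1
  funext q
  have e : ((1 / 2 : ℝ) • (x + (x + q)), ξ) = (x, ξ) + halfX d q := by
    simp only [halfX_apply, Prod.mk_add_mk, smul_add, ← add_assoc, ← add_smul]
    norm_num
  simp only [e, sub_add_cancel_left, inner_neg_left]
  push_cast
  rw [mul_neg]
  ring

/-- The regularized Weyl integrals converge to the iterated integral `weylOp`, because the inner
integral is integrable in `ξ`. -/
lemma weylMapsTo_of_eq {r : ℕ} {c : Phase d → ℂ} (hc : IsAmp r c) {u v : 𝓢(Config d, ℂ)}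
    (hv : ∀ x, v x = weylOp c u x) : WeylMapsTo c u v := by
  intro ψ hψ hψc hψ1 x
  rw [hv, weylOp]
  have h0 : (fun ε : ℝ => regularizedWeyl ψ ε c u x) =ᶠ[𝓝[>] 0] fun ε =>
      (((2 * Real.pi) ^ d : ℝ) : ℂ)⁻¹ * ∫ ξ, ψ (ε • ξ) * innerWeyl c u x ξ := by
    filter_upwards [self_mem_nhdsWithin] with ε hε
    exact regularizedWeyl_eq hc u hψ.continuous hψc hε x
  refine Tendsto.congr' h0.symm (Tendsto.const_mul _ ?_)
  obtain ⟨C, hC⟩ := hψ.continuous.bounded_above_of_compact_support hψc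
  have hi := integrable_innerWeyl_right hc u x
  refine tendsto_integral_filter_of_dominated_convergence (fun ξ => C * ‖innerWeyl c u x ξ‖)
    (Eventually.of_forall fun ε => ?_) (Eventually.of_forall fun ε => Eventually.of_forall
      fun ξ => ?_) (hi.norm.const_mul C) (Eventually.of_forall fun ξ => ?_)
  · have := hψ.continuous
    exact (Continuous.aestronglyMeasurable (by fun_prop)).mul hi.1
  · rw [norm_mul]
    gcongr
    exact hC _
  · have h1 : Tendsto (fun ε : ℝ => ε • ξ) (𝓝[>] 0) (𝓝 0) := by
      have : Continuous fun ε : ℝ => ε • ξ := by fun_prop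
      simpa using (this.tendsto 0).mono_left nhdsWithin_le_nhds
    refine tendsto_const_nhds.congr' ?_
    filter_upwards [h1.eventually hψ1] with ε hε
    rw [hε, one_mul]

/-- Fourier inversion. -/
lemma weylOp_one (u : 𝓢(Config d, ℂ)) (x : Config d) : weylOp (fun _ => 1) u x = u x := by
  have h1 : ∀ ξ, innerWeyl (fun _ => 1) u x ξ =
      Complex.exp (2 * Real.pi * Complex.I * (inner ℝ ((2 * Real.pi)⁻¹ • ξ) x : ℝ)) *
        (𝓕 u : 𝓢(Config d, ℂ)) ((2 * Real.pi)⁻¹ • ξ) := by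
    intro ξ
    rw [innerWeyl_eq_fourier, SchwartzMap.fourier_coe]
    simp only [one_mul]
    congr 2
    rw [inner_smul_left, real_inner_comm]
    push_cast
    simp
    field_simp
  have h2 : 𝓕⁻ (⇑(𝓕 u : 𝓢(Config d, ℂ))) x = u x := by
    rw [← SchwartzMap.fourierInv_coe]
    simp
  rw [weylOp]
  simp only [h1]
  rw [Measure.integral_comp_inv_smul volume (fun ξ : Config d =>
    Complex.exp (2 * Real.pi * Complex.I * (inner ℝ ξ x : ℝ)) * (𝓕 u : 𝓢(Config d, ℂ)) ξ),
    ← h2, Real.fourierInv_eq']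
  rw [finrank_euclideanSpace_fin, abs_of_nonneg (by positivity), Complex.real_smul, ← mul_assoc,
    inv_mul_cancel₀ (by
      have : (0 : ℝ) < (2 * Real.pi) ^ d := by positivity
      exact_mod_cast this.ne'), one_mul]
  congr 1
  funext ξ
  rw [smul_eq_mul]
  congr 2
  push_cast
  ring

end Weyl

/-! ### Weyl quantizations act on Schwartz functions -/

section WeylSchwartz

open scoped LineDeriv

variable {d : ℕ}

/-- Multiplication of a Schwartz function by the linear function `⟨·, w⟩`. -/
def mulInner (w : Config d) (u : 𝓢(Config d, ℂ)) : 𝓢(Config d, ℂ) :=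
  SchwartzMap.smulLeftCLM ℂ (fun y : Config d => ((inner ℝ y w : ℝ) : ℂ)) u

lemma mulInner_apply (w : Config d) (u : 𝓢(Config d, ℂ)) (y : Config d) :
    mulInner w u y = (inner ℝ y w : ℝ) * u y := by
  have h : (fun y : Config d => ((inner ℝ y w : ℝ) : ℂ)).HasTemperateGrowth := by
    have : (inner ℝ · w : Config d → ℝ).HasTemperateGrowth := by fun_prop
    exact Function.Complex.hasTemperateGrowth_ofReal.comp this
  rw [mulInner, SchwartzMap.smulLeftCLM_apply_apply h, smul_eq_mul]

/-- The derivative of the integrand of `innerWeyl` along a line: the derivative of the phase factor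
is a difference of multiplications by linear functions of `x + q` and of `x`. -/
lemma hasDerivAt_innerWeyl_integrand {c : Phase d → ℂ} (hc : ContDiff ℝ ∞ c) (u : 𝓢(Config d, ℂ))
    (v w x ξ q : Config d) (s : ℝ) :
    HasDerivAt (fun s : ℝ => Complex.exp (-(Complex.I * (inner ℝ q (ξ + s • w) : ℝ))) *
        (c ((x + s • v, ξ + s • w) + halfX d q) * u (x + s • v + q)))
      (Complex.exp (-(Complex.I * (inner ℝ q (ξ + s • w) : ℝ))) *
          (dd (v, w) c ((x + s • v, ξ + s • w) + halfX d q) * u (x + s • v + q)) +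
        Complex.exp (-(Complex.I * (inner ℝ q (ξ + s • w) : ℝ))) *
          (c ((x + s • v, ξ + s • w) + halfX d q) *
            (∂_{v} u : 𝓢(Config d, ℂ)) (x + s • v + q)) -
        Complex.I * (Complex.exp (-(Complex.I * (inner ℝ q (ξ + s • w) : ℝ))) *
          (c ((x + s • v, ξ + s • w) + halfX d q) * mulInner w u (x + s • v + q))) +
        Complex.I * (inner ℝ (x + s • v) w : ℝ) *
          (Complex.exp (-(Complex.I * (inner ℝ q (ξ + s • w) : ℝ))) *
            (c ((x + s • v, ξ + s • w) + halfX d q) * u (x + s • v + q)))) s := by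
  have e1 : ∀ s : ℝ, ((x, ξ) + halfX d q) + s • (v, w) = (x + s • v, ξ + s • w) + halfX d q := by
    intro s
    rw [Prod.smul_mk, add_right_comm]
    rfl
  have h1 := hasDerivAt_comp_line hc ((x, ξ) + halfX d q) (v, w) s
  simp only [e1] at h1
  have e2 : ∀ s : ℝ, (x + q) + s • v = x + s • v + q := fun s => by abel
  have h2 := hasDerivAt_comp_line (u.smooth ⊤) (x + q) v s
  simp only [e2] at h2
  have e3 : dd v u (x + s • v + q) = (∂_{v} u : 𝓢(Config d, ℂ)) (x + s • v + q) :=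
    (SchwartzMap.lineDerivOp_apply_eq_fderiv v u _).symm
  rw [e3] at h2
  have h3 : HasDerivAt (fun s : ℝ => -(Complex.I * (inner ℝ q (ξ + s • w) : ℝ)))
      (-(Complex.I * (inner ℝ q w : ℝ))) s := by
    have e4 : (fun s : ℝ => -(Complex.I * ((inner ℝ q (ξ + s • w) : ℝ) : ℂ))) = fun s : ℝ =>
        -(Complex.I * (inner ℝ q ξ : ℝ)) + -(Complex.I * (inner ℝ q w : ℝ)) * (s : ℂ) := by
      funext s
      rw [inner_add_right, inner_smul_right]
      push_cast
      ring
    rw [e4]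
    simpa using ((Complex.ofRealCLM.hasDerivAt (x := s)).const_mul
      (-(Complex.I * ((inner ℝ q w : ℝ) : ℂ)))).const_add (-(Complex.I * ((inner ℝ q ξ : ℝ) : ℂ)))
  refine (h3.cexp.mul (h1.mul h2)).congr_deriv ?_
  rw [mulInner_apply, inner_add_left (x + s • v) q w]
  push_cast
  simp only [Pi.mul_apply]
  ring

lemma integral_add_sub_add {α : Type*} [MeasurableSpace α] {μ : Measure α} {f₁ f₂ f₃ f₄ : α → ℂ}
    (h₁ : Integrable f₁ μ) (h₂ : Integrable f₂ μ) (h₃ : Integrable f₃ μ) (h₄ : Integrable f₄ μ)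
    (c e : ℂ) : ∫ q, (f₁ q + f₂ q - c * f₃ q + e * f₄ q) ∂μ =
      ∫ q, f₁ q ∂μ + ∫ q, f₂ q ∂μ - c * ∫ q, f₃ q ∂μ + e * ∫ q, f₄ q ∂μ := by
  rw [← integral_const_mul, ← integral_const_mul, ← integral_add h₁ h₂,
    ← integral_sub (f := fun q => f₁ q + f₂ q) (h₁.add h₂) (h₃.const_mul c),
    ← integral_add (f := fun q => f₁ q + f₂ q - c * f₃ q) ((h₁.add h₂).sub (h₃.const_mul c))
      (h₄.const_mul e)]

lemma hasDerivAt_innerWeyl {r : ℕ} {c : Phase d → ℂ} (hc : IsAmp r c) (u : 𝓢(Config d, ℂ))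
    (v w x ξ : Config d) (s₀ : ℝ) :
    HasDerivAt (fun s : ℝ => innerWeyl c u (x + s • v) (ξ + s • w))
      (innerWeyl (dd (v, w) c) u (x + s₀ • v) (ξ + s₀ • w) +
        innerWeyl c (∂_{v} u : 𝓢(Config d, ℂ)) (x + s₀ • v) (ξ + s₀ • w) -
        Complex.I * innerWeyl c (mulInner w u) (x + s₀ • v) (ξ + s₀ • w) +
        Complex.I * (inner ℝ (x + s₀ • v) w : ℝ) *
          innerWeyl c u (x + s₀ • v) (ξ + s₀ • w)) s₀ := by
  set n := Module.finrank ℝ (Config d) + 1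
  set R : ℝ := (‖x‖ + ‖ξ‖) + (|s₀| + 1) * (‖v‖ + ‖w‖) with hR
  have hbd : ∀ {c : Phase d → ℂ}, IsAmp r c → ∀ u : 𝓢(Config d, ℂ), ∃ C : ℝ, 0 ≤ C ∧
      ∀ s ∈ Metric.ball s₀ 1, ∀ q,
        ‖Complex.exp (-(Complex.I * (inner ℝ q (ξ + s • w) : ℝ))) *
          (c ((x + s • v, ξ + s • w) + halfX d q) * u (x + s • v + q))‖ ≤
        C * ((1 + ‖q‖ ^ 2) ^ n)⁻¹ := by
    intro c hc u
    obtain ⟨A, hA0, hA⟩ := hc.exists_norm_le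
    obtain ⟨C, hC, h⟩ := exists_norm_mul_schwartz_le u r R
    refine ⟨C * A, by positivity, fun s hs q => ?_⟩
    have hst : |s| ≤ |s₀| + 1 := by
      rw [Metric.mem_ball, Real.dist_eq] at hs
      have := abs_add_le s₀ (s - s₀)
      rw [add_sub_cancel] at this
      linarith
    have hle : ∀ y y' : Config d, ‖y + s • y'‖ ≤ ‖y‖ + (|s₀| + 1) * ‖y'‖ := by
      intro y y'
      refine (norm_add_le _ _).trans ?_
      rw [norm_smul, Real.norm_eq_abs]
      gcongr
    have hp : 0 ≤ |s₀| + 1 := by positivity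
    rw [norm_mul, norm_exp_neg_I_mul, one_mul]
    refine h c A hA _ _ ((hle x v).trans ?_) ((hle ξ w).trans ?_) q
    · rw [hR]
      nlinarith [norm_nonneg ξ, mul_nonneg hp (norm_nonneg w)]
    · rw [hR]
      nlinarith [norm_nonneg x, mul_nonneg hp (norm_nonneg v)]
  obtain ⟨C₁, hC₁, h₁⟩ := hbd (hc.dd (v, w)) u
  obtain ⟨C₂, hC₂, h₂⟩ := hbd hc (∂_{v} u : 𝓢(Config d, ℂ))
  obtain ⟨C₃, hC₃, h₃⟩ := hbd hc (mulInner w u)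
  obtain ⟨C₄, hC₄, h₄⟩ := hbd hc u
  set R' : ℝ := (‖x‖ + (|s₀| + 1) * ‖v‖) * ‖w‖ with hR'
  have hin : ∀ s ∈ Metric.ball s₀ 1, |inner ℝ (x + s • v) w| ≤ R' := by
    intro s hs
    have hst : |s| ≤ |s₀| + 1 := by
      rw [Metric.mem_ball, Real.dist_eq] at hs
      have := abs_add_le s₀ (s - s₀)
      rw [add_sub_cancel] at this
      linarith
    refine (abs_real_inner_le_norm _ _).trans ?_
    rw [hR']
    gcongr
    refine (norm_add_le _ _).trans ?_
    rw [norm_smul, Real.norm_eq_abs]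
    gcongr
  have hi := fun {c : Phase d → ℂ} => integrable_innerWeyl (d := d) (r := r) (c := c)
  have i1 := hi (hc.dd (v, w)) u (x + s₀ • v) (ξ + s₀ • w)
  have i2 := hi hc (∂_{v} u : 𝓢(Config d, ℂ)) (x + s₀ • v) (ξ + s₀ • w)
  have i3 := hi hc (mulInner w u) (x + s₀ • v) (ξ + s₀ • w)
  have i4 := hi hc u (x + s₀ • v) (ξ + s₀ • w)
  have hmain := (hasDerivAt_integral_of_dominated_loc_of_deriv_le
    (bound := fun q => (C₁ + C₂ + C₃ + R' * C₄) * ((1 + ‖q‖ ^ 2) ^ n)⁻¹)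
    (Metric.ball_mem_nhds s₀ one_pos)
    (Eventually.of_forall fun s => (hi hc u (x + s • v) (ξ + s • w)).1) i4
    (((i1.add i2).sub (i3.const_mul Complex.I)).add
      (i4.const_mul (Complex.I * (inner ℝ (x + s₀ • v) w : ℝ)))).1
    (Eventually.of_forall fun q s hs => ?_)
    ((integrable_inv_one_add_sq_pow (by omega)).const_mul _)
    (Eventually.of_forall fun q s hs => hasDerivAt_innerWeyl_integrand hc.1 u v w x ξ q s)).2
  · refine hmain.congr_deriv ?_
    exact integral_add_sub_add i1 i2 i3 i4 _ _
  · have e := add_le_add (add_le_add (add_le_add (h₁ s hs q) (h₂ s hs q)) (h₃ s hs q))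
      (mul_le_mul (hin s hs) (h₄ s hs q) (norm_nonneg _) ((abs_nonneg _).trans (hin s hs)))
    refine le_trans ?_ (e.trans (le_of_eq (by ring)))
    refine (norm_add_le _ _).trans (add_le_add ((norm_sub_le _ _).trans (add_le_add
      (norm_add_le _ _) (le_of_eq ?_))) (le_of_eq ?_))
    · rw [norm_mul, Complex.norm_I, one_mul]
    · rw [norm_mul, norm_mul, Complex.norm_I, one_mul, Complex.norm_real, Real.norm_eq_abs]

lemma mulInner_zero (u : 𝓢(Config d, ℂ)) : mulInner 0 u = 0 := by
  ext x
  simp [mulInner_apply]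

lemma innerWeyl_zero (c : Phase d → ℂ) (x ξ : Config d) :
    innerWeyl c 0 x ξ = 0 := by
  simp [innerWeyl]

/-- Multiplication by coordinate functions commutes with Weyl quantization up to a derivative of the
amplitude, by integration by parts in `ξ`. -/
lemma inner_mul_weylOp {r : ℕ} {c : Phase d → ℂ} (hc : IsAmp r c) (u : 𝓢(Config d, ℂ))
    (w x : Config d) :
    (inner ℝ x w : ℝ) * weylOp c u x =
      weylOp c (mulInner w u) x + Complex.I * weylOp (dd (0, w) c) u x := by
  have i1 := integrable_innerWeyl_right (hc.dd (0, w)) u x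
  have i3 := integrable_innerWeyl_right hc (mulInner w u) x
  have i4 := integrable_innerWeyl_right hc u x
  have hd : ∀ ξ, HasLineDerivAt ℝ (fun ξ => innerWeyl c u x ξ)
      (innerWeyl (dd (0, w) c) u x ξ - Complex.I * innerWeyl c (mulInner w u) x ξ +
        Complex.I * (inner ℝ x w : ℝ) * innerWeyl c u x ξ) ξ w := by
    intro ξ
    have h := hasDerivAt_innerWeyl hc u 0 w x ξ 0
    rw [HasLineDerivAt]
    simpa [innerWeyl_zero] using h
  have hI : Integrable fun ξ => innerWeyl (dd (0, w) c) u x ξ -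
      Complex.I * innerWeyl c (mulInner w u) x ξ +
        Complex.I * (inner ℝ x w : ℝ) * innerWeyl c u x ξ :=
    (i1.sub (i3.const_mul Complex.I)).add (i4.const_mul (Complex.I * (inner ℝ x w : ℝ)))
  have h0 := integral_bilinear_hasLineDerivAt_right_eq_neg_left_of_integrable (μ := volume)
    (f := fun _ : Config d => (1 : ℂ)) (f' := fun _ => 0)
    (g := fun ξ => innerWeyl c u x ξ) (v := w) (B := ContinuousLinearMap.mul ℝ ℂ)
    (by simp) (by simpa using hI) (by simpa using i4)
    (fun ξ _ => by simpa [HasLineDerivAt] using hasDerivAt_const (0 : ℝ) (1 : ℂ)) (fun ξ _ => hd ξ)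
  simp only [ContinuousLinearMap.mul_apply', one_mul, zero_mul, integral_zero, neg_zero] at h0
  rw [integral_add (f := fun ξ => innerWeyl (dd (0, w) c) u x ξ -
    Complex.I * innerWeyl c (mulInner w u) x ξ) (i1.sub (i3.const_mul Complex.I))
    (i4.const_mul _), integral_sub i1 (i3.const_mul _), integral_const_mul, integral_const_mul] at h0
  simp only [weylOp]
  linear_combination (-(((2 * Real.pi) ^ d : ℝ) : ℂ)⁻¹ * Complex.I) * h0 +
    ((((2 * Real.pi) ^ d : ℝ) : ℂ)⁻¹ * ((inner ℝ x w : ℝ) * (∫ ξ, innerWeyl c u x ξ) -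
      ∫ ξ, innerWeyl c (mulInner w u) x ξ)) * Complex.I_sq

lemma hasDerivAt_weylOp {r : ℕ} {c : Phase d → ℂ} (hc : IsAmp r c) (u : 𝓢(Config d, ℂ))
    (v x : Config d) (s₀ : ℝ) :
    HasDerivAt (fun s : ℝ => weylOp c u (x + s • v))
      (weylOp (dd (v, 0) c) u (x + s₀ • v) +
        weylOp c (∂_{v} u : 𝓢(Config d, ℂ)) (x + s₀ • v)) s₀ := by
  set n := Module.finrank ℝ (Config d) + 1
  set R : ℝ := ‖x‖ + (|s₀| + 1) * ‖v‖ with hR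
  have hbd : ∀ {c : Phase d → ℂ}, IsAmp r c → ∀ u : 𝓢(Config d, ℂ), ∃ C : ℝ,
      ∀ s ∈ Metric.ball s₀ 1, ∀ ξ,
        ‖innerWeyl c u (x + s • v) ξ‖ ≤ C * ((1 + ‖ξ‖ ^ 2) ^ n)⁻¹ := by
    intro c hc u
    obtain ⟨M, C, hC, h⟩ := exists_norm_innerWeyl_le u r n
    obtain ⟨A, hA0, hA⟩ := hc.exists_bound M
    refine ⟨C * A * (1 + R ^ 2) ^ r, fun s hs ξ => (h c hc A hA _ _).trans ?_⟩
    have hst : |s| ≤ |s₀| + 1 := by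
      rw [Metric.mem_ball, Real.dist_eq] at hs
      have := abs_add_le s₀ (s - s₀)
      rw [add_sub_cancel] at this
      linarith
    gcongr
    refine (norm_add_le _ _).trans ?_
    rw [norm_smul, Real.norm_eq_abs, hR]
    gcongr
  obtain ⟨C₁, h₁⟩ := hbd (hc.dd (v, 0)) u
  obtain ⟨C₂, h₂⟩ := hbd hc (∂_{v} u : 𝓢(Config d, ℂ))
  have hi := fun {c : Phase d → ℂ} => integrable_innerWeyl_right (d := d) (r := r) (c := c)
  have i1 := hi (hc.dd (v, 0)) u (x + s₀ • v)
  have i2 := hi hc (∂_{v} u : 𝓢(Config d, ℂ)) (x + s₀ • v)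
  have hmain := (hasDerivAt_integral_of_dominated_loc_of_deriv_le
    (F := fun (s : ℝ) ξ => innerWeyl c u (x + s • v) ξ)
    (F' := fun (s : ℝ) ξ => innerWeyl (dd (v, 0) c) u (x + s • v) ξ +
      innerWeyl c (∂_{v} u : 𝓢(Config d, ℂ)) (x + s • v) ξ)
    (bound := fun ξ => (C₁ + C₂) * ((1 + ‖ξ‖ ^ 2) ^ n)⁻¹)
    (Metric.ball_mem_nhds s₀ one_pos)
    (Eventually.of_forall fun s => (hi hc u (x + s • v)).1) (hi hc u (x + s₀ • v))
    (i1.add i2).1 (Eventually.of_forall fun ξ s hs => ?_)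
    ((integrable_inv_one_add_sq_pow (by omega)).const_mul _)
    (Eventually.of_forall fun ξ s hs => ?_)).2
  · refine (hmain.const_mul ((((2 * Real.pi) ^ d : ℝ) : ℂ)⁻¹)).congr_deriv ?_
    simp only [weylOp]
    rw [integral_add i1 i2]
    ring
  · rw [add_mul]
    exact (norm_add_le _ _).trans (add_le_add (h₁ s hs ξ) (h₂ s hs ξ))
  · have h := hasDerivAt_innerWeyl hc u v 0 x ξ s
    simpa [mulInner_zero, innerWeyl_zero] using h

lemma continuous_weylOp {r : ℕ} {c : Phase d → ℂ} (hc : IsAmp r c) (u : 𝓢(Config d, ℂ)) :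
    Continuous (weylOp c u) := by
  refine continuous_iff_continuousAt.2 fun x => ?_
  obtain ⟨M, C, hC, h⟩ := exists_norm_innerWeyl_le u r (Module.finrank ℝ (Config d) + 1)
  obtain ⟨A, hA0, hA⟩ := hc.exists_bound M
  have hcont := continuous_innerWeyl hc u
  refine ContinuousAt.mul continuousAt_const ?_
  refine continuousAt_of_dominated (F := fun x ξ => innerWeyl c u x ξ)
    (bound := fun ξ => C * A * (1 + (‖x‖ + 1) ^ 2) ^ r *
      ((1 + ‖ξ‖ ^ 2) ^ (Module.finrank ℝ (Config d) + 1))⁻¹)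
    (Eventually.of_forall fun x => (integrable_innerWeyl_right hc u x).1) ?_
    ((integrable_inv_one_add_sq_pow (by omega)).const_mul _)
    (Eventually.of_forall fun ξ => ?_)
  · filter_upwards [Metric.ball_mem_nhds x one_pos] with y hy
    refine Eventually.of_forall fun ξ => (h c hc A hA y ξ).trans ?_
    rw [Metric.mem_ball, dist_eq_norm] at hy
    have h1 : ‖y‖ ≤ ‖x‖ + 1 := by
      have := norm_add_le x (y - x)
      rw [add_sub_cancel] at this
      linarith
    gcongr
  · have : Continuous fun x => innerWeyl c u x ξ := by fun_prop
    exact this.continuousAt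

lemma weylOp_sum_left {ι : Type*} (t : Finset ι) {r : ℕ} {c : ι → Phase d → ℂ}
    (hc : ∀ i, IsAmp r (c i)) (α : ι → ℂ) (u : 𝓢(Config d, ℂ)) (x : Config d) :
    weylOp (fun z => ∑ i ∈ t, α i * c i z) u x = ∑ i ∈ t, α i * weylOp (c i) u x := by
  have h : ∀ ξ, innerWeyl (fun z => ∑ i ∈ t, α i * c i z) u x ξ =
      ∑ i ∈ t, α i * innerWeyl (c i) u x ξ := by
    intro ξ
    simp only [innerWeyl, ← integral_const_mul]
    rw [← integral_finsetSum _ fun i _ => (integrable_innerWeyl (hc i) u x ξ).const_mul _]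
    congr 1
    funext q
    rw [Finset.sum_mul, Finset.mul_sum]
    exact Finset.sum_congr rfl fun i _ => by ring
  simp only [weylOp, h]
  rw [integral_finsetSum _ fun i _ => (integrable_innerWeyl_right (hc i) u x).const_mul _,
    Finset.mul_sum]
  refine Finset.sum_congr rfl fun i _ => ?_
  rw [integral_const_mul]
  ring

lemma weylOp_sum_right {ι : Type*} (t : Finset ι) {r : ℕ} {c : Phase d → ℂ}
    (hc : IsAmp r c) (α : ι → ℂ) (u : ι → 𝓢(Config d, ℂ)) (x : Config d) :
    weylOp c (fun y => ∑ i ∈ t, α i * u i y) x = ∑ i ∈ t, α i * weylOp c (u i) x := by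
  have h : ∀ ξ, innerWeyl c (fun y => ∑ i ∈ t, α i * u i y) x ξ =
      ∑ i ∈ t, α i * innerWeyl c (u i) x ξ := by
    intro ξ
    simp only [innerWeyl, ← integral_const_mul]
    rw [← integral_finsetSum _ fun i _ => (integrable_innerWeyl hc (u i) x ξ).const_mul _]
    congr 1
    funext q
    rw [Finset.mul_sum, Finset.mul_sum]
    exact Finset.sum_congr rfl fun i _ => by ring
  simp only [weylOp, h]
  rw [integral_finsetSum _ fun i _ => (integrable_innerWeyl_right hc (u i) x).const_mul _,
    Finset.mul_sum]
  refine Finset.sum_congr rfl fun i _ => ?_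
  rw [integral_const_mul]
  ring

variable (d) in
/-- A basis of configuration space. -/
def configBasis : Module.Basis (Fin (Module.finrank ℝ (Config d))) ℝ (Config d) :=
  Module.finBasis ℝ (Config d)

/-- The increments of a Weyl quantization, expressed through finitely many derivatives of the
amplitude and of the Schwartz function. -/
lemma weylOp_segments {r : ℕ} {c : Phase d → ℂ} (hc : IsAmp r c) (u : 𝓢(Config d, ℂ))
    (x v : Config d) : weylOp c u (x + v) - weylOp c u x =
      ∫ s in (0 : ℝ)..1, ∑ i, ((configBasis d).repr v i : ℂ) *
        (weylOp (dd (configBasis d i, 0) c) u (x + s • v) +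
          weylOp c (∂_{configBasis d i} u : 𝓢(Config d, ℂ)) (x + s • v)) := by
  have hcont : Continuous fun s : ℝ => weylOp (dd (v, 0) c) u (x + s • v) +
      weylOp c (∂_{v} u : 𝓢(Config d, ℂ)) (x + s • v) := by
    have h1 := continuous_weylOp (hc.dd (v, 0)) u
    have h2 := continuous_weylOp hc (∂_{v} u : 𝓢(Config d, ℂ))
    fun_prop
  have h := intervalIntegral.integral_eq_sub_of_hasDerivAt
    (fun s _ => hasDerivAt_weylOp hc u v x s) (hcont.intervalIntegrable 0 1)
  simp only [one_smul, zero_smul, add_zero] at h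
  rw [← h]
  congr 1
  funext s
  have e1 : dd (v, (0 : Config d)) c =
      fun z => ∑ i, ((configBasis d).repr v i : ℂ) * dd (configBasis d i, 0) c z := by
    funext z
    simp only [dd]
    have : (v, (0 : Config d)) = ∑ i, (configBasis d).repr v i • (configBasis d i, (0 : Config d)) := by
      conv_lhs => rw [← (configBasis d).sum_repr v]
      ext1
      · simp [Prod.fst_sum]
      · simp [Prod.snd_sum]
    rw [this, map_sum]
    simp only [map_smul, Complex.real_smul]
  have e2 : ⇑(∂_{v} u : 𝓢(Config d, ℂ)) = fun y => ∑ i, ((configBasis d).repr v i : ℂ) *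
      (∂_{configBasis d i} u : 𝓢(Config d, ℂ)) y := by
    funext y
    simp only [SchwartzMap.lineDerivOp_apply_eq_fderiv]
    exact congrFun (dd_eq_sum (configBasis d) u v) y
  rw [e1, e2, weylOp_sum_left _ fun i => hc.dd _, weylOp_sum_right _ hc, ← Finset.sum_add_distrib]
  exact Finset.sum_congr rfl fun i _ => by ring

lemma dd_weylOp {r : ℕ} {c : Phase d → ℂ} (hc : IsAmp r c) (u : 𝓢(Config d, ℂ)) (i) :
    dd (configBasis d i) (weylOp c u) = fun x => weylOp (dd (configBasis d i, 0) c) u x +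
      weylOp c (∂_{configBasis d i} u : 𝓢(Config d, ℂ)) x :=
  dd_of_segments (configBasis d) (G := fun i x => weylOp (dd (configBasis d i, 0) c) u x +
      weylOp c (∂_{configBasis d i} u : 𝓢(Config d, ℂ)) x)
    (fun _ => (continuous_weylOp (hc.dd _) _).add (continuous_weylOp hc _))
    (weylOp_segments hc u) i

lemma contDiff_weylOp {r : ℕ} {c : Phase d → ℂ} (hc : IsAmp r c) (u : 𝓢(Config d, ℂ)) :
    ContDiff ℝ ∞ (weylOp c u) := by
  refine contDiff_infty.2 fun n => ?_
  induction n generalizing c u with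
  | zero => exact contDiff_zero.2 (continuous_weylOp hc u)
  | succ n ih =>
    exact contDiff_succ_of_segments (configBasis d)
      (G := fun i x => weylOp (dd (configBasis d i, 0) c) u x +
        weylOp c (∂_{configBasis d i} u : 𝓢(Config d, ℂ)) x)
      (fun i => (ih (hc.dd _) _).add (ih hc _)) (weylOp_segments hc u)

/-- Weyl quantizations decay faster than any power: all weights `(1 + ∑ |x_k|)^K` are allowed, with
a bound whose growth `(1 + |x|²)^r` does not depend on `K`. -/
lemma exists_pow_mul_norm_weylOp_le {r : ℕ} (K : ℕ) {c : Phase d → ℂ} (hc : IsAmp r c)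
    (u : 𝓢(Config d, ℂ)) :
    ∃ C : ℝ, 0 ≤ C ∧ ∀ x : Config d,
      (1 + ∑ k, |x k|) ^ K * ‖weylOp c u x‖ ≤ C * (1 + ‖x‖ ^ 2) ^ r := by
  induction K generalizing c u with
  | zero =>
    obtain ⟨M, C, hC, h⟩ := exists_norm_innerWeyl_le u r (Module.finrank ℝ (Config d) + 1)
    obtain ⟨A, hA0, hA⟩ := hc.exists_bound M
    set I₀ := ∫ ξ : Config d, ((1 + ‖ξ‖ ^ 2) ^ (Module.finrank ℝ (Config d) + 1))⁻¹ with hI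
    have hI0 : 0 ≤ I₀ := integral_nonneg fun y => by positivity
    refine ⟨‖(((2 * Real.pi) ^ d : ℝ) : ℂ)⁻¹‖ * (C * A * I₀), by positivity, fun x => ?_⟩
    rw [pow_zero, one_mul, weylOp, norm_mul, mul_assoc]
    gcongr
    calc _ ≤ ∫ ξ : Config d, C * A * (1 + ‖x‖ ^ 2) ^ r *
          ((1 + ‖ξ‖ ^ 2) ^ (Module.finrank ℝ (Config d) + 1))⁻¹ :=
          norm_integral_le_of_norm_le ((integrable_inv_one_add_sq_pow (by omega)).const_mul _)
            (Eventually.of_forall fun ξ => h c hc A hA x ξ)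
      _ = _ := by
          rw [integral_const_mul, hI]
          ring
  | succ K ih =>
    obtain ⟨C₀, hC₀, h₀⟩ := ih hc u
    have h1 := fun k : Fin d => ih hc (mulInner (coordVec k) u)
    have h2 := fun k : Fin d => ih (hc.dd (0, coordVec k)) u
    choose C₁ hC₁ h₁ using h1
    choose C₂ hC₂ h₂ using h2
    refine ⟨C₀ + ∑ k, (C₁ k + C₂ k), add_nonneg hC₀ (Finset.sum_nonneg fun k _ =>
      add_nonneg (hC₁ k) (hC₂ k)), fun x => ?_⟩
    have hS : 0 ≤ 1 + ∑ k, |x k| := by positivity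
    have hk : ∀ k, |x k| * ‖weylOp c u x‖ ≤
        ‖weylOp c (mulInner (coordVec k) u) x‖ + ‖weylOp (dd (0, coordVec k) c) u x‖ := by
      intro k
      have := congrArg norm (inner_mul_weylOp hc u (coordVec k) x)
      rw [inner_coordVec, norm_mul, Complex.norm_real, Real.norm_eq_abs] at this
      rw [this]
      refine (norm_add_le _ _).trans ?_
      rw [norm_mul, Complex.norm_I, one_mul]
    calc (1 + ∑ k, |x k|) ^ (K + 1) * ‖weylOp c u x‖ =
          (1 + ∑ k, |x k|) ^ K * (‖weylOp c u x‖ + ∑ k, |x k| * ‖weylOp c u x‖) := by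
          rw [← Finset.sum_mul]
          ring
      _ ≤ (1 + ∑ k, |x k|) ^ K * (‖weylOp c u x‖ + ∑ k : Fin d,
          (‖weylOp c (mulInner (coordVec k) u) x‖ + ‖weylOp (dd (0, coordVec k) c) u x‖)) := by
          gcongr with k
          exact hk k
      _ = (1 + ∑ k, |x k|) ^ K * ‖weylOp c u x‖ + ∑ k : Fin d,
          ((1 + ∑ k, |x k|) ^ K * ‖weylOp c (mulInner (coordVec k) u) x‖ +
            (1 + ∑ k, |x k|) ^ K * ‖weylOp (dd (0, coordVec k) c) u x‖) := by
          rw [mul_add, Finset.mul_sum]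
          simp only [mul_add]
      _ ≤ C₀ * (1 + ‖x‖ ^ 2) ^ r + ∑ k : Fin d, (C₁ k * (1 + ‖x‖ ^ 2) ^ r +
            C₂ k * (1 + ‖x‖ ^ 2) ^ r) :=
          add_le_add (h₀ x) (Finset.sum_le_sum fun k _ => add_le_add (h₁ k x) (h₂ k x))
      _ = _ := by
          simp only [← add_mul, ← Finset.sum_mul]

lemma exists_pow_mul_norm_iteratedFDeriv_weylOp_le {r : ℕ} (p k : ℕ) {c : Phase d → ℂ}
    (hc : IsAmp r c) (u : 𝓢(Config d, ℂ)) :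
    ∃ C : ℝ, ∀ x, ‖x‖ ^ p * ‖iteratedFDeriv ℝ k (weylOp c u) x‖ ≤ C := by
  induction k generalizing c u with
  | zero =>
    obtain ⟨C, hC, h⟩ := exists_pow_mul_norm_weylOp_le (p + 2 * r) hc u
    refine ⟨C, fun x => ?_⟩
    rw [norm_iteratedFDeriv_zero]
    have hx : ‖x‖ ≤ ∑ k, |x k| := by
      conv_lhs => rw [eq_sum_coordVec x]
      refine (norm_sum_le _ _).trans (le_of_eq (Finset.sum_congr rfl fun k _ => ?_))
      rw [norm_smul, norm_coordVec, mul_one, Real.norm_eq_abs]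
    set S := ∑ k, |x k| with hS
    have hx0 := norm_nonneg x
    have h1 : ‖x‖ ^ p ≤ (1 + S) ^ p := by gcongr; linarith
    have h2 : (1 + ‖x‖ ^ 2) ^ r ≤ (1 + S) ^ (2 * r) := by
      rw [pow_mul]
      gcongr
      nlinarith
    have h3 : (0 : ℝ) < (1 + ‖x‖ ^ 2) ^ r := by positivity
    refine le_of_mul_le_mul_right ?_ h3
    calc _ ≤ (1 + S) ^ p * ‖weylOp c u x‖ * (1 + S) ^ (2 * r) := by gcongr
      _ = (1 + S) ^ (p + 2 * r) * ‖weylOp c u x‖ := by rw [pow_add]; ring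
      _ ≤ _ := h x
  | succ k ih =>
    obtain ⟨C₀, hC₀, h₀⟩ := exists_norm_iteratedFDeriv_succ_le (configBasis d)
    have h1 := fun i => ih (hc.dd (configBasis d i, (0 : Config d))) u
    have h2 := fun i => ih hc (∂_{configBasis d i} u : 𝓢(Config d, ℂ))
    choose C₁ h₁ using h1
    choose C₂ h₂ using h2
    refine ⟨C₀ * ∑ i, (C₁ i + C₂ i), fun x => ?_⟩
    have hs : ∀ {c : Phase d → ℂ}, IsAmp r c → ∀ u : 𝓢(Config d, ℂ),
        ContDiffAt ℝ k (weylOp c u) x := fun hc u =>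
      ((contDiff_weylOp hc u).of_le (by exact_mod_cast le_top)).contDiffAt
    have hi : ∀ i, ‖x‖ ^ p * ‖iteratedFDeriv ℝ k (dd (configBasis d i) (weylOp c u)) x‖ ≤
        C₁ i + C₂ i := by
      intro i
      have hadd := iteratedFDeriv_add_apply (hs (hc.dd (configBasis d i, (0 : Config d))) u)
        (hs hc (∂_{configBasis d i} u : 𝓢(Config d, ℂ)))
      change iteratedFDeriv ℝ k (fun x => weylOp (dd (configBasis d i, 0) c) u x +
        weylOp c (∂_{configBasis d i} u : 𝓢(Config d, ℂ)) x) x = _ at hadd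
      rw [dd_weylOp hc u, hadd]
      calc _ ≤ ‖x‖ ^ p * (‖iteratedFDeriv ℝ k (weylOp (dd (configBasis d i, (0 : Config d)) c) u) x‖ +
            ‖iteratedFDeriv ℝ k (weylOp c (∂_{configBasis d i} u : 𝓢(Config d, ℂ))) x‖) := by
            gcongr
            exact norm_add_le _ _
        _ ≤ _ := by
            rw [mul_add]
            exact add_le_add (h₁ i x) (h₂ i x)
    calc _ ≤ ‖x‖ ^ p * (C₀ * ∑ i, ‖iteratedFDeriv ℝ k (dd (configBasis d i) (weylOp c u)) x‖) := by
          gcongr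
          exact h₀ _ (contDiff_weylOp hc u) k x
      _ = C₀ * ∑ i, ‖x‖ ^ p * ‖iteratedFDeriv ℝ k (dd (configBasis d i) (weylOp c u)) x‖ := by
          rw [← Finset.mul_sum]
          ring
      _ ≤ _ := by
          gcongr with i
          exact hi i

/-- The Weyl quantization of an amplitude, as a map on Schwartz functions. -/
def weylS {r : ℕ} {c : Phase d → ℂ} (hc : IsAmp r c) (u : 𝓢(Config d, ℂ)) : 𝓢(Config d, ℂ) where
  toFun := weylOp c u
  smooth' := contDiff_weylOp hc u
  decay' p k := exists_pow_mul_norm_iteratedFDeriv_weylOp_le p k hc u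

lemma weylMapsTo_weylS {r : ℕ} {c : Phase d → ℂ} (hc : IsAmp r c) (u : 𝓢(Config d, ℂ)) :
    WeylMapsTo c u (weylS hc u) := weylMapsTo_of_eq hc fun _ => rfl

end WeylSchwartz

/-! ### Composition of Weyl quantizations -/

section Composition

open scoped FourierTransform

variable {d : ℕ}

lemma two_pi_mul_inner (ζ : FPhase d) (z : Phase d) :
    2 * Real.pi * inner ℝ ζ ((phaseEquiv d).symm z) =
      2 * inner ℝ (symJ d ζ).1 z.2 - 2 * inner ℝ (symJ d ζ).2 z.1 := by
  rw [WithLp.prod_inner_apply, symJ_apply]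
  simp only [inner_smul_left, inner_neg_left]
  simp [phaseEquiv]
  ring

/-- The phase factor of the Weyl quantization of a plane wave. -/
def waveFactor (ζ : FPhase d) (x : Config d) : ℂ :=
  Complex.exp (-(Complex.I * (2 * inner ℝ (symJ d ζ).2 (x + (symJ d ζ).1) : ℝ)))

lemma norm_waveFactor (ζ : FPhase d) (x : Config d) : ‖waveFactor ζ x‖ = 1 :=
  norm_exp_neg_I_mul _

/-- A plane wave in the amplitude translates the point, the covariable, and multiplies by a phase
factor. -/
lemma innerWeyl_planeWave (b : Phase d → ℂ) (u : Config d → ℂ) (ζ : FPhase d) (x ξ : Config d) :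
    innerWeyl (fun z => Complex.exp (2 * Real.pi * Complex.I *
        (inner ℝ ζ ((phaseEquiv d).symm z) : ℝ)) * b (z + symJ d ζ)) u x ξ =
      waveFactor ζ x *
        innerWeyl b u (x + (2 : ℝ) • (symJ d ζ).1) (ξ + (symJ d ζ).2) := by
  rw [innerWeyl, ← integral_add_left_eq_self _ ((2 : ℝ) • (symJ d ζ).1), innerWeyl,
    ← integral_const_mul]
  congr 1
  funext q
  set J := symJ d ζ with hJ
  have e1 : (x, ξ) + halfX d ((2 : ℝ) • J.1 + q) + J =
      (x + (2 : ℝ) • J.1, ξ + J.2) + halfX d q := by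
    rw [halfX_apply, halfX_apply]
    ext1
    · simp only [Prod.fst_add]
      module
    · simp
  have e2 : x + ((2 : ℝ) • J.1 + q) = x + (2 : ℝ) • J.1 + q := by abel
  have e3 : 2 * (Real.pi : ℂ) * Complex.I *
      ((inner ℝ ζ ((phaseEquiv d).symm ((x, ξ) + halfX d ((2 : ℝ) • J.1 + q))) : ℝ) : ℂ) =
      Complex.I * ((2 * inner ℝ J.1 ξ - 2 * inner ℝ J.2 (x + J.1 + (1 / 2 : ℝ) • q) : ℝ) : ℂ) := by
    rw [show 2 * (Real.pi : ℂ) * Complex.I *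
      ((inner ℝ ζ ((phaseEquiv d).symm ((x, ξ) + halfX d ((2 : ℝ) • J.1 + q))) : ℝ) : ℂ) =
      Complex.I * ((2 * Real.pi * inner ℝ ζ ((phaseEquiv d).symm ((x, ξ) +
        halfX d ((2 : ℝ) • J.1 + q))) : ℝ) : ℂ) by push_cast; ring, two_pi_mul_inner, ← hJ,
      halfX_apply]
    congr 3
    · simp
    · simp only [Prod.fst_add, smul_add, smul_smul]
      norm_num [add_assoc]
  rw [e1, e2, e3, waveFactor, ← hJ]
  have e4 : ∀ A B C D β υ : ℂ, A + B = C + D →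
      Complex.exp A * (Complex.exp B * β * υ) = Complex.exp C * (Complex.exp D * (β * υ)) := by
    intro A B C D β υ h
    have := congrArg Complex.exp h
    rw [Complex.exp_add, Complex.exp_add] at this
    linear_combination β * υ * this
  refine e4 _ _ _ _ _ _ ?_
  simp only [inner_add_left, inner_add_right, inner_smul_left, inner_smul_right]
  rw [real_inner_comm J.2 q]
  push_cast
  simp
  ring

lemma continuous_phi {a : Phase d → ℂ} (ha : ContDiff ℝ ∞ a) (hc : HasCompactSupport a) :
    Continuous (phi a 0) := by
  rw [phi_eq_fourier_schwartzOf ha hc]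
  exact SchwartzMap.continuous _

lemma phi_eq_exp_mul (a : Phase d → ℂ) (z : Phase d) (ζ : FPhase d) :
    phi a z ζ = Complex.exp (2 * Real.pi * Complex.I * (inner ℝ ζ ((phaseEquiv d).symm z) : ℝ)) *
      phi a 0 ζ := by
  simpa using phi_translate a 0 z ζ

lemma innerWeyl_PW {a b : Phase d → ℂ} (ha : ContDiff ℝ ∞ a) (hc : HasCompactSupport a) {r : ℕ}
    (hb : IsAmp r b) (u : 𝓢(Config d, ℂ)) (x ξ : Config d) :
    innerWeyl (PW a b 1) u x ξ = ∫ ζ, phi a 0 ζ * (waveFactor ζ x *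
      innerWeyl b u (x + (2 : ℝ) • (symJ d ζ).1) (ξ + (symJ d ζ).2)) := by
  set n := Module.finrank ℝ (Config d) + 1 with hn
  set F : Config d → FPhase d → ℂ := fun q ζ =>
    Complex.exp (-(Complex.I * (inner ℝ q ξ : ℝ))) * ((Complex.exp (2 * Real.pi * Complex.I *
      (inner ℝ ζ ((phaseEquiv d).symm ((x, ξ) + halfX d q)) : ℝ)) * phi a 0 ζ *
        b ((x, ξ) + halfX d q + symJ d ζ)) * u (x + q)) with hF
  obtain ⟨B, hB, hBb⟩ := hb.exists_norm_le
  obtain ⟨C, hC, h⟩ := exists_norm_mul_schwartz_le u r (max ‖x‖ ‖ξ‖)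
  have hint : Integrable (Function.uncurry F) (volume.prod volume) := by
    have h1 : Integrable fun q : Config d => ((1 + ‖q‖ ^ 2) ^ n)⁻¹ :=
      integrable_inv_one_add_sq_pow (by omega)
    have h2 := (integrable_norm_phi_mul ha hc r).const_mul
      (C * (B * (2 * (1 + ‖symJ d‖ ^ 2)) ^ r))
    refine (h1.mul_prod h2).mono' ?_ (Eventually.of_forall fun p => ?_)
    · have c1 := continuous_phi ha hc
      have c2 := hb.1.continuous
      have c3 : Continuous ((phaseEquiv d).symm) := (phaseEquiv d).symm.continuous
      refine Continuous.aestronglyMeasurable ?_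
      simp only [hF, Function.uncurry_def]
      fun_prop
    · obtain ⟨q, ζ⟩ := p
      have h3 : ∀ z, ‖b (z + symJ d ζ)‖ ≤
          B * (2 * (1 + ‖symJ d‖ ^ 2) * (1 + ‖ζ‖ ^ 2)) ^ r * (1 + ‖z‖ ^ 2) ^ r := by
        intro z
        refine (hBb _).trans ?_
        rw [mul_assoc, ← mul_pow]
        gcongr
        calc _ ≤ 2 * ((1 + ‖z‖ ^ 2) * (1 + ‖symJ d ζ‖ ^ 2)) := one_add_sq_add_le _ _
          _ ≤ 2 * ((1 + ‖z‖ ^ 2) * ((1 + ‖symJ d‖ ^ 2) * (1 + ‖ζ‖ ^ 2))) := by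
              gcongr
              exact one_add_mul_sq_le ((symJ d).le_opNorm ζ)
          _ = _ := by ring
      have h4 := h (fun z => b (z + symJ d ζ)) _ h3 x ξ (le_max_left _ _) (le_max_right _ _) q
      simp only [hF, Function.uncurry_apply_pair]
      rw [norm_mul, norm_exp_neg_I_mul, one_mul]
      have h5 : ‖Complex.exp (2 * Real.pi * Complex.I *
          (inner ℝ ζ ((phaseEquiv d).symm ((x, ξ) + halfX d q)) : ℝ)) * phi a 0 ζ‖ =
            ‖phi a 0 ζ‖ := by
        rw [← phi_eq_exp_mul, norm_phi]
      rw [mul_assoc, norm_mul, h5]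
      calc _ ≤ ‖phi a 0 ζ‖ * (C * (B * (2 * (1 + ‖symJ d‖ ^ 2) * (1 + ‖ζ‖ ^ 2)) ^ r) *
            ((1 + ‖q‖ ^ 2) ^ n)⁻¹) := by gcongr
        _ = _ := by rw [mul_pow _ (1 + ‖ζ‖ ^ 2)]; ring
  have e1 : innerWeyl (PW a b 1) u x ξ = ∫ q, ∫ ζ, F q ζ := by
    rw [innerWeyl]
    congr 1
    funext q
    simp only [hF]
    rw [integral_const_mul, integral_mul_const, PW_eq_integral_phi]
    simp only [one_smul, phi_eq_exp_mul a ((x, ξ) + halfX d q)]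
  rw [e1, integral_integral_swap hint]
  congr 1
  funext ζ
  rw [← innerWeyl_planeWave, innerWeyl, ← integral_const_mul]
  congr 1
  funext q
  simp only [hF]
  ring

/-- The Weyl quantization of a twisted product, as a superposition of translations and
multiplications applied to the Weyl quantization of the right factor. -/
lemma weylOp_PW {a b : Phase d → ℂ} (ha : ContDiff ℝ ∞ a) (hc : HasCompactSupport a) {r : ℕ}
    (hb : IsAmp r b) (u : 𝓢(Config d, ℂ)) (x : Config d) :
    weylOp (PW a b 1) u x = ∫ ζ, phi a 0 ζ * (waveFactor ζ x *
      weylOp b u (x + (2 : ℝ) • (symJ d ζ).1)) := by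
  set n := Module.finrank ℝ (Config d) + 1 with hn
  set F : Config d → FPhase d → ℂ := fun ξ ζ => phi a 0 ζ * (waveFactor ζ x *
      innerWeyl b u (x + (2 : ℝ) • (symJ d ζ).1) (ξ + (symJ d ζ).2)) with hF
  obtain ⟨M, C, hC, h⟩ := exists_norm_innerWeyl_le u r n
  obtain ⟨B, hB, hBb⟩ := hb.exists_bound M
  set P : ℝ := 1 + (2 * ‖symJ d‖) ^ 2 with hP
  have hP1 : ∀ ζ, 1 + ‖(2 : ℝ) • (symJ d ζ).1‖ ^ 2 ≤ P * (1 + ‖ζ‖ ^ 2) := by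
    intro ζ
    refine one_add_mul_sq_le ?_
    rw [norm_smul, Real.norm_of_nonneg zero_le_two, mul_assoc]
    gcongr
    exact (norm_fst_le _).trans ((symJ d).le_opNorm ζ)
  have hP2 : ∀ ζ, 1 + ‖(symJ d ζ).2‖ ^ 2 ≤ P * (1 + ‖ζ‖ ^ 2) := by
    intro ζ
    refine one_add_mul_sq_le ?_
    refine ((norm_snd_le _).trans ((symJ d).le_opNorm ζ)).trans ?_
    nlinarith [norm_nonneg (symJ d), norm_nonneg ζ,
      mul_nonneg (norm_nonneg (symJ d)) (norm_nonneg ζ)]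
  have hint : Integrable (Function.uncurry F) (volume.prod volume) := by
    have h1 : Integrable fun ξ : Config d => ((1 + ‖ξ‖ ^ 2) ^ n)⁻¹ :=
      integrable_inv_one_add_sq_pow (by omega)
    have h2 := (integrable_norm_phi_mul ha hc (r + n)).const_mul
      (C * B * (2 * (1 + ‖x‖ ^ 2) * P) ^ r * (2 * P) ^ n)
    refine (h1.mul_prod h2).mono' ?_ (Eventually.of_forall fun p => ?_)
    · have c1 := continuous_phi ha hc
      have c2 := continuous_innerWeyl hb u
      refine Continuous.aestronglyMeasurable ?_
      simp only [hF, Function.uncurry_def, waveFactor]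
      refine (c1.comp continuous_snd).mul (Continuous.mul (by fun_prop) ?_)
      exact c2.comp (f := fun p : Config d × FPhase d =>
        (x + (2 : ℝ) • (symJ d p.2).1, p.1 + (symJ d p.2).2)) (by fun_prop)
    · obtain ⟨ξ, ζ⟩ := p
      simp only [hF, Function.uncurry_apply_pair]
      rw [norm_mul, norm_mul, norm_waveFactor, one_mul]
      have h3 : (1 + ‖x + (2 : ℝ) • (symJ d ζ).1‖ ^ 2) ^ r ≤
          (2 * (1 + ‖x‖ ^ 2) * P * (1 + ‖ζ‖ ^ 2)) ^ r := by
        refine pow_le_pow_left₀ (by positivity) ?_ r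
        calc _ ≤ 2 * ((1 + ‖x‖ ^ 2) * (1 + ‖(2 : ℝ) • (symJ d ζ).1‖ ^ 2)) := one_add_sq_add_le _ _
          _ ≤ 2 * ((1 + ‖x‖ ^ 2) * (P * (1 + ‖ζ‖ ^ 2))) := by
              gcongr
              exact hP1 ζ
          _ = _ := by ring
      have h4 : ((1 + ‖ξ + (symJ d ζ).2‖ ^ 2) ^ n)⁻¹ ≤
          (2 * P * (1 + ‖ζ‖ ^ 2)) ^ n * ((1 + ‖ξ‖ ^ 2) ^ n)⁻¹ := by
        rw [← div_eq_mul_inv, le_div_iff₀ (by positivity), inv_mul_le_iff₀ (by positivity),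
          ← mul_pow]
        refine pow_le_pow_left₀ (by positivity) ?_ n
        have h5 := one_add_sq_add_le (ξ + (symJ d ζ).2) (-(symJ d ζ).2)
        rw [add_neg_cancel_right, norm_neg] at h5
        calc _ ≤ 2 * ((1 + ‖ξ + (symJ d ζ).2‖ ^ 2) * (1 + ‖(symJ d ζ).2‖ ^ 2)) := h5
          _ ≤ 2 * ((1 + ‖ξ + (symJ d ζ).2‖ ^ 2) * (P * (1 + ‖ζ‖ ^ 2))) := by
              gcongr
              exact hP2 ζ
          _ = _ := by ring
      calc _ ≤ ‖phi a 0 ζ‖ * (C * B * (2 * (1 + ‖x‖ ^ 2) * P * (1 + ‖ζ‖ ^ 2)) ^ r *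
            ((2 * P * (1 + ‖ζ‖ ^ 2)) ^ n * ((1 + ‖ξ‖ ^ 2) ^ n)⁻¹)) := by
            gcongr
            refine (h b hb B hBb _ _).trans ?_
            gcongr
        _ = _ := by
            rw [mul_pow _ (1 + ‖ζ‖ ^ 2), mul_pow _ (1 + ‖ζ‖ ^ 2), pow_add (1 + ‖ζ‖ ^ 2)]
            ring
  rw [weylOp]
  simp only [innerWeyl_PW ha hc hb]
  rw [integral_integral_swap hint, ← integral_const_mul]
  congr 1
  funext ζ
  simp only [hF]
  rw [integral_const_mul, integral_const_mul, integral_add_right_eq_self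
    (fun ξ => innerWeyl b u (x + (2 : ℝ) • (symJ d ζ).1) ξ), weylOp]
  ring

lemma PW_one_right {a : Phase d → ℂ} (ha : ContDiff ℝ ∞ a) (hc : HasCompactSupport a) :
    PW a (fun _ => 1) 1 = a := by
  funext z
  have hb : IsAmp 0 (fun _ : Phase d => (1 : ℂ)) := isAmp_const 1
  have haA : IsAmp 0 a := by
    refine ⟨ha, fun k => ?_⟩
    obtain ⟨C, hC⟩ := ((ha.continuous_iteratedFDeriv (m := k)
      (by exact_mod_cast le_top)).norm).bounded_above_of_compact_support
        ((hc.iteratedFDeriv (𝕜 := ℝ) k).norm)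
    exact ⟨C, fun z => by simpa using hC z⟩
  have h := T_zero haA hb z
  rw [T_eq_PW haA hc hb, mul_one] at h
  exact h

/-- Composition for a compactly supported left factor. By `weylOp_PW` with the right factor `1`, whose
quantization is the identity, `weylOp a` is itself a superposition of translations and
multiplications; applied to `weylOp b u` it gives the right side of `weylOp_PW`. -/
lemma weylOp_PW_eq_comp {a b : Phase d → ℂ} (ha : ContDiff ℝ ∞ a) (hc : HasCompactSupport a)
    {r : ℕ} (hb : IsAmp r b) (u : 𝓢(Config d, ℂ)) (x : Config d) :
    weylOp (PW a b 1) u x = weylOp a (weylS hb u) x := by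
  have h := weylOp_PW ha hc (isAmp_const 1) (weylS hb u) x
  rw [PW_one_right ha hc] at h
  rw [h, weylOp_PW ha hc hb]
  simp only [weylOp_one]
  rfl

lemma weightBound_of_le {M r : ℕ} {A : ℝ} (hA0 : 0 ≤ A) {a : Phase d → ℂ}
    (hA : ∀ k ≤ M, ∀ z, ‖iteratedFDeriv ℝ k a z‖ ≤ A * (1 + ‖z‖ ^ 2) ^ r) :
    WeightBound M 0 1 (2 * r) A a := by
  intro k hk z
  rw [one_pow, mul_one, one_smul, zero_mul, sub_zero]
  exact (hA k hk z).trans (mul_le_mul_of_nonneg_left (one_add_sq_pow_le_japanese r z) hA0)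

/-- Continuity of the twisted product on amplitudes: the estimate of the remainder of order `0` with
the constants `δ = 0` and `h = 1`. -/
lemma exists_norm_iteratedFDeriv_T_le (k r : ℕ) :
    ∃ (M : ℕ) (C : ℝ), 0 ≤ C ∧ ∀ τ ∈ Icc (0 : ℝ) 1, ∀ a b : Phase d → ℂ,
      IsAmp r a → IsAmp r b → ∀ A B : ℝ, 0 ≤ A → 0 ≤ B →
      (∀ k ≤ M, ∀ z, ‖iteratedFDeriv ℝ k a z‖ ≤ A * (1 + ‖z‖ ^ 2) ^ r) →
      (∀ k ≤ M, ∀ z, ‖iteratedFDeriv ℝ k b z‖ ≤ B * (1 + ‖z‖ ^ 2) ^ r) →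
      ∀ z, ‖iteratedFDeriv ℝ k (T a b τ) z‖ ≤ C * (A * B) * (1 + ‖z‖ ^ 2) ^ (2 * r) := by
  obtain ⟨M, C, hC, h⟩ := exists_norm_iteratedFDeriv_moyalRem_le (d := d) le_rfl k 0 r
    (2 * r) (2 * r)
  refine ⟨M, C * 2 ^ (2 * r), by positivity, fun τ hτ a b ha hb A B hA0 hB0 hA hB z => ?_⟩
  have h1 := h 1 ⟨one_pos, le_rfl⟩ τ hτ a b ha hb A B (weightBound_of_le hA0 hA)
    (weightBound_of_le hB0 hB) z
  have h2 : moyalRem 0 a b τ = T a b τ := by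
    funext z
    simp [moyalRem]
  rw [h2, one_pow, mul_one, one_smul, zero_mul, sub_zero,
    show (2 * r + 2 * r : ℝ) = ((2 * (2 * r) : ℕ) : ℝ) by push_cast; ring,
    Real.rpow_natCast, pow_mul] at h1
  refine h1.trans ?_
  calc _ ≤ C * (A * B) * (2 * (1 + ‖z‖ ^ 2)) ^ (2 * r) := by
        gcongr
        exact japanese_sq_le z
    _ = _ := by rw [mul_pow]; ring

lemma isAmp_T {r : ℕ} {a b : Phase d → ℂ} (ha : IsAmp r a) (hb : IsAmp r b) {τ : ℝ}
    (hτ : τ ∈ Icc (0 : ℝ) 1) : IsAmp (2 * r) (T a b τ) := by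
  refine ⟨contDiff_T ha hb hτ, fun k => ?_⟩
  obtain ⟨M, C, -, h⟩ := exists_norm_iteratedFDeriv_T_le (d := d) k r
  obtain ⟨A, hA0, hA⟩ := ha.exists_bound M
  obtain ⟨B, hB0, hB⟩ := hb.exists_bound M
  exact ⟨_, h τ hτ a b ha hb A B hA0 hB0 hA hB⟩

/-- The twisted product at `τ = 1` is the Weyl product. -/
lemma weylOp_T {r : ℕ} {a b : Phase d → ℂ} (ha : IsAmp r a) (hb : IsAmp r b)
    (u : 𝓢(Config d, ℂ)) (x : Config d) :
    weylOp (T a b 1) u x = weylOp a (weylS hb u) x := by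
  have h := isApprox_trunc ha
  have h1 : (1 : ℝ) ∈ Icc (0 : ℝ) 1 := ⟨zero_le_one, le_rfl⟩
  have hPW : ∀ n, PW (trunc a n) b 1 = T (trunc a n) b 1 := fun n => by
    funext z
    rw [T_eq_PW (h.isAmp_apply n) (h.hasCompactSupport n) hb]
  have hlim : AmpTendsto (2 * r) (fun n => PW (trunc a n) b 1) (T a b 1) := by
    refine ⟨fun n => ?_, fun k => ?_, fun z => h.tendsto_PW hb 1 z⟩
    · rw [hPW]
      exact isAmp_T (h.isAmp_apply n) hb h1
    · obtain ⟨M, C, -, hM⟩ := exists_norm_iteratedFDeriv_T_le (d := d) k r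
      obtain ⟨A, hA0, hA⟩ := h.exists_bound M
      obtain ⟨B, hB0, hB⟩ := hb.exists_bound M
      refine ⟨C * (A * B), fun n z => ?_⟩
      rw [hPW]
      exact hM 1 h1 _ b (h.isAmp_apply n) hb A B hA0 hB0 (fun k hk z => hA k hk n z) hB z
  refine tendsto_nhds_unique (hlim.weylOp u x) ?_
  simp only [weylOp_PW_eq_comp (h.contDiff _) (h.hasCompactSupport _) hb]
  exact h.ampTendsto.weylOp (weylS hb u) x

end Composition

/-! ### Uniqueness of Weyl symbols -/

section Uniqueness

open scoped FourierTransform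

variable {d : ℕ}

/-- The Schwartz function `y ↦ g(x + y)` for a real test function `g`. -/
def testShift {g : Config d → ℝ} (hg : ContDiff ℝ ∞ g) (hc : HasCompactSupport g)
    (x : Config d) : 𝓢(Config d, ℂ) :=
  HasCompactSupport.toSchwartzMap (f := fun y => ((g (x + y) : ℝ) : ℂ))
    ((hc.comp_homeomorph (Homeomorph.addLeft x)).comp_left (g := fun t : ℝ => (t : ℂ)) rfl)
    (Complex.ofRealCLM.contDiff.comp (hg.comp (contDiff_const.add contDiff_id)))

lemma testShift_apply {g : Config d → ℝ} (hg : ContDiff ℝ ∞ g) (hc : HasCompactSupport g)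
    (x y : Config d) : testShift hg hc x y = ((g (x + y) : ℝ) : ℂ) := rfl

lemma innerWeyl_testShift {g : Config d → ℝ} (hg : ContDiff ℝ ∞ g) (hc : HasCompactSupport g)
    (c : Phase d → ℂ) (x ξ : Config d) :
    innerWeyl c (testShift hg hc x) x ξ =
      Complex.exp (Complex.I * (inner ℝ ((2 : ℝ) • x) ξ : ℝ)) *
        innerWeyl c (testShift hg hc 0) 0 ξ := by
  rw [innerWeyl, ← integral_add_left_eq_self _ (-((2 : ℝ) • x)), innerWeyl, ← integral_const_mul]
  congr 1
  funext q
  have e1 : (x, ξ) + halfX d (-((2 : ℝ) • x) + q) = (0, ξ) + halfX d q := by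
    rw [halfX_apply, halfX_apply]
    ext1
    · simp only [Prod.fst_add]
      module
    · simp
  have e2 : x + (x + (-((2 : ℝ) • x) + q)) = 0 + (0 + q) := by module
  rw [e1, testShift_apply, testShift_apply, e2, inner_add_left, inner_neg_left]
  rw [← mul_assoc, ← mul_assoc, ← mul_assoc, ← Complex.exp_add]
  congr 3
  push_cast
  ring

/-- An amplitude is determined by its Weyl quantization. The value at `x` of the operator applied
to `y ↦ g(x + y)` is a Fourier transform in `x` of `∫ e^{-i⟨q, ξ⟩} c(q/2, ξ) g(q) dq`, so these
integrals vanish for all test functions `g`. -/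
lemma eq_zero_of_weylOp_eq_zero {r : ℕ} {c : Phase d → ℂ} (hc : IsAmp r c)
    (h : ∀ (u : 𝓢(Config d, ℂ)) (x : Config d), weylOp c u x = 0) (z : Phase d) : c z = 0 := by
  have key : ∀ (g : Config d → ℝ) (hg : ContDiff ℝ ∞ g) (hgc : HasCompactSupport g)
      (ξ : Config d), innerWeyl c (testShift hg hgc 0) 0 ξ = 0 := by
    intro g hg hgc
    set Φ : Config d → ℂ := fun ξ => innerWeyl c (testShift hg hgc 0) 0 ξ with hΦ
    have hint : Integrable Φ := integrable_innerWeyl_right hc _ 0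
    have hcont : Continuous Φ := by
      have := continuous_innerWeyl hc (testShift hg hgc 0)
      fun_prop
    have hF : 𝓕 Φ = 0 := by
      funext w
      have h1 := h (testShift hg hgc (-(Real.pi • w))) (-(Real.pi • w))
      rw [weylOp, mul_eq_zero] at h1
      have h2 := h1.resolve_left (by
        rw [inv_eq_zero, Complex.ofReal_eq_zero]
        positivity)
      rw [Real.fourier_eq', Pi.zero_apply, ← h2]
      congr 1
      funext ξ
      rw [innerWeyl_testShift, smul_eq_mul]
      congr 2
      rw [real_inner_comm, smul_neg, inner_neg_left, smul_smul, inner_smul_left]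
      push_cast
      simp
      ring
    have h3 := hcont.fourierInv_fourier_eq hint (by rw [hF]; exact integrable_zero _ _ _)
    intro ξ
    have h4 := congrFun h3 ξ
    rw [hF, Real.fourierInv_eq'] at h4
    simpa using h4.symm
  obtain ⟨m, ξ⟩ := z
  set f : Config d → ℂ := fun q =>
    Complex.exp (-(Complex.I * (inner ℝ q ξ : ℝ))) * c ((0, ξ) + halfX d q) with hf
  have hfc : Continuous f := by
    have := hc.1.continuous
    fun_prop
  have hae : f =ᵐ[volume] 0 := by
    refine ae_eq_zero_of_integral_contDiff_smul_eq_zero hfc.locallyIntegrable fun g hg hgc => ?_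
    rw [← key g hg hgc ξ, innerWeyl]
    congr 1
    funext q
    rw [testShift_apply, zero_add, zero_add, hf, Complex.real_smul]
    ring
  have h0 := congrFun ((hfc.ae_eq_iff_eq volume continuous_const).1 hae) ((2 : ℝ) • m)
  have h1 : (0, ξ) + halfX d ((2 : ℝ) • m) = (m, ξ) := by
    rw [halfX_apply, smul_smul]
    norm_num
  simp only [hf, h1] at h0
  exact (mul_eq_zero.1 h0).resolve_left (Complex.exp_ne_zero _)

lemma eq_of_weylOp_eq {r : ℕ} {c c' : Phase d → ℂ} (hc : IsAmp r c) (hc' : IsAmp r c')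
    (h : ∀ (u : 𝓢(Config d, ℂ)) (x : Config d), weylOp c u x = weylOp c' u x) : c = c' := by
  have hA : ∀ i : Bool, IsAmp r (cond i c c') := fun i => by cases i <;> assumption
  -- the difference `c - c'`, as a sum over two indices
  set e : Phase d → ℂ := fun z => ∑ i : Bool, cond i 1 (-1) * cond i c c' z with he
  have h0 := eq_zero_of_weylOp_eq_zero (c := e)
    (IsAmp.sum _ fun i _ => (hA i).const_mul _) fun u x => by
      rw [he, weylOp_sum_left _ hA]
      simp [h u x]
  funext z
  have := h0 z
  simp only [he, Fintype.sum_bool, cond_true, cond_false] at this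
  linear_combination this

lemma WeylMapsTo.unique {c : Phase d → ℂ} {u v w : 𝓢(Config d, ℂ)} (hv : WeylMapsTo c u v)
    (hw : WeylMapsTo c u w) : v = w := by
  let ψ : ContDiffBump (0 : Config d) := default
  have h1 : ContDiff ℝ ∞ fun ξ => ((ψ ξ : ℝ) : ℂ) := Complex.ofRealCLM.contDiff.comp ψ.contDiff
  have h2 : HasCompactSupport fun ξ => ((ψ ξ : ℝ) : ℂ) :=
    ψ.hasCompactSupport.comp_left (g := fun t : ℝ => (t : ℂ)) rfl
  have h3 : ∀ᶠ ξ in 𝓝 0, ((ψ ξ : ℝ) : ℂ) = 1 := by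
    filter_upwards [ψ.eventuallyEq_one] with ξ hξ
    simp [hξ]
  ext x
  exact tendsto_nhds_unique (hv _ h1 h2 h3 x) (hw _ h1 h2 h3 x)

lemma WeylMapsTo.eq_weylS {r : ℕ} {c : Phase d → ℂ} (hc : IsAmp r c) {u v : 𝓢(Config d, ℂ)}
    (hv : WeylMapsTo c u v) : v = weylS hc u := hv.unique (weylMapsTo_weylS hc u)

end Uniqueness

/-! ### Shubin symbols as amplitudes -/

section Shubin

variable {d : ℕ}

lemma japanese_smul_le {h : ℝ} (hh : h ∈ Ioc (0 : ℝ) 1) (z : Phase d) :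
    japanese (h • z) ≤ japanese z := by
  refine Real.sqrt_le_sqrt ?_
  have h1 : h ^ 2 ≤ 1 := pow_le_one₀ hh.1.le hh.2
  simp only [Prod.smul_fst, Prod.smul_snd, norm_smul, mul_pow, Real.norm_eq_abs, sq_abs]
  nlinarith [sq_nonneg ‖z.1‖, sq_nonneg ‖z.2‖]

lemma mul_japanese_le {h : ℝ} (hh : h ∈ Ioc (0 : ℝ) 1) (z : Phase d) :
    h * japanese z ≤ japanese (h • z) := by
  refine Real.le_sqrt_of_sq_le ?_
  have h1 : h ^ 2 ≤ 1 := pow_le_one₀ hh.1.le hh.2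
  rw [mul_pow, japanese_sq]
  simp only [Prod.smul_fst, Prod.smul_snd, norm_smul, mul_pow, Real.norm_eq_abs, sq_abs]
  linarith

lemma japanese_smul_rpow_le {h : ℝ} (hh : h ∈ Ioc (0 : ℝ) 1) (s : ℝ) (z : Phase d) :
    japanese (h • z) ^ s ≤ h ^ (-|s|) * japanese z ^ s := by
  have h1 := japanese_pos z
  have h2 := japanese_pos (h • z)
  rcases le_total 0 s with hs | hs
  · rw [abs_of_nonneg hs]
    have : 1 ≤ h ^ (-s) := Real.one_le_rpow_of_pos_of_le_one_of_nonpos hh.1 hh.2 (by linarith)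
    have h3 := Real.rpow_le_rpow h2.le (japanese_smul_le hh z) hs
    have h4 : 0 ≤ japanese z ^ s := by positivity
    nlinarith
  · rw [abs_of_nonpos hs, neg_neg, ← Real.mul_rpow hh.1.le h1.le]
    exact Real.rpow_le_rpow_of_nonpos (mul_pos hh.1 h1) (mul_japanese_le hh z) hs

lemma isAmp_of_isShubin {k : ℝ} {c : Phase d → ℂ} (hc : IsShubin k c) {r : ℕ} (hr : k ≤ 2 * r) :
    IsAmp r c := by
  refine ⟨hc.1, fun j => ?_⟩
  obtain ⟨C, hC⟩ := hc.2 j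
  refine ⟨|C| * 2 ^ r, fun z => (hC z).trans ?_⟩
  have h0 := japanese_pos z
  calc C * japanese z ^ (k - (j : ℝ)) ≤ |C| * japanese z ^ (k - (j : ℝ)) := by
        gcongr
        exact le_abs_self C
    _ ≤ |C| * japanese z ^ ((2 * r : ℕ) : ℝ) := by
        gcongr
        · exact one_le_japanese z
        · push_cast
          linarith [Nat.cast_nonneg (α := ℝ) j]
    _ = |C| * (japanese z ^ 2) ^ r := by rw [Real.rpow_natCast, pow_mul]
    _ ≤ |C| * (2 * (1 + ‖z‖ ^ 2)) ^ r := by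
        gcongr
        exact japanese_sq_le z
    _ = _ := by rw [mul_pow]; ring

/-- Each member of a family of `h`-Shubin symbols is a Shubin symbol of the same order, with
constants that depend on `h`. -/
lemma IsHShubin.isShubin {m : ℝ} {a : ℝ → Phase d → ℂ} (ha : IsHShubin m a) {h : ℝ}
    (hh : h ∈ Ioc (0 : ℝ) 1) : IsShubin m (a h) := by
  refine ⟨ha.1 h hh, fun k => ?_⟩
  obtain ⟨C, hC⟩ := ha.2 k
  refine ⟨|C| * h ^ k * h ^ (-|m - (k : ℝ)|), fun z => (hC h hh z).trans ?_⟩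
  have h0 := hh.1
  have h1 := japanese_pos (h • z)
  calc C * h ^ k * japanese (h • z) ^ (m - (k : ℝ))
      ≤ |C| * h ^ k * (h ^ (-|m - (k : ℝ)|) * japanese z ^ (m - (k : ℝ))) := by
        gcongr
        · exact le_abs_self C
        · exact japanese_smul_rpow_le hh _ z
    _ = _ := by ring

lemma IsHShubin.exists_weightBound {m : ℝ} {a : ℝ → Phase d → ℂ} (ha : IsHShubin m a) (M : ℕ) :
    ∃ A : ℝ, ∀ h ∈ Ioc (0 : ℝ) 1, WeightBound M 1 h m A (a h) := by
  choose C hC using ha.2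
  refine ⟨∑ k ∈ Finset.range (M + 1), |C k|, fun h hh k hk z => (hC k h hh z).trans ?_⟩
  have h0 := hh.1
  have h1 := japanese_pos (h • z)
  rw [one_mul]
  gcongr
  exact (le_abs_self _).trans (Finset.single_le_sum (f := fun k => |C k|)
    (fun _ _ => abs_nonneg _) (Finset.mem_range.2 (by omega)))

lemma IsHShubin.congr {m : ℝ} {a b : ℝ → Phase d → ℂ} (ha : IsHShubin m a)
    (hab : ∀ h ∈ Ioc (0 : ℝ) 1, b h = a h) : IsHShubin m b := by
  refine ⟨fun h hh => hab h hh ▸ ha.1 h hh, fun k => ?_⟩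
  obtain ⟨C, hC⟩ := ha.2 k
  exact ⟨C, fun h hh z => by rw [hab h hh]; exact hC h hh z⟩

end Shubin

/-! ### The Weyl product -/

section WeylProduct

variable {d : ℕ}

/-- There is at most one Weyl product. -/
lemma IsWeylProduct.unique {a b c c' : Phase d → ℂ} (hc : IsWeylProduct a b c)
    (hc' : IsWeylProduct a b c') : c = c' := by
  obtain ⟨⟨k, hk⟩, h⟩ := hc
  obtain ⟨⟨k', hk'⟩, h'⟩ := hc'
  obtain ⟨s, hs⟩ := exists_nat_ge (max k k' / 2)
  have h1 := isAmp_of_isShubin hk (r := s) (by linarith [le_max_left k k'])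
  have h1' := isAmp_of_isShubin hk' (r := s) (by linarith [le_max_right k k'])
  refine eq_of_weylOp_eq h1 h1' fun u x => ?_
  obtain ⟨v, w, hv, hw, hcw⟩ := h u
  obtain ⟨v', w', hv', hw', hcw'⟩ := h' u
  have e1 : w = w' := by
    rw [hv.unique hv'] at hw
    exact hw.unique hw'
  have e2 := (hcw.eq_weylS h1).symm.trans (e1.trans (hcw'.eq_weylS h1'))
  exact congrArg (fun f : 𝓢(Config d, ℂ) => f x) e2

/-- The twisted product at `τ = 1` is the Weyl product as soon as it is a Shubin symbol. -/
lemma isWeylProduct_T {r : ℕ} {a b : Phase d → ℂ} (ha : IsAmp r a) (hb : IsAmp r b) {k : ℝ}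
    (hT : IsShubin k (T a b 1)) : IsWeylProduct a b (T a b 1) := by
  refine ⟨⟨k, hT⟩, fun u => ⟨weylS hb u, weylS ha (weylS hb u), weylMapsTo_weylS hb u,
    weylMapsTo_weylS ha _, ?_⟩⟩
  exact weylMapsTo_of_eq (isAmp_T ha hb ⟨zero_le_one, le_rfl⟩) fun x => (weylOp_T ha hb u x).symm

/-- A gain of `h^{2N}` and of `2N` orders, in the form of the estimates of the Moyal remainders. -/
lemma isHPowShubin_of_norm_le (N : ℕ) {s : ℝ} {f : ℝ → Phase d → ℂ}
    (hf : ∀ h ∈ Ioc (0 : ℝ) 1, ContDiff ℝ ∞ (f h))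
    (hb : ∀ k : ℕ, ∃ C : ℝ, ∀ h ∈ Ioc (0 : ℝ) 1, ∀ z, ‖iteratedFDeriv ℝ k (f h) z‖ ≤
      C * h ^ (k + 2 * N) * japanese (h • z) ^ (s - 1 * (k + 2 * N))) :
    IsHPowShubin (2 * N) (s - 2 * N) f := by
  refine ⟨fun h hh => contDiff_const.mul (hf h hh), fun k => ?_⟩
  obtain ⟨C, hC⟩ := hb k
  refine ⟨C, fun h hh z => ?_⟩
  have h0 : h ^ (-(2 * N : ℝ)) * h ^ (k + 2 * N) = h ^ k := by
    rw [pow_add, Real.rpow_neg hh.1.le, show (2 * N : ℝ) = ((2 * N : ℕ) : ℝ) by push_cast; rfl,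
      Real.rpow_natCast]
    have := (pow_pos hh.1 (2 * N)).ne'
    field_simp
  have h1 : 0 < h ^ (-(2 * N : ℝ)) := Real.rpow_pos_of_pos hh.1 _
  have h2 : iteratedFDeriv ℝ k (fun z => ((h ^ (-(2 * N : ℝ)) : ℝ) : ℂ) * f h z) z =
      ((h ^ (-(2 * N : ℝ)) : ℝ) : ℂ) • iteratedFDeriv ℝ k (f h) z :=
    iteratedFDeriv_const_smul_apply' (a := ((h ^ (-(2 * N : ℝ)) : ℝ) : ℂ)) ((hf h hh).of_le (by exact_mod_cast le_top)).contDiffAt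
  rw [h2, norm_smul, Complex.norm_real, Real.norm_of_nonneg h1.le]
  refine (mul_le_mul_of_nonneg_left (hC h hh z) h1.le).trans (le_of_eq ?_)
  rw [show s - 1 * ((k : ℝ) + 2 * N) = s - 2 * N - k by ring, ← h0]
  ring

lemma exists_forall_isAmp {m n : ℝ} {a b : ℝ → Phase d → ℂ} (ha : IsHShubin m a)
    (hb : IsHShubin n b) : ∃ r : ℕ, ∀ h ∈ Ioc (0 : ℝ) 1, IsAmp r (a h) ∧ IsAmp r (b h) := by
  obtain ⟨r, hr⟩ := exists_nat_ge (max m n / 2)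
  exact ⟨r, fun h hh =>
    ⟨isAmp_of_isShubin (ha.isShubin hh) (by linarith [le_max_left m n]),
      isAmp_of_isShubin (hb.isShubin hh) (by linarith [le_max_right m n])⟩⟩

lemma isHPowShubin_moyalRem {m n : ℝ} {a b : ℝ → Phase d → ℂ} (ha : IsHShubin m a)
    (hb : IsHShubin n b) (N : ℕ) :
    IsHPowShubin (2 * N) (m + n - 2 * N) fun h => moyalRem N (a h) (b h) 1 := by
  obtain ⟨r, hr⟩ := exists_forall_isAmp ha hb
  have h1 : (1 : ℝ) ∈ Icc (0 : ℝ) 1 := ⟨zero_le_one, le_rfl⟩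
  refine isHPowShubin_of_norm_le N
    (fun h hh => contDiff_moyalRem N (hr h hh).1 (hr h hh).2 h1) fun k => ?_
  obtain ⟨M, C, -, hC⟩ := exists_norm_iteratedFDeriv_moyalRem_le (d := d) zero_le_one k N r m n
  obtain ⟨A, hA⟩ := ha.exists_weightBound M
  obtain ⟨B, hB⟩ := hb.exists_weightBound M
  exact ⟨C * (A * B), fun h hh =>
    hC h hh 1 h1 (a h) (b h) (hr h hh).1 (hr h hh).2 A B (hA h hh) (hB h hh)⟩

lemma isHPowShubin_moyal {m n : ℝ} {a b : ℝ → Phase d → ℂ} (ha : IsHShubin m a)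
    (hb : IsHShubin n b) (j : ℕ) :
    IsHPowShubin (2 * j) (m + n - 2 * j) fun h => moyal j (a h) (b h) := by
  obtain ⟨r, hr⟩ := exists_forall_isAmp ha hb
  refine isHPowShubin_of_norm_le j
    (fun h hh => contDiff_moyal j (hr h hh).1.1 (hr h hh).2.1) fun k => ?_
  obtain ⟨M, C, -, hC⟩ := exists_norm_iteratedFDeriv_moyal_le (d := d) zero_le_one k j r m n
  obtain ⟨A, hA⟩ := ha.exists_weightBound M
  obtain ⟨B, hB⟩ := hb.exists_weightBound M
  exact ⟨C * (A * B), fun h hh =>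
    hC h hh (a h) (b h) (hr h hh).1 (hr h hh).2 A B (hA h hh) (hB h hh)⟩

lemma isHShubin_T {m n : ℝ} {a b : ℝ → Phase d → ℂ} (ha : IsHShubin m a)
    (hb : IsHShubin n b) : IsHShubin (m + n) fun h => T (a h) (b h) 1 := by
  have h0 := isHPowShubin_moyalRem ha hb 0
  rw [IsHPowShubin] at h0
  simpa [moyalRem] using h0

lemma isHShubin_weylTerm {m n : ℝ} {a b : ℝ → Phase d → ℂ} (ha : IsHShubin m a)
    (hb : IsHShubin n b) (j : ℕ) : IsHShubin (m + n - 2 * j) (weylTerm a b j) := by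
  refine (isHPowShubin_moyal ha hb j).congr fun h hh => funext fun z => ?_
  simp only
  rw [← weylTerm_eq_moyal j hh.1.ne' (ha.1 h hh) (hb.1 h hh), ← mul_assoc, ← Complex.ofReal_mul,
    ← Real.rpow_natCast, ← Real.rpow_add hh.1]
  simp

/-- A non-increasing sequence of orders is its own envelope. -/
lemma orderEnvelope_sub_two_mul (s : ℝ) (j : ℕ) :
    orderEnvelope (fun j : ℕ => s - 2 * (j : ℝ)) j = s - 2 * j := by
  refine le_antisymm (ciSup_le fun k => ?_) ?_
  · push_cast
    linarith [Nat.cast_nonneg (α := ℝ) k]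
  · refine le_ciSup_of_le ⟨s, ?_⟩ 0 (by simp)
    rintro _ ⟨k, rfl⟩
    simp only
    linarith [Nat.cast_nonneg (α := ℝ) (j + k)]

lemma hasAsymptoticExpansion_T {m n : ℝ} {a b : ℝ → Phase d → ℂ} (ha : IsHShubin m a)
    (hb : IsHShubin n b) {c : ℝ → Phase d → ℂ}
    (hc : ∀ h ∈ Ioc (0 : ℝ) 1, c h = T (a h) (b h) 1) :
    HasAsymptoticExpansion c (fun j : ℕ => m + n - 2 * (j : ℝ)) fun j => weylTerm a b j where
  order_tendsto := by
    refine tendsto_atBot_add_const_left _ _ ?_ |>.congr fun j => (sub_eq_add_neg _ _).symm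
    exact tendsto_neg_atTop_atBot.comp
      (tendsto_natCast_atTop_atTop.const_mul_atTop (zero_lt_two (α := ℝ)))
  contDiff h hh := hc h hh ▸ (isHShubin_T ha hb).1 h hh
  term_mem j := isHShubin_weylTerm ha hb j
  remainder_mem N _ := by
    simp only [orderEnvelope_sub_two_mul]
    rw [show m + n - 2 * ((0 : ℕ) : ℝ) - (m + n - 2 * (N : ℝ)) = 2 * N by simp]
    refine (isHPowShubin_moyalRem ha hb N).congr fun h hh => funext fun z => ?_
    simp only [hc h hh, moyalRem]
    congr 2
    refine Finset.sum_congr rfl fun j _ => ?_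
    rw [← weylTerm_eq_moyal j hh.1.ne' (ha.1 h hh) (hb.1 h hh),
      show m + n - 2 * ((0 : ℕ) : ℝ) - (m + n - 2 * (j : ℝ)) = ((2 * j : ℕ) : ℝ) by
        push_cast; ring, Real.rpow_natCast]
    simp

end WeylProduct

end ShubinCalculus

end

theorem theoremA4 (d : ℕ) (m n : ℝ) (a b : ℝ → Phase d → ℂ)
    (ha : IsHShubin m a) (hb : IsHShubin n b) :
    (∀ h ∈ Ioc (0 : ℝ) 1, ∃! c : Phase d → ℂ, IsWeylProduct (a h) (b h) c) ∧
      ∀ c : ℝ → Phase d → ℂ,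
        (∀ h ∈ Ioc (0 : ℝ) 1, IsWeylProduct (a h) (b h) (c h)) →
          IsHShubin (m + n) c ∧
            HasAsymptoticExpansion c (fun j : ℕ => m + n - 2 * (j : ℝ))
              (fun j => weylTerm a b j) := by
  obtain ⟨r, hr⟩ := exists_forall_isAmp ha hb
  have hT := isHShubin_T ha hb
  have hW : ∀ h ∈ Ioc (0 : ℝ) 1, IsWeylProduct (a h) (b h) (T (a h) (b h) 1) := fun h hh =>
    isWeylProduct_T (hr h hh).1 (hr h hh).2 (hT.isShubin hh)
  refine ⟨fun h hh => ⟨_, hW h hh, fun c hc => hc.unique (hW h hh)⟩, fun c hc => ?_⟩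
  have hcT : ∀ h ∈ Ioc (0 : ℝ) 1, c h = T (a h) (b h) 1 := fun h hh =>
    (hc h hh).unique (hW h hh)
  exact ⟨hT.congr hcT, hasAsymptoticExpansion_T ha hb hcT⟩
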